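/- Let $N$ be a nonempty $C^\infty$ manifold (possibly with boundary), $\Gamma$ a subgroup of ${\rm Diff}^\infty(N)$, $r\in\mathbb Z_{\ge0}\cup\{\infty\}$, and let $\pi:M\to S^1$ be a $C^\infty$ fiber bundle over the circle with fiber $N$ and structure group $\Gamma$ (a locally trivial bundle with a maximal atlas of local trivializations whose transition maps $\psi_q\varphi_q^{-1}$ lie in $\Gamma$). **Groups.** For any fiber bundle $\varrho:L\to B$ with fiber $N$ and structure group $\Gamma$, ${\rm Diff}^r_\varrho(L)$ is the group of $C^r$ diffeomorphisms $f$ of $L$ with $\varrho f=\underline f\,\varrho$ for some $\underline f:B\to B$ and whose restriction to each fiber, read in local trivializations, lies in $\Gamma$. A $C^r$ isotopy of $\varrho$ is a family $F=(F_t)_{t\in[0,1]}$ in ${\rm Diff}^r_\varrho(L)$ such that $(x,t)\mapsto(F_t(x),t)$ is a $C^r$ diffeomorphism of $L\times[0,1]$. Let ${\rm Diff}^r_\varrho(L)_0$ be the group of all $F_1$ with $F$ such an isotopy and $F_0={\rm id}$; let ${\rm Diff}^r_{\varrho,c}(L)_0$ be the subgroup obtained from those $F$ whose support lies in $\varrho^{-1}(K)$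 for some compact $K\subset B$; and, for $C\subset B$, let ${\rm Diff}^r_\varrho(L;C)_0$ be the subgroup obtained from those $F$ that are the identity over a neighborhood of $C$. Let $P(f)=\underline f$ for $f\in{\rm Diff}^r_\pi(M)_0$; thus ${\rm Ker}\,P=\{f\mid \underline f={\rm id}_{S^1}\}$. **The integer $k$.** Fix $p\in S^1=\mathbb R/\mathbb Z$. For an isotopy $F$ of $\pi$ let $\nu(F)=\tilde c(1)-\tilde c(0)$, where $\tilde c:[0,1]\to\mathbb R$ is any lift of the path $t\mapsto\underline{F_t}(p)$. Then $k=k(\pi,r)\ge0$ is the integer for which the values $\nu(F)$, over all $C^r$ isotopies $F$ of $\pi$ with $F_0=F_1={\rm id}_M$, form the set $k\mathbb Z$. **Assumption $(\ast)$.** For the trivial bundle $\varrho:L\to J$ over an open interval $J$ with fiber $N$ and structure group $\Gamma$, the group ${\rm Diff}^r_{\varrho,c}(L)_0$ is perfect. **Norms.** For $f\in{\rm Diff}^r_\pi(M)_0$, let $clb_\pi f\in\mathbb Z_{\ge0}\cup\{\infty\}$ be the least $m$ such that $f$ is a product of $m$ commutators $[a_i,b_i]$ with $a_i,b_i\in{\rm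 Diff}^r_\pi(M;S^1-{\rm Int}\,D_i)_0$ for closed arcs $D_i\subsetneq S^1$ (and $\infty$ if there is no such $m$). For $g$ in a group $G$, let $\zeta_g(f)$ be the least number of factors in an expression of $f\in G$ as a product of conjugates of $g$ and $g^{-1}$ ($\infty$ if there is none). $G$ is *uniformly simple relative to* a normal subgroup $\Lambda$ if there is $m\in\mathbb Z_{\ge0}$ with $\zeta_g(f)\le m$ for all $g\in G-\Lambda$ and $f\in G$; $G$ is *bounded* if every conjugation-invariant norm $G\to[0,\infty)$ is bounded; $G$ is *uniformly perfect* if there is $m$ such that every element of $G$ is a product of at most $m$ commutators. **Corollary.** Suppose $k=k(\pi,r)\ge1$ and $(N,\Gamma,r)$ satisfies Assumption $(\ast)$. Then: 1. $\sup\{clb_\pi f\mid f\in{\rm Diff}^r_\pi(M)_0\}\le k+3$. 2. $\zeta_g(f)\le4\,clb_\pi f$ for all $g\in{\rm Diff}^r_\pi(M)_0-{\rm Ker}\,P$ and $f\in{\rm Diff}^r_\pi(M)_0$. 3. ${\rm Diff}^r_\pi(M)_0$ is uniformly simple relative to ${\rm Ker}\,P$. 4. ${\rm Diff}^r_\pi(M)_0$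 is bounded. 5. ${\rm Diff}^r_\pi(M)_0$ is uniformly perfect. -/

import Mathlib

open Set Function Topology
open scoped Manifold ContDiff Pointwise

/-! ### Norms on groups -/

section GroupNorms

variable {G : Type*} [Group G]

/-- The word norm `q_(G,S)`: the least number of factors in an expression of `g` as a product of
elements of `S`, and `∞` when there is no such expression. -/
noncomputable def wordNorm (S : Set G) (g : G) : ℕ∞ :=
  ⨅ (l : List G) (_ : (∀ x ∈ l, x ∈ S) ∧ l.prod = g), (l.length : ℕ∞)

/-- The commutator length of `G`. -/
noncomputable def commLength (g : G) : ℕ∞ := wordNorm (commutatorSet G) g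

/-- The conjugation-generated norm `ζ_g`: the word norm with respect to the conjugates of `g` and
of its inverse. -/
noncomputable def conjNorm (g : G) : G → ℕ∞ := wordNorm (conjugatesOf g ∪ conjugatesOf g⁻¹)

/-- The diameter of `G` with respect to a norm `q`. -/
noncomputable def normDiam (q : G → ℕ∞) : ℕ∞ := ⨆ g, q g

/-- Conjugation-invariant norms with values in `[0, ∞)`. -/
structure IsConjInvNorm (q : G → ℝ) : Prop where
  nonneg : ∀ g, 0 ≤ q g
  eq_zero_iff : ∀ g, q g = 0 ↔ g = 1
  inv : ∀ g, q g⁻¹ = q g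
  mul_le : ∀ g h, q (g * h) ≤ q g + q h
  conj : ∀ g h, q (h * g * h⁻¹) = q g

variable (G)

/-- A group is bounded if every conjugation-invariant norm on it is bounded. -/
def IsBoundedGroup : Prop :=
  ∀ q : G → ℝ, IsConjInvNorm q → ∃ C : ℝ, ∀ g, q g ≤ C

/-- A group is uniformly perfect if its commutator length diameter is finite. -/
def IsUniformlyPerfect : Prop := normDiam (commLength : G → ℕ∞) < ⊤

variable {G}

/-- `G` is uniformly simple relative to the (normal) subgroup `L`: for some `k`, every element of
`G` is a product of at most `k` conjugates of `g` or its inverse, for every `g` outside `L`. -/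
def IsUniformlySimpleRel (L : Subgroup G) : Prop :=
  ∃ k : ℕ, ∀ g : G, g ∉ L → ∀ f : G, conjNorm g f ≤ (k : ℕ∞)

end GroupNorms

/-! ### Fiber bundles with a structure group -/

/-- The group of `C^r` diffeomorphisms of `N`, as a group of permutations of `N`. -/
def diffGroup {E H : Type*} [NormedAddCommGroup E] [NormedSpace ℝ E] [TopologicalSpace H]
    (I : ModelWithCorners ℝ E H) (N : Type*) [TopologicalSpace N] [ChartedSpace H N]
    (r : WithTop ℕ∞) : Subgroup (Equiv.Perm N) where
  carrier := {f | ContMDiff I I r f ∧ ContMDiff I I r (f⁻¹ : Equiv.Perm N)}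
  one_mem' := ⟨contMDiff_id, contMDiff_id⟩
  mul_mem' := by
    rintro f g ⟨hf, hf'⟩ ⟨hg, hg'⟩
    refine ⟨hf.comp hg, ?_⟩
    rw [mul_inv_rev]
    exact hg'.comp hf'
  inv_mem' := by
    rintro f ⟨hf, hf'⟩
    exact ⟨hf', by simpa using hf⟩

section Bundles

variable {EM HM EB HB EN HN : Type*}
  [NormedAddCommGroup EM] [NormedSpace ℝ EM] [TopologicalSpace HM]
  [NormedAddCommGroup EB] [NormedSpace ℝ EB] [TopologicalSpace HB]
  [NormedAddCommGroup EN] [NormedSpace ℝ EN] [TopologicalSpace HN]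

/-- A local trivialization over an open set `U` is smooth if it is a `C^∞` diffeomorphism from
the part over `U` onto `U × N`. -/
def SmoothTriv (IM : ModelWithCorners ℝ EM HM) (IB : ModelWithCorners ℝ EB HB)
    (IN : ModelWithCorners ℝ EN HN) {M B N : Type*}
    [TopologicalSpace M] [ChartedSpace HM M] [TopologicalSpace B] [ChartedSpace HB B]
    [TopologicalSpace N] [ChartedSpace HN N] {p : M → B}
    (φ : Bundle.Trivialization N p) : Prop :=
  ContMDiffOn IM (IB.prod IN) ∞ φ φ.source ∧
    ContMDiffOn (IB.prod IN) IM ∞ φ.toOpenPartialHomeomorph.symm φ.target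

/-- The transition functions `ψ_q ∘ φ_q⁻¹` between two local trivializations belong to `Γ` at
every common point `q`. -/
def TransitionIn {M B N : Type*} [TopologicalSpace M] [TopologicalSpace B] [TopologicalSpace N]
    (Γ : Subgroup (Equiv.Perm N)) {p : M → B} (φ ψ : Bundle.Trivialization N p) : Prop :=
  ∀ q ∈ φ.baseSet ∩ ψ.baseSet, ∃ γ ∈ Γ, ∀ x : N,
    (ψ (φ.toOpenPartialHomeomorph.symm (q, x))).2 = γ x

/-- A `C^∞` fiber bundle over `B` with total space `M`, fiber `N` and structure group `Γ`: a locally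
trivial projection together with a maximal `Γ`-atlas. -/
structure GammaBundle (IM : ModelWithCorners ℝ EM HM) (IB : ModelWithCorners ℝ EB HB)
    (IN : ModelWithCorners ℝ EN HN) {N : Type*} [TopologicalSpace N] [ChartedSpace HN N]
    (Γ : Subgroup (Equiv.Perm N)) (M B : Type*) [TopologicalSpace M] [ChartedSpace HM M]
    [TopologicalSpace B] [ChartedSpace HB B] where
  proj : M → B
  atlas : Set (Bundle.Trivialization N proj)
  smooth : ∀ φ ∈ atlas, SmoothTriv IM IB IN φ
  cover : ∀ b : B, ∃ φ ∈ atlas, b ∈ φ.baseSet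
  compat : ∀ φ ∈ atlas, ∀ ψ ∈ atlas, TransitionIn Γ φ ψ
  maximal : ∀ φ : Bundle.Trivialization N proj, SmoothTriv IM IB IN φ →
    (∀ ψ ∈ atlas, TransitionIn Γ φ ψ ∧ TransitionIn Γ ψ φ) → φ ∈ atlas

/-- The product bundle `B × N → B`, with the maximal `Γ`-atlas containing the identity. -/
def productBundle (IB : ModelWithCorners ℝ EB HB) (IN : ModelWithCorners ℝ EN HN)
    {N : Type*} [TopologicalSpace N] [ChartedSpace HN N] (Γ : Subgroup (Equiv.Perm N))
    (B : Type*) [TopologicalSpace B] [ChartedSpace HB B] :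
    GammaBundle (IB.prod IN) IB IN Γ (B × N) B :=
  let e : Bundle.Trivialization N (Prod.fst : B × N → B) :=
    { toOpenPartialHomeomorph := OpenPartialHomeomorph.refl (B × N)
      baseSet := univ
      open_baseSet := isOpen_univ
      source_eq := by simp
      target_eq := by simp
      proj_toFun := fun _ _ => rfl }
  have key : ∀ φ : Bundle.Trivialization N (Prod.fst : B × N → B), ∀ q ∈ φ.baseSet, ∀ y : N,
      φ.toOpenPartialHomeomorph.symm (φ (q, y)) = (q, y) := fun φ q hq y =>
    φ.toOpenPartialHomeomorph.left_inv (φ.mem_source.2 hq)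
  { proj := Prod.fst
    atlas := {φ | SmoothTriv (IB.prod IN) IB IN φ ∧ TransitionIn Γ e φ}
    smooth := fun φ hφ => hφ.1
    cover := fun b => ⟨e, ⟨⟨contMDiffOn_id, contMDiffOn_id⟩,
      fun q _ => ⟨1, Γ.one_mem, fun x => rfl⟩⟩, mem_univ b⟩
    compat := by
      rintro φ ⟨-, hφ⟩ ψ ⟨-, hψ⟩ q ⟨hq, hq'⟩
      obtain ⟨γ, hγ, h⟩ := hφ q ⟨mem_univ _, hq⟩
      obtain ⟨δ, hδ, h'⟩ := hψ q ⟨mem_univ _, hq'⟩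
      refine ⟨δ * γ⁻¹, Γ.mul_mem hδ (Γ.inv_mem hγ), fun x => ?_⟩
      have h1 : φ (q, γ⁻¹ x) = (q, x) :=
        Prod.ext (φ.proj_toFun _ (φ.mem_source.2 hq)) ((h (γ⁻¹ x)).trans (by simp))
      have h2 := key φ q hq (γ⁻¹ x)
      rw [h1] at h2
      rw [h2]
      exact h' (γ⁻¹ x)
    maximal := fun φ hφ h =>
      ⟨hφ, (h e ⟨⟨contMDiffOn_id, contMDiffOn_id⟩,
        fun q _ => ⟨1, Γ.one_mem, fun x => rfl⟩⟩).2⟩ }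

namespace GammaBundle

variable {IM : ModelWithCorners ℝ EM HM} {IB : ModelWithCorners ℝ EB HB}
  {IN : ModelWithCorners ℝ EN HN} {N : Type*} [TopologicalSpace N] [ChartedSpace HN N]
  {Γ : Subgroup (Equiv.Perm N)} {M B : Type*} [TopologicalSpace M] [ChartedSpace HM M]
  [TopologicalSpace B] [ChartedSpace HB B] (π : GammaBundle IM IB IN Γ M B)

theorem proj_surjective [Nonempty N] : Surjective π.proj := fun b => by
  obtain ⟨φ, -, hb⟩ := π.cover b
  exact ⟨φ.toOpenPartialHomeomorph.symm (b, Classical.arbitrary N), φ.proj_symm_apply' hb⟩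

/-- `f` maps each fiber of `π` into a fiber, and its restriction to each fiber, read in local
trivializations of the atlas, belongs to `Γ`. -/
def IsBundleMap (f : M → M) : Prop :=
  ∃ g : B → B, (∀ x, π.proj (f x) = g (π.proj x)) ∧
    ∀ φ ∈ π.atlas, ∀ ψ ∈ π.atlas, ∀ q ∈ φ.baseSet, g q ∈ ψ.baseSet →
      ∃ γ ∈ Γ, ∀ x : N, (ψ (f (φ.toOpenPartialHomeomorph.symm (q, x)))).2 = γ x

theorem IsBundleMap.one : π.IsBundleMap id :=
  ⟨id, fun _ => rfl, fun φ hφ ψ hψ q hq hq' => π.compat φ hφ ψ hψ q ⟨hq, hq'⟩⟩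

variable {π}

theorem IsBundleMap.comp {f f' : M → M} (hf : π.IsBundleMap f) (hf' : π.IsBundleMap f') :
    π.IsBundleMap (f ∘ f') := by
  obtain ⟨g, hg, h⟩ := hf
  obtain ⟨g', hg', h'⟩ := hf'
  refine ⟨g ∘ g', fun x => by simp [hg, hg'], fun φ hφ ψ hψ q hq hq' => ?_⟩
  obtain ⟨χ, hχ, hb⟩ := π.cover (g' q)
  obtain ⟨γ', hγ', e'⟩ := h' φ hφ χ hχ q hq hb
  obtain ⟨γ, hγ, e⟩ := h χ hχ ψ hψ (g' q) hb hq'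
  refine ⟨γ * γ', Γ.mul_mem hγ hγ', fun x => ?_⟩
  have hp : π.proj (f' (φ.toOpenPartialHomeomorph.symm (q, x))) = g' q := by
    rw [hg', φ.proj_symm_apply' hq]
  have key : f' (φ.toOpenPartialHomeomorph.symm (q, x)) =
      χ.toOpenPartialHomeomorph.symm (g' q, γ' x) := by
    rw [← e' x, ← hp, χ.symm_apply_mk_proj]
    rw [χ.mem_source, hp]; exact hb
  rw [comp_apply, key, e (γ' x), Equiv.Perm.mul_apply]

theorem IsBundleMap.inv {f : Equiv.Perm M} (hf : π.IsBundleMap f) :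
    π.IsBundleMap (f⁻¹ : Equiv.Perm M) := by
  obtain ⟨g, hg, h⟩ := hf
  -- each fiber over `q` is mapped onto the fiber over `g q`
  have surj : ∀ q y, π.proj y = g q → ∃ z, π.proj z = q ∧ f z = y := by
    intro q y hy
    obtain ⟨φ, hφ, hq⟩ := π.cover q
    obtain ⟨ψ, hψ, hq'⟩ := π.cover (g q)
    obtain ⟨γ, hγ, e⟩ := h φ hφ ψ hψ q hq hq'
    refine ⟨φ.toOpenPartialHomeomorph.symm (q, γ⁻¹ (ψ y).2), φ.proj_symm_apply' hq, ?_⟩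
    have hs : y ∈ ψ.source := by rw [ψ.mem_source, hy]; exact hq'
    have hp : π.proj (f (φ.toOpenPartialHomeomorph.symm (q, γ⁻¹ (ψ y).2))) = g q := by
      rw [hg, φ.proj_symm_apply' hq]
    have hs' : f (φ.toOpenPartialHomeomorph.symm (q, γ⁻¹ (ψ y).2)) ∈ ψ.source := by
      rw [ψ.mem_source, hp]; exact hq'
    apply ψ.toOpenPartialHomeomorph.injOn hs' hs
    refine Prod.ext ?_ ((e _).trans (by simp))
    exact (ψ.proj_toFun _ hs').trans ((hp.trans hy.symm).trans (ψ.proj_toFun _ hs).symm)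
  have proj_inv : ∀ q y, π.proj y = g q → π.proj (f⁻¹ y) = q := by
    intro q y hy
    obtain ⟨z, hz, rfl⟩ := surj q y hy
    simpa using hz
  classical
  refine ⟨fun b => if hb : ∃ y, π.proj y = b then π.proj (f⁻¹ hb.choose) else b,
    fun y => ?_, fun φ hφ ψ hψ q hq hq' => ?_⟩
  · have hb : ∃ y', π.proj y' = π.proj y := ⟨y, rfl⟩
    simp only [dif_pos hb]
    have h1 : π.proj y = g (π.proj (f⁻¹ y)) := by rw [← hg]; simp
    exact (proj_inv _ _ (hb.choose_spec.trans h1)).symm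
  · rcases isEmpty_or_nonempty N with hN | ⟨⟨n⟩⟩
    · exact ⟨1, Γ.one_mem, fun x => hN.elim x⟩
    have hb : ∃ y, π.proj y = q :=
      ⟨φ.toOpenPartialHomeomorph.symm (q, n), φ.proj_symm_apply' hq⟩
    simp only [dif_pos hb] at hq'
    set q' := π.proj (f⁻¹ hb.choose) with hq'_def
    have hgq : g q' = q := by
      rw [hq'_def, ← hg]; simpa using hb.choose_spec
    obtain ⟨γ, hγ, e⟩ := h ψ hψ φ hφ q' hq' (by rw [hgq]; exact hq)
    refine ⟨γ⁻¹, Γ.inv_mem hγ, fun x => ?_⟩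
    have hp : π.proj (f (ψ.toOpenPartialHomeomorph.symm (q', γ⁻¹ x))) = q := by
      rw [hg, ψ.proj_symm_apply' hq', hgq]
    have key : φ.toOpenPartialHomeomorph.symm (q, x) =
        f (ψ.toOpenPartialHomeomorph.symm (q', γ⁻¹ x)) := by
      have h2 : x = (φ (f (ψ.toOpenPartialHomeomorph.symm (q', γ⁻¹ x)))).2 := by
        rw [e]; simp
      conv_lhs => rw [h2, ← hp]
      exact φ.symm_apply_mk_proj (by rw [φ.mem_source, hp]; exact hq)
    have h3 : (f⁻¹ : Equiv.Perm M) (f (ψ.toOpenPartialHomeomorph.symm (q', γ⁻¹ x))) =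
        ψ.toOpenPartialHomeomorph.symm (q', γ⁻¹ x) := by simp
    rw [key, h3, ψ.apply_symm_apply' hq']

variable (π)

/-- The group `Diff^r_π(M)` of `C^r` bundle diffeomorphisms of `π`. -/
def diff (r : ℕ∞) : Subgroup (Equiv.Perm M) where
  carrier := {f | f ∈ diffGroup IM M (r : WithTop ℕ∞) ∧ π.IsBundleMap f}
  one_mem' := ⟨one_mem _, IsBundleMap.one π⟩
  mul_mem' := fun hf hg => ⟨mul_mem hf.1 hg.1, hf.2.comp hg.2⟩
  inv_mem' := fun hf => ⟨inv_mem hf.1, hf.2.inv⟩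

/-- The group `Isot^r_π(M)` of `C^r` isotopies of `π`, under `(F G)_t = F_t G_t`: families of bundle
diffeomorphisms such that `(x, t) ↦ (F_t x, t)` is a `C^r` diffeomorphism of `M × [0,1]`. -/
def isot (r : ℕ∞) : Subgroup (unitInterval → Equiv.Perm M) where
  carrier := {F |
    ContMDiff (IM.prod (𝓡∂ 1)) IM r (fun p : M × unitInterval => F p.2 p.1) ∧
    ContMDiff (IM.prod (𝓡∂ 1)) IM r (fun p : M × unitInterval => (F p.2)⁻¹ p.1) ∧
    ∀ t, F t ∈ π.diff r}
  one_mem' := ⟨contMDiff_fst, by simpa using contMDiff_fst, fun _ => one_mem _⟩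
  mul_mem' := by
    rintro F G ⟨hF, hF', hFt⟩ ⟨hG, hG', hGt⟩
    refine ⟨?_, ?_, fun t => mul_mem (hFt t) (hGt t)⟩
    · exact hF.comp (hG.prodMk contMDiff_snd)
    · exact hG'.comp (hF'.prodMk contMDiff_snd)
  inv_mem' := by
    rintro F ⟨hF, hF', hFt⟩
    exact ⟨hF', by simpa using hF, fun t => inv_mem (hFt t)⟩

/-- `Isot^r_π(M)_0`: the isotopies starting at the identity. -/
def isot0 (r : ℕ∞) : Subgroup (unitInterval → Equiv.Perm M) :=
  π.isot r ⊓ (Pi.evalMonoidHom (fun _ : unitInterval => Equiv.Perm M) 0).ker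

/-- The isotopies from the identity to the identity. -/
def isotLoop (r : ℕ∞) : Subgroup (unitInterval → Equiv.Perm M) :=
  π.isot0 r ⊓ (Pi.evalMonoidHom (fun _ : unitInterval => Equiv.Perm M) 1).ker

/-- `Diff^r_π(M)_0`: the time-one maps of the isotopies starting at the identity. -/
def diff0 (r : ℕ∞) : Subgroup (Equiv.Perm M) :=
  (π.isot0 r).map (Pi.evalMonoidHom (fun _ : unitInterval => Equiv.Perm M) 1)

/-- The support of an isotopy. -/
def isotSupport (F : unitInterval → Equiv.Perm M) : Set M :=
  closure (⋃ t, closure {x | F t x ≠ x})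

theorem isotSupport_mul_subset (F G : unitInterval → Equiv.Perm M) :
    isotSupport (F * G) ⊆ isotSupport F ∪ isotSupport G := by
  have hc : ∀ F : unitInterval → Equiv.Perm M, IsClosed (isotSupport F) :=
    fun _ => isClosed_closure
  refine closure_minimal (iUnion_subset fun t => closure_minimal (fun x hx => ?_)
    ((hc F).union (hc G))) ((hc F).union (hc G))
  by_cases h : G t x = x
  · left
    refine subset_closure (mem_iUnion.2 ⟨t, subset_closure ?_⟩)
    have hx' : F t (G t x) ≠ x := hx
    rw [h] at hx'
    exact hx'
  · right
    exact subset_closure (mem_iUnion.2 ⟨t, subset_closure h⟩)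

theorem isotSupport_inv (F : unitInterval → Equiv.Perm M) :
    isotSupport F⁻¹ = isotSupport F := by
  have : ∀ t, {x | (F⁻¹) t x ≠ x} = {x | F t x ≠ x} := by
    intro t
    ext x
    change (F t)⁻¹ x ≠ x ↔ F t x ≠ x
    rw [not_iff_not, Equiv.Perm.inv_eq_iff_eq, eq_comm]
  simp only [isotSupport, this]

/-- `Isot^r_{π,c}(M)_0`: the isotopies starting at the identity that are compactly supported with
respect to `π`. -/
def isotC0 (r : ℕ∞) : Subgroup (unitInterval → Equiv.Perm M) where
  carrier := {F | F ∈ π.isot0 r ∧ ∃ K : Set B, IsCompact K ∧ isotSupport F ⊆ π.proj ⁻¹' K}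
  one_mem' := ⟨one_mem _, ∅, isCompact_empty, by simp [isotSupport]⟩
  mul_mem' := by
    rintro F G ⟨hF, K, hK, hFK⟩ ⟨hG, L, hL, hGL⟩
    refine ⟨mul_mem hF hG, K ∪ L, hK.union hL, (isotSupport_mul_subset F G).trans ?_⟩
    rw [preimage_union]
    exact union_subset_union hFK hGL
  inv_mem' := by
    rintro F ⟨hF, K, hK, hFK⟩
    exact ⟨inv_mem hF, K, hK, by rwa [isotSupport_inv]⟩

/-- `Diff^r_{π,c}(M)_0`. -/
def diffC0 (r : ℕ∞) : Subgroup (Equiv.Perm M) :=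
  (π.isotC0 r).map (Pi.evalMonoidHom (fun _ : unitInterval => Equiv.Perm M) 1)

/-- `Isot^r_π(M; C)_0`: the isotopies starting at the identity that are the identity over a
neighborhood of `C`. -/
def isotRel0 (r : ℕ∞) (C : Set B) : Subgroup (unitInterval → Equiv.Perm M) where
  carrier := {F | F ∈ π.isot0 r ∧
    ∃ U : Set B, IsOpen U ∧ C ⊆ U ∧ ∀ t x, π.proj x ∈ U → F t x = x}
  one_mem' := ⟨one_mem _, univ, isOpen_univ, subset_univ _, fun _ _ _ => rfl⟩
  mul_mem' := by
    rintro F G ⟨hF, U, hU, hCU, hFU⟩ ⟨hG, V, hV, hCV, hGV⟩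
    refine ⟨mul_mem hF hG, U ∩ V, hU.inter hV, subset_inter hCU hCV, fun t x hx => ?_⟩
    change F t (G t x) = x
    rw [hGV t x hx.2, hFU t x hx.1]
  inv_mem' := by
    rintro F ⟨hF, U, hU, hCU, hFU⟩
    refine ⟨inv_mem hF, U, hU, hCU, fun t x hx => ?_⟩
    change (F t)⁻¹ x = x
    rw [Equiv.Perm.inv_eq_iff_eq, hFU t x hx]

/-- `Diff^r_π(M; C)_0`. -/
def diffRel0 (r : ℕ∞) (C : Set B) : Subgroup (Equiv.Perm M) :=
  (π.isotRel0 r C).map (Pi.evalMonoidHom (fun _ : unitInterval => Equiv.Perm M) 1)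

theorem diff0_le (r : ℕ∞) : π.diff0 r ≤ π.diff r := by
  rintro _ ⟨F, hF, rfl⟩
  exact hF.1.2.2 1

variable [Nonempty N]

/-- The map of the base induced by a map of the total space that preserves the fibers. -/
noncomputable def baseMap (f : M → M) (b : B) : B :=
  π.proj (f (surjInv π.proj_surjective b))

variable {π} in
theorem IsBundleMap.baseMap_proj {f : M → M} (hf : π.IsBundleMap f) (x : M) :
    π.baseMap f (π.proj x) = π.proj (f x) := by
  obtain ⟨g, hg, -⟩ := hf
  rw [baseMap, hg, hg, surjInv_eq π.proj_surjective]

variable {π} in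
theorem IsBundleMap.baseMap_comp {f f' : M → M} (hf : π.IsBundleMap f) (b : B) :
    π.baseMap (f ∘ f') b = π.baseMap f (π.baseMap f' b) :=
  (hf.baseMap_proj _).symm

theorem baseMap_id (b : B) : π.baseMap id b = b := surjInv_eq π.proj_surjective b

/-- The homomorphism `P` sending `f` in `Diff^r_π(M)_0` to the induced permutation of the base. -/
noncomputable def P (r : ℕ∞) : π.diff0 r →* Equiv.Perm B where
  toFun f :=
    { toFun := π.baseMap (f : Equiv.Perm M)
      invFun := π.baseMap ((f : Equiv.Perm M)⁻¹ : Equiv.Perm M)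
      left_inv := fun b => by
        rw [← (π.diff0_le r f.2).2.inv.baseMap_comp, ← Equiv.Perm.coe_mul, inv_mul_cancel]
        exact π.baseMap_id b
      right_inv := fun b => by
        rw [← (π.diff0_le r f.2).2.baseMap_comp, ← Equiv.Perm.coe_mul, mul_inv_cancel]
        exact π.baseMap_id b }
  map_one' := Equiv.ext fun b => π.baseMap_id b
  map_mul' f g := Equiv.ext fun b => (π.diff0_le r f.2).2.baseMap_comp b

end GammaBundle

end Bundles

/-! ### Bundles over the circle -/

/-- The universal covering of the circle, with deck transformation group `ℤ`. -/
noncomputable def circleCover (s : ℝ) : Circle := Circle.exp (2 * Real.pi * s)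

/-- The winding number of a path in the circle: the increment of any continuous lift. -/
noncomputable def windingNumber (c : unitInterval → Circle) : ℝ :=
  open Classical in
  if h : ∃ l : unitInterval → ℝ, Continuous l ∧ ∀ t, circleCover (l t) = c t then
    h.choose 1 - h.choose 0
  else 0

theorem circleCover_eq_iff {s t : ℝ} : circleCover s = circleCover t ↔ ∃ n : ℤ, s = t + n := by
  have h2 : (2 * Real.pi) ≠ 0 := by positivity
  rw [circleCover, circleCover, Circle.exp_eq_exp]
  refine exists_congr fun n => ⟨fun h => ?_, fun h => by rw [h]; ring⟩
  apply mul_left_cancel₀ h2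
  rw [h]; ring

/-- The winding number does not depend on the lift. -/
theorem windingNumber_eq {c : unitInterval → Circle} {l : unitInterval → ℝ} (hl : Continuous l)
    (hc : ∀ t, circleCover (l t) = c t) : windingNumber c = l 1 - l 0 := by
  have h : ∃ l : unitInterval → ℝ, Continuous l ∧ ∀ t, circleCover (l t) = c t := ⟨l, hl, hc⟩
  rw [windingNumber, dif_pos h]
  obtain ⟨hm, hmc⟩ := h.choose_spec
  set m := h.choose
  have hd : ∀ t, ∃ n : ℤ, m t - l t = n := fun t => by
    obtain ⟨n, hn⟩ := circleCover_eq_iff.1 ((hmc t).trans (hc t).symm)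
    exact ⟨n, by rw [hn]; ring⟩
  choose n hn using hd
  have hcont : Continuous n := by
    rw [Int.isClosedEmbedding_coe_real.isInducing.continuous_iff]
    have : ((fun k : ℤ => (k : ℝ)) ∘ n) = fun t => m t - l t := funext fun t => (hn t).symm
    rw [this]
    exact hm.sub hl
  have h01 : n 1 = n 0 := PreconnectedSpace.constant inferInstance hcont
  have h1 := hn 1
  have h0 := hn 0
  rw [h01] at h1
  linarith

/-- The proper closed arcs, that is, the (`C^r`) one-dimensional balls in the circle. -/
def IsClosedArc (D : Set Circle) : Prop :=
  ∃ a b : ℝ, a < b ∧ b < a + 1 ∧ D = circleCover '' Icc a b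

namespace GammaBundle

variable {EM HM EN HN : Type*}
  [NormedAddCommGroup EM] [NormedSpace ℝ EM] [TopologicalSpace HM]
  [NormedAddCommGroup EN] [NormedSpace ℝ EN] [TopologicalSpace HN]
  {IM : ModelWithCorners ℝ EM HM} {IN : ModelWithCorners ℝ EN HN}
  {N : Type*} [TopologicalSpace N] [ChartedSpace HN N] {Γ : Subgroup (Equiv.Perm N)}
  {M : Type*} [TopologicalSpace M] [ChartedSpace HM M]
  (π : GammaBundle IM (𝓡 1) IN Γ M Circle)

/-- The commutators in `Diff^r_π(M)_0` of two elements of `Diff^r_π(M; S¹ - Int D)_0`, for some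
closed arc `D`. -/
def ballCommutators (r : ℕ∞) : Set (π.diff0 r) :=
  {g | ∃ D : Set Circle, IsClosedArc D ∧ ∃ a b : π.diff0 r,
    (a : Equiv.Perm M) ∈ π.diffRel0 r (interior D)ᶜ ∧
    (b : Equiv.Perm M) ∈ π.diffRel0 r (interior D)ᶜ ∧ g = a * b * a⁻¹ * b⁻¹}

/-- `clb_π`: the commutator length supported in balls of the base. -/
noncomputable def clb (r : ℕ∞) : π.diff0 r → ℕ∞ := wordNorm (π.ballCommutators r)

variable [Nonempty N]

/-- `ν(F)`: the winding number of the path traced in the base by the point `p`. -/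
noncomputable def nu (p : Circle) (F : unitInterval → Equiv.Perm M) : ℝ :=
  windingNumber fun t => π.baseMap (F t) p

/-- The integer `k(π, r) ≥ 0`, characterized by `ν(Isot^r_π(M)_{id,id}) = k ℤ`. -/
noncomputable def kInv (r : ℕ∞) (p : Circle) : ℕ :=
  sInf {k : ℕ | π.nu p '' (π.isotLoop r : Set (unitInterval → Equiv.Perm M)) =
    {a : ℝ | ∃ n : ℤ, a = k * n}}

end GammaBundle

/-- Assumption `(∗)` on `(N, Γ, r)`: for the trivial bundle with fiber `N` and structure group `Γ`
over an open interval (all of which are diffeomorphic to `ℝ`), the group of time-one maps of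
compactly supported isotopies is perfect. -/
def AssumptionStar {EN HN : Type*} [NormedAddCommGroup EN] [NormedSpace ℝ EN]
    [TopologicalSpace HN] (IN : ModelWithCorners ℝ EN HN) {N : Type*} [TopologicalSpace N]
    [ChartedSpace HN N] (Γ : Subgroup (Equiv.Perm N)) (r : ℕ∞) : Prop :=
  Group.IsPerfect ((productBundle 𝓘(ℝ, ℝ) IN Γ ℝ).diffC0 r)

/-!
Bundle diffeomorphisms over the circle are studied on the infinite cyclic covering of the total
space. Gluing local trivializations along the line and absorbing the smooth dependence of the
transition functions gives a global description of the bundle as a mapping torus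
(`TorusChart`, `nonempty_torusChart`): a map `Φ : ℝ × N → M` over the universal covering of the
circle with `Φ (q + 1, x) = Φ (q, m x)` for some `m ∈ Γ`. Isotopies of the bundle starting at the
identity correspond to isotopies of `ℝ × N → ℝ` which commute with the deck transformation
(`TorusChart.exists_lift`, `TorusChart.exists_descent`); the winding number of a loop is the
displacement of a fiber under the lifted isotopy (`TorusChart.nu_eq`).

*Fragmentation.* If the lift of `f` moves the fiber over `p` by less than a full turn, then `f` is a
product of two elements supported over proper closed arcs (`TorusChart.exists_fragmentation`): the
first factor agrees with `f` near that fiber. It combines a periodic diffeomorphism of the line,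
equal near `p` to the one underlying `f` and fixing a neighborhood of some other point, with the
vertical part of the lifted isotopy, cut off away from `p`.

*Two commutators over an arc.* The bundle over an open arc is the product bundle over the line, and
its group of compactly supported diffeomorphisms contains elements carrying a given compact interval
to the right of itself. For a perfect group with this property, an algebraic argument
(`exists_two_commutators`) shows that each element is a product of two commutators
(`exists_two_commutators_of_isPerfect`, `TorusChart.clb_le_two`). Together with fragmentation,
`clb f ≤ 4` when the displacement is less than a full turn.

*Large displacements.* A single commutator supported over an arc realizes every displacement by less
than a full turn (`TorusChart.exists_ballCommutator`), so a displacement in `(-1, m + 1)` costs at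
most `m + 4` commutators (`TorusChart.clb_le_of_displacement`). Composition with a loop of isotopies
does not change `f`, but it changes the displacement by an arbitrary multiple of `k`, which can hence
be assumed to lie in `[0, k)`; so `clb f ≤ k + 3`.

*Conjugates.* If `g` does not induce the identity of the circle, it displaces a short arc, and a
suitable conjugate of `g` displaces any prescribed proper closed arc. A commutator `[a, b]` over that
arc is then a product of four conjugates of `g` and `g⁻¹` (`conjNorm_commutator_le`), whence
`conjNorm g f ≤ 4 * clb f`. The other three assertions follow formally from the two inequalities,
since elements `g` as above exist.
-/

/-! ### Increasing diffeomorphisms of the line -/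

/-- Functions on the line that are strictly increasing and `C^r` with, unless `r = 0`, positive
derivative: the `C^r` diffeomorphisms onto their images. -/
def IsIncr (r : ℕ∞) (u : ℝ → ℝ) : Prop :=
  ContDiff ℝ r u ∧ StrictMono u ∧ (r ≠ 0 → ∀ q, 0 < deriv u q)

/-- The increasing `C^r` diffeomorphisms of the line at bounded distance from the identity. -/
def goodPerm (r : ℕ∞) : Subgroup (Equiv.Perm ℝ) where
  carrier := {a | ContDiff ℝ r a ∧ ContDiff ℝ r (a⁻¹ : Equiv.Perm ℝ) ∧ StrictMono a ∧
    ∃ C, ∀ q, |a q - q| ≤ C}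
  one_mem' := ⟨contDiff_id, contDiff_id, strictMono_id, 0, fun q => by simp⟩
  mul_mem' := by
    rintro a b ⟨h1, h2, h3, C, h4⟩ ⟨k1, k2, k3, D, k4⟩
    refine ⟨h1.comp k1, ?_, h3.comp k3, C + D, fun q => ?_⟩
    · rw [mul_inv_rev]; exact k2.comp h2
    · rw [Equiv.Perm.mul_apply]
      have e : a (b q) - q = (a (b q) - b q) + (b q - q) := by ring
      rw [e]
      exact (abs_add_le _ _).trans (add_le_add (h4 _) (k4 _))
  inv_mem' := by
    rintro a ⟨h1, h2, h3, C, h4⟩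
    refine ⟨h2, by simpa using h1, fun x y hxy => ?_, C, fun q => ?_⟩
    · have : a (a⁻¹ x) < a (a⁻¹ y) := by simpa using hxy
      exact h3.lt_iff_lt.1 this
    · have := h4 (a⁻¹ q)
      have e : a (a⁻¹ q) = q := by simp
      rwa [e, abs_sub_comm] at this

section Line

variable {r : ℕ∞}

theorem coe_ne_zero_of_ne_zero (hr : r ≠ 0) : (r : WithTop ℕ∞) ≠ 0 := by
  exact_mod_cast hr

theorem isIncr_of_mem_goodPerm {a : Equiv.Perm ℝ} (ha : a ∈ goodPerm r) : IsIncr r a := by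
  obtain ⟨h1, h2, h3, -⟩ := ha
  refine ⟨h1, h3, fun hr q => ?_⟩
  have d1 : DifferentiableAt ℝ a q := h1.differentiable (coe_ne_zero_of_ne_zero hr) q
  have d2 : DifferentiableAt ℝ (a⁻¹ : Equiv.Perm ℝ) (a q) :=
    h2.differentiable (coe_ne_zero_of_ne_zero hr) _
  have h := (d2.hasDerivAt.comp q d1.hasDerivAt)
  have e : ((a⁻¹ : Equiv.Perm ℝ) : ℝ → ℝ) ∘ a = id := by
    ext x; simp
  rw [e] at h
  have h' := h.unique (hasDerivAt_id q)
  have hn : 0 ≤ deriv a q := h3.monotone.deriv_nonneg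
  refine lt_of_le_of_ne hn fun h0 => ?_
  rw [← h0] at h'
  simp at h'

theorem isIncr_id : IsIncr r id :=
  ⟨contDiff_id, strictMono_id, fun _ q => by simp⟩

theorem isIncr_affine {η : ℝ} (hη : 0 < η) (c p : ℝ) : IsIncr r fun q => c + η * (q - p) := by
  refine ⟨by fun_prop, fun x y h => by
    have := mul_lt_mul_of_pos_left h hη
    simp only; nlinarith, fun _ q => ?_⟩
  have : HasDerivAt (fun q => c + η * (q - p)) (η * 1) q :=
    (((hasDerivAt_id q).sub_const p).const_mul η).const_add c
  rw [this.deriv]; simpa using hη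

/-- A fiberwise inverse of a continuous family of increasing bijections of the line is jointly
continuous. -/
theorem continuous_inverse_of_strictMono {B b : ℝ × ℝ → ℝ} (hB : Continuous B)
    (hm : ∀ t, StrictMono fun q => B (t, q)) (hr : ∀ t y, B (t, b (t, y)) = y) :
    Continuous b := by
  rw [continuous_iff_continuousAt]
  rintro ⟨t₀, y₀⟩
  refine tendsto_order.2 ⟨fun a ha => ?_, fun a ha => ?_⟩
  · have h : B (t₀, a) < y₀ := by
      conv_rhs => rw [← hr t₀ y₀]
      exact hm t₀ ha
    have : ∀ᶠ z : ℝ × ℝ in 𝓝 (t₀, y₀), B (z.1, a) < z.2 :=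
      (isOpen_lt (by fun_prop) continuous_snd).mem_nhds h
    filter_upwards [this] with z hz
    rw [← hr z.1 z.2] at hz
    exact (hm z.1).lt_iff_lt.1 hz
  · have h : y₀ < B (t₀, a) := by
      conv_lhs => rw [← hr t₀ y₀]
      exact hm t₀ ha
    have : ∀ᶠ z : ℝ × ℝ in 𝓝 (t₀, y₀), z.2 < B (z.1, a) :=
      (isOpen_lt continuous_snd (by fun_prop)).mem_nhds h
    filter_upwards [this] with z hz
    rw [← hr z.1 z.2] at hz
    exact (hm z.1).lt_iff_lt.1 hz

/-- The convex isotopy from the identity to `u`, in smoothed time. -/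
noncomputable def slide (u : ℝ → ℝ) (z : ℝ × ℝ) : ℝ :=
  z.2 + Real.smoothTransition z.1 * (u z.2 - z.2)

theorem slide_of_fixed {u : ℝ → ℝ} {q : ℝ} (h : u q = q) (t : ℝ) : slide u (t, q) = q := by
  simp [slide, h]

theorem slide_zero (u : ℝ → ℝ) (q : ℝ) : slide u (0, q) = q := by simp [slide]

theorem slide_one (u : ℝ → ℝ) (q : ℝ) : slide u (1, q) = u q := by simp [slide]

theorem IsIncr.contDiff_slide {u : ℝ → ℝ} (hu : IsIncr r u) : ContDiff ℝ r (slide u) := by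
  have h1 : ContDiff ℝ r fun z : ℝ × ℝ => Real.smoothTransition z.1 :=
    Real.smoothTransition.contDiff.comp contDiff_fst
  have h2 : ContDiff ℝ r fun z : ℝ × ℝ => u z.2 := hu.1.comp contDiff_snd
  exact contDiff_snd.add (h1.mul (h2.sub contDiff_snd))

theorem IsIncr.strictMono_slide {u : ℝ → ℝ} (hu : IsIncr r u) (t : ℝ) :
    StrictMono fun q => slide u (t, q) := by
  intro x y h
  have h0 := Real.smoothTransition.nonneg t
  have h1 := Real.smoothTransition.le_one t
  have h2 := hu.2.1 h
  simp only [slide]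
  nlinarith [mul_nonneg h0 (sub_nonneg.2 h2.le), mul_nonneg (sub_nonneg.2 h1) (sub_nonneg.2 h.le),
    mul_pos (sub_pos.2 h) (sub_pos.2 h)]

theorem IsIncr.surjective_slide {u : ℝ → ℝ} (hu : IsIncr r u) {C : ℝ}
    (hC : ∀ q, |u q - q| ≤ C) (t : ℝ) : Surjective fun q => slide u (t, q) := by
  intro y
  have h0 := Real.smoothTransition.nonneg t
  have h1 := Real.smoothTransition.le_one t
  have hC0 : 0 ≤ C := (abs_nonneg _).trans (hC 0)
  have hc : Continuous fun q => slide u (t, q) := hu.contDiff_slide.continuous.comp (by fun_prop)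
  refine mem_range_of_exists_le_of_exists_ge hc ⟨y - C, ?_⟩ ⟨y + C, ?_⟩
  · have := (abs_le.1 (hC (y - C))).2
    simp only [slide]
    nlinarith
  · have := (abs_le.1 (hC (y + C))).1
    simp only [slide]
    nlinarith

/-- The inverses of the maps `slide u (t, ·)` form a `C^r` family. For `r = 0` this is a monotonicity
argument, and for `r > 0` an application of the inverse function theorem to
`(t, q) ↦ (t, slide u (t, q))`. -/
theorem IsIncr.exists_slide_inverse {u : ℝ → ℝ} (hu : IsIncr r u) {C : ℝ}
    (hC : ∀ q, |u q - q| ≤ C) : ∃ b : ℝ × ℝ → ℝ, ContDiff ℝ r b ∧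
      (∀ t q, b (t, slide u (t, q)) = q) ∧ ∀ t y, slide u (t, b (t, y)) = y := by
  choose b hb using fun t => hu.surjective_slide hC t
  have hb' : ∀ t q, b t (slide u (t, q)) = q := fun t q =>
    (hu.strictMono_slide t).injective (hb t _)
  have hcont : Continuous fun z : ℝ × ℝ => b z.1 z.2 :=
    continuous_inverse_of_strictMono hu.contDiff_slide.continuous hu.strictMono_slide
      (fun t y => hb t y)
  refine ⟨fun z => b z.1 z.2, ?_, hb', hb⟩
  by_cases hr : r = 0
  · subst hr
    exact contDiff_zero.2 hcont
  let e : ℝ × ℝ ≃ₜ ℝ × ℝ :=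
    { toFun := fun z => (z.1, slide u z)
      invFun := fun z => (z.1, b z.1 z.2)
      left_inv := fun z => Prod.ext rfl (hb' z.1 z.2)
      right_inv := fun z => Prod.ext rfl (hb z.1 z.2)
      continuous_toFun := continuous_fst.prodMk hu.contDiff_slide.continuous
      continuous_invFun := continuous_fst.prodMk hcont }
  have hdiff : ∀ z, HasFDerivAt (slide u) (fderiv ℝ (slide u) z) z := fun z =>
    (hu.contDiff_slide.differentiable (coe_ne_zero_of_ne_zero hr) z).hasFDerivAt
  -- the partial derivative in the second variable is a convex combination of `1` and `u'`
  have hpos : ∀ z, 0 < fderiv ℝ (slide u) z (0, 1) := by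
    intro z
    have h0 : HasDerivAt (fun q : ℝ => (z.1, q)) ((0 : ℝ), (1 : ℝ)) z.2 :=
      (hasDerivAt_const _ _).prodMk (hasDerivAt_id _)
    have h1 : HasDerivAt (fun q => slide u (z.1, q)) (fderiv ℝ (slide u) z (0, 1)) z.2 :=
      (hdiff z).comp_hasDerivAt (f := fun q : ℝ => (z.1, q)) z.2 h0
    have h2 : HasDerivAt (fun q => slide u (z.1, q))
        (1 + Real.smoothTransition z.1 * (deriv u z.2 - 1)) z.2 := by
      have h3 : HasDerivAt (fun q => u q - q) (deriv u z.2 - 1) z.2 :=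
        ((hu.1.differentiable (coe_ne_zero_of_ne_zero hr) z.2).hasDerivAt).sub (hasDerivAt_id _)
      exact (hasDerivAt_id z.2).add (h3.const_mul (Real.smoothTransition z.1))
    rw [h1.unique h2]
    have h0 := Real.smoothTransition.nonneg z.1
    have h1 := Real.smoothTransition.le_one z.1
    have h2 := hu.2.2 hr z.2
    rcases h0.eq_or_lt with h | h
    · rw [← h]; simp
    · nlinarith [mul_pos h h2]
  let f' : ℝ × ℝ → (ℝ × ℝ) ≃L[ℝ] (ℝ × ℝ) := fun z =>
    (ContinuousLinearEquiv.refl ℝ ℝ).skewProd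
      (ContinuousLinearEquiv.unitsEquivAut ℝ (Units.mk0 _ (hpos z).ne'))
      ((fderiv ℝ (slide u) z).comp (ContinuousLinearMap.inl ℝ ℝ ℝ))
  have he : ∀ z, HasFDerivAt e (f' z : (ℝ × ℝ) →L[ℝ] (ℝ × ℝ)) z := by
    intro z
    have h : HasFDerivAt e ((ContinuousLinearMap.fst ℝ ℝ ℝ).prod (fderiv ℝ (slide u) z)) z :=
      hasFDerivAt_fst.prodMk (hdiff z)
    convert h using 1
    ext
    · simp [f']
    · simp [f']
    · simp [f']
    · have : fderiv ℝ (slide u) z (0, 0) = 0 := map_zero _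
      simp [f', this]
  have hs : ContDiff ℝ r e.symm :=
    e.contDiff_symm he (contDiff_fst.prodMk hu.contDiff_slide)
  exact contDiff_snd.comp hs

theorem IsIncr.exists_goodPerm {u : ℝ → ℝ} (hu : IsIncr r u) {C : ℝ}
    (hC : ∀ q, |u q - q| ≤ C) : ∃ a ∈ goodPerm r, ⇑a = u := by
  obtain ⟨b, hb, h1, h2⟩ := hu.exists_slide_inverse hC
  refine ⟨⟨u, fun y => b (1, y), fun q => ?_, fun y => ?_⟩, ⟨hu.1, ?_, hu.2.1, C, hC⟩, rfl⟩
  · simpa [slide_one] using h1 1 q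
  · simpa [slide_one] using h2 1 y
  · exact hb.comp (contDiff_const.prodMk contDiff_id)

/-- The convex isotopy from the identity to a diffeomorphism `a` of the line, with parameter `t`
in `ℝ`. -/
theorem exists_slidePerm {a : Equiv.Perm ℝ} (ha : a ∈ goodPerm r) : ∃ A : ℝ → Equiv.Perm ℝ,
    (∀ t q, A t q = slide a (t, q)) ∧ ContDiff ℝ r (fun z : ℝ × ℝ => A z.1 z.2) ∧
    ContDiff ℝ r (fun z : ℝ × ℝ => (A z.1)⁻¹ z.2) := by
  have hu := isIncr_of_mem_goodPerm ha
  obtain ⟨-, -, -, C, hC⟩ := ha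
  obtain ⟨b, hb, h1, h2⟩ := hu.exists_slide_inverse hC
  exact ⟨fun t => ⟨fun q => slide a (t, q), fun y => b (t, y), h1 t, h2 t⟩, fun t q => rfl,
    hu.contDiff_slide, hb⟩

/-- Two increasing diffeomorphisms can be glued by a convex combination, provided that the one used
on the right is the larger one on the transition region. -/
theorem IsIncr.glue {u v : ℝ → ℝ} (hu : IsIncr r u) (hv : IsIncr r v) {a b : ℝ} (hab : a < b)
    (h : ∀ q ∈ Icc a b, u q ≤ v q) :
    ∃ w, IsIncr r w ∧ (∀ q ≤ a, w q = u q) ∧ ∀ q ≥ b, w q = v q := by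
  set m : ℝ → ℝ := fun q => Real.smoothTransition ((q - a) / (b - a)) with hm
  have hba : 0 < b - a := sub_pos.2 hab
  have m0 : ∀ q ≤ a, m q = 0 := fun q hq =>
    Real.smoothTransition.zero_of_nonpos (div_nonpos_of_nonpos_of_nonneg (by linarith) hba.le)
  have m1 : ∀ q ≥ b, m q = 1 := fun q hq =>
    Real.smoothTransition.one_of_one_le ((one_le_div hba).2 (by linarith))
  have mn : ∀ q, 0 ≤ m q := fun q => Real.smoothTransition.nonneg _
  have ml : ∀ q, m q ≤ 1 := fun q => Real.smoothTransition.le_one _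
  have mm : Monotone m := fun x y hxy =>
    Real.smoothTransition.monotone (div_le_div_of_nonneg_right (by linarith) hba.le)
  have mc : ContDiff ℝ r m := Real.smoothTransition.contDiff.comp (by fun_prop)
  set w : ℝ → ℝ := fun q => u q + m q * (v q - u q) with hw
  have w0 : ∀ q ≤ a, w q = u q := fun q hq => by simp [hw, m0 q hq]
  have w1 : ∀ q ≥ b, w q = v q := fun q hq => by simp [hw, m1 q hq]
  refine ⟨w, ⟨hu.1.add (mc.mul (hv.1.sub hu.1)), fun x y hxy => ?_, fun hr q => ?_⟩, w0, w1⟩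
  · have hux := hu.2.1 hxy
    have hvx := hv.2.1 hxy
    have hmxy := mm hxy.le
    have key : ∀ s, 0 ≤ s → s ≤ 1 → u x + s * (v x - u x) < u y + s * (v y - u y) := by
      intro s hs hs'
      rcases hs.eq_or_lt with rfl | hs
      · simpa using hux
      · nlinarith [mul_pos hs (sub_pos.2 hvx), mul_nonneg (sub_nonneg.2 hs') (sub_pos.2 hux).le]
    rcases lt_or_ge x a with hxa | hxa
    · rw [w0 x hxa.le]
      rcases le_total y a with hya | hya
      · rw [w0 y hya]; exact hux
      · rcases le_total y b with hyb | hyb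
        · have := mul_nonneg (mn y) (sub_nonneg.2 (h y ⟨hya, hyb⟩))
          simp only [hw]; linarith
        · rw [w1 y hyb]
          have := hu.2.1 hxa
          have h1 := h a ⟨le_rfl, hab.le⟩
          have := hv.2.1.monotone hya
          linarith
    · rcases le_total x b with hxb | hxb
      · -- enlarge the weight of `v` at `x`
        have h1 := mul_le_mul_of_nonneg_right hmxy (sub_nonneg.2 (h x ⟨hxa, hxb⟩))
        have h2 := key (m y) (mn y) (ml y)
        simp only [hw]; linarith
      · rw [w1 x hxb, w1 y (hxb.trans hxy.le)]; exact hvx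
  · have hr' := coe_ne_zero_of_ne_zero hr
    rcases lt_or_ge q a with hqa | hqa
    · have : w =ᶠ[𝓝 q] u := by
        filter_upwards [Iio_mem_nhds hqa] with x hx using w0 x (le_of_lt hx)
      rw [this.deriv_eq]; exact hu.2.2 hr q
    rcases lt_or_ge b q with hqb | hqb
    · have : w =ᶠ[𝓝 q] v := by
        filter_upwards [Ioi_mem_nhds hqb] with x hx using w1 x (le_of_lt hx)
      rw [this.deriv_eq]; exact hv.2.2 hr q
    have du := (hu.1.differentiable hr' q).hasDerivAt
    have dv := (hv.1.differentiable hr' q).hasDerivAt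
    have dm := (mc.differentiable hr' q).hasDerivAt
    have dw : HasDerivAt w _ q := du.add (dm.mul (dv.sub du))
    rw [dw.deriv]
    have h1 := hu.2.2 hr q
    have h2 := hv.2.2 hr q
    have h3 := h q ⟨hqa, hqb⟩
    have h4 : 0 ≤ deriv m q := mm.deriv_nonneg
    have h5 := mul_nonneg h4 (sub_nonneg.2 h3)
    rcases (mn q).eq_or_lt with h6 | h6
    · rw [← h6]; simp only [zero_mul, add_zero]; linarith
    · have := mul_pos h6 h2
      have := mul_nonneg (sub_nonneg.2 (ml q)) h1.le
      nlinarith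

/-- An increasing diffeomorphism can be modified away from `[p₁, p₂]` to have support in an open
interval that contains both `[p₁, p₂]` and its image. -/
theorem IsIncr.exists_extension {g : ℝ → ℝ} (hg : IsIncr r g) {α β p₁ p₂ : ℝ} (h1 : α < p₁)
    (h12 : p₁ ≤ p₂) (h2 : p₂ < β) (h3 : α < g p₁) (h4 : g p₂ < β) :
    ∃ a ∈ goodPerm r, ∃ ε > 0, ∃ α' β', α < α' ∧ β' < β ∧ α' < p₁ ∧ p₂ < β' ∧
      (∀ q ∈ Icc (p₁ - ε) (p₂ + ε), a q = g q) ∧ ∀ q, q ≤ α' ∨ β' ≤ q → a q = q := by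
  obtain ⟨c, hc1, hc2⟩ := exists_between (max_lt h2 h4)
  obtain ⟨d, hd1, hd2⟩ := exists_between (lt_min h1 h3)
  have hc1' := max_lt_iff.1 hc1
  have hd2' := lt_min_iff.1 hd2
  have hgc : Continuous g := hg.1.continuous
  obtain ⟨δ₁, hδ₁, hb₁⟩ : ∃ δ > 0, ∀ q, |q - p₂| < δ → g q < c ∧ q < c := by
    have : ∀ᶠ q in 𝓝 p₂, g q < c ∧ q < c :=
      ((isOpen_lt hgc continuous_const).inter (isOpen_lt continuous_id continuous_const)).mem_nhds
        ⟨hc1'.2, hc1'.1⟩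
    obtain ⟨δ, hδ, hb⟩ := Metric.eventually_nhds_iff.1 this
    exact ⟨δ, hδ, fun q hq => hb (by rwa [Real.dist_eq])⟩
  obtain ⟨δ₂, hδ₂, hb₂⟩ : ∃ δ > 0, ∀ q, |q - p₁| < δ → d < g q ∧ d < q := by
    have : ∀ᶠ q in 𝓝 p₁, d < g q ∧ d < q :=
      ((isOpen_lt continuous_const hgc).inter (isOpen_lt continuous_const continuous_id)).mem_nhds
        ⟨hd2'.2, hd2'.1⟩
    obtain ⟨δ, hδ, hb⟩ := Metric.eventually_nhds_iff.1 this
    exact ⟨δ, hδ, fun q hq => hb (by rwa [Real.dist_eq])⟩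
  set ε := min δ₁ δ₂ / 3 with hε
  have hε0 : 0 < ε := by have := lt_min hδ₁ hδ₂; positivity
  have hε1 : 2 * ε < δ₁ := by have := min_le_left δ₁ δ₂; linarith
  have hε2 : 2 * ε < δ₂ := by have := min_le_right δ₁ δ₂; linarith
  have e1 := hb₁ (p₂ + 2 * ε) (by rw [add_sub_cancel_left, abs_of_pos (by linarith)]; exact hε1)
  have e2 := hb₂ (p₁ - 2 * ε) (by
    rw [sub_sub_cancel_left, abs_neg, abs_of_pos (by linarith)]; exact hε2)
  -- lines of small slope slightly above `g p₂` and below `g p₁`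
  set β₁ := (c + β) / 2 with hβ₁
  set α₁ := (d + α) / 2 with hα₁
  have hη : 0 < (β₁ - c) / (β - p₂) := div_pos (by linarith) (by linarith)
  have hζ : 0 < (d - α₁) / (p₁ - α) := div_pos (by linarith) (by linarith)
  set η := (β₁ - c) / (β - p₂) with hηd
  set ζ := (d - α₁) / (p₁ - α) with hζd
  have hη' : η * (β - p₂) = β₁ - c := div_mul_cancel₀ _ (by linarith)
  have hζ' : ζ * (p₁ - α) = d - α₁ := div_mul_cancel₀ _ (by linarith)
  have hup : IsIncr r fun q => c + η * (q - p₂) := isIncr_affine hη c p₂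
  have hlo : IsIncr r fun q => d + ζ * (q - p₁) := isIncr_affine hζ d p₁
  obtain ⟨w₁, i₁, l₁, r₁⟩ := isIncr_id.glue hlo (a := (α + α₁) / 2) (b := α₁) (by linarith)
    (fun q hq => by
      have : ζ * (p₁ - q) ≤ ζ * (p₁ - α) := mul_le_mul_of_nonneg_left (by linarith [hq.1]) hζ.le
      have := hq.2
      simp only [id]; nlinarith)
  obtain ⟨w₂, i₂, l₂, r₂⟩ := i₁.glue hg (a := p₁ - 2 * ε) (b := p₁ - ε) (by linarith)
    (fun q hq => by
      rw [r₁ q (by linarith [hq.1])]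
      have := hg.2.1.monotone hq.1
      have := mul_nonneg hζ.le (show 0 ≤ p₁ - q by linarith [hq.2])
      linarith)
  obtain ⟨w₃, i₃, l₃, r₃⟩ := i₂.glue hup (a := p₂ + ε) (b := p₂ + 2 * ε) (by linarith)
    (fun q hq => by
      rw [r₂ q (by linarith [hq.1])]
      have := hg.2.1.monotone hq.2
      have := mul_nonneg hη.le (show 0 ≤ q - p₂ by linarith [hq.1])
      linarith)
  obtain ⟨w₄, i₄, l₄, r₄⟩ := i₃.glue isIncr_id (a := β₁) (b := (β₁ + β) / 2) (by linarith)
    (fun q hq => by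
      rw [r₃ q (by linarith [hq.1])]
      have : η * (q - p₂) ≤ η * (β - p₂) := mul_le_mul_of_nonneg_left (by linarith [hq.2]) hη.le
      have := hq.1
      simp only [id]; linarith)
  have hid : ∀ q, q ≤ (α + α₁) / 2 ∨ (β₁ + β) / 2 ≤ q → w₄ q = q := by
    rintro q (hq | hq)
    · rw [l₄ q (by linarith), l₃ q (by linarith), l₂ q (by linarith), l₁ q hq, id]
    · rw [r₄ q hq, id]
  obtain ⟨C, hC⟩ : ∃ C, ∀ q, |w₄ q - q| ≤ C := by
    have hcont : Continuous fun q => w₄ q - q := i₄.1.continuous.sub continuous_id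
    obtain ⟨C, hC⟩ := (isCompact_Icc (a := (α + α₁) / 2)
      (b := (β₁ + β) / 2)).exists_bound_of_continuousOn hcont.continuousOn
    refine ⟨max C 0, fun q => ?_⟩
    by_cases hq : q ≤ (α + α₁) / 2 ∨ (β₁ + β) / 2 ≤ q
    · rw [hid q hq]; simp
    · push Not at hq
      exact (hC q ⟨hq.1.le, hq.2.le⟩).trans (le_max_left _ _)
  obtain ⟨a, ha, rfl⟩ := i₄.exists_goodPerm hC
  refine ⟨a, ha, ε, hε0, (α + α₁) / 2, (β₁ + β) / 2, by linarith, by linarith, by linarith,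
    by linarith, fun q hq => ?_, hid⟩
  rw [l₄ q (by linarith [hq.2]), l₃ q hq.2, r₂ q hq.1]

theorem add_int_of_periodic {u : ℝ → ℝ} (hu : ∀ q, u (q + 1) = u q + 1) (n : ℤ) (q : ℝ) :
    u (q + n) = u q + n := by
  induction n with
  | zero => simp
  | succ n ih =>
    have := hu (q + n)
    push_cast at *
    rw [← add_assoc]; linarith
  | pred n ih =>
    have h := hu (q - n - 1)
    push_cast at *
    have e : q + (-(n : ℝ) - 1) = q - n - 1 := by ring
    have e' : q - n - 1 + 1 = q + -n := by ring
    rw [e'] at h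
    rw [e]; linarith

theorem bounded_displacement_of_periodic {u : ℝ → ℝ} (hm : Monotone u)
    (hu : ∀ q, u (q + 1) = u q + 1) (q : ℝ) : |u q - q| ≤ |u 0| + 1 := by
  have h1 := hm (Int.floor_le q)
  have h2 := hm (Int.lt_floor_add_one q).le
  rw [hu] at h2
  have h3 := add_int_of_periodic hu ⌊q⌋ 0
  rw [zero_add] at h3
  have h4 := Int.floor_le q
  have h5 := (Int.lt_floor_add_one q).le
  have h6 := abs_le.1 (le_refl |u 0|)
  rw [abs_le]
  constructor <;> linarith

/-- An increasing diffeomorphism supported in a unit interval extends periodically. -/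
theorem IsIncr.exists_periodic {a : ℝ → ℝ} (ha : IsIncr r a) {c c' c'' : ℝ} (h1 : c < c')
    (h2 : c'' < c + 1) (hid : ∀ q, q ≤ c' ∨ c'' ≤ q → a q = q) :
    ∃ w ∈ goodPerm r, (∀ q, w (q + 1) = w q + 1) ∧
      ∀ q ∈ Ioo (c'' - 1) (c' + 1), w q = a q := by
  set w : ℝ → ℝ := fun q => a (q - ⌊q - c⌋) + ⌊q - c⌋ with hw
  have hper : ∀ q, w (q + 1) = w q + 1 := fun q => by
    have e : q + 1 - c = (q - c) + 1 := by ring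
    simp only [hw, e, Int.floor_add_one]
    push_cast
    rw [show q + 1 - ((⌊q - c⌋ : ℝ) + 1) = q - ⌊q - c⌋ by ring]; ring
  have hfl : ∀ q, c ≤ q - ⌊q - c⌋ ∧ q - ⌊q - c⌋ < c + 1 := fun q => by
    have h1 := Int.floor_le (q - c)
    have h2 := Int.lt_floor_add_one (q - c)
    constructor <;> linarith
  have hloc : ∀ (n : ℤ) q, c'' - 1 + n < q → q < c' + 1 + n → w q = a (q - n) + n := by
    intro n q hq hq'
    have h3 := hfl q
    set k := ⌊q - c⌋ with hk
    rcases lt_trichotomy k n with h | h | h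
    · have h' : (k : ℝ) + 1 ≤ n := by exact_mod_cast h
      simp only [hw, ← hk]
      rw [hid (q - k) (Or.inr (by linarith)), hid (q - n) (Or.inl (by linarith))]; ring
    · simp only [hw, ← hk, h]
    · have h' : (n : ℝ) + 1 ≤ k := by exact_mod_cast h
      simp only [hw, ← hk]
      rw [hid (q - k) (Or.inl (by linarith)), hid (q - n) (Or.inr (by linarith))]; ring
  have hev : ∀ q, w =ᶠ[𝓝 q] fun x => a (x - ⌊q - c⌋) + ⌊q - c⌋ := fun q => by
    have h3 := hfl q
    filter_upwards [Ioo_mem_nhds (show c'' - 1 + ⌊q - c⌋ < q by linarith)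
      (show q < c' + 1 + ⌊q - c⌋ by linarith)] with x hx using hloc _ x hx.1 hx.2
  have hincr : IsIncr r w := by
    refine ⟨contDiff_iff_contDiffAt.2 fun q => ?_, fun x y hxy => ?_, fun hr q => ?_⟩
    · refine ContDiffAt.congr_of_eventuallyEq ?_ (hev q)
      exact ((ha.1.comp (contDiff_id.sub contDiff_const)).add contDiff_const).contDiffAt
    · have h3 := hfl x
      have h4 := hfl y
      have hle : ⌊x - c⌋ ≤ ⌊y - c⌋ := Int.floor_le_floor (by linarith)
      rcases hle.eq_or_lt with h | h
      · simp only [hw, h]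
        have := ha.2.1 (show x - ⌊y - c⌋ < y - ⌊y - c⌋ by linarith)
        linarith
      · have h' : (⌊x - c⌋ : ℝ) + 1 ≤ ⌊y - c⌋ := by exact_mod_cast h
        have h5 := ha.2.1 h3.2
        have h6 := ha.2.1.monotone h4.1
        rw [hid (c + 1) (Or.inr h2.le)] at h5
        rw [hid c (Or.inl h1.le)] at h6
        simp only [hw]; linarith
    · rw [(hev q).deriv_eq]
      have : HasDerivAt (fun x => a (x - ⌊q - c⌋) + ⌊q - c⌋) (deriv a (q - ⌊q - c⌋)) q := by
        have := ((ha.1.differentiable (coe_ne_zero_of_ne_zero hr)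
          (q - ⌊q - c⌋)).hasDerivAt).comp_sub_const q (⌊q - c⌋ : ℝ)
        exact this.add_const _
      rw [this.deriv]; exact ha.2.2 hr _
  obtain ⟨b, hb, hbw⟩ := hincr.exists_goodPerm
    (bounded_displacement_of_periodic hincr.2.1.monotone hper)
  refine ⟨b, hb, fun q => by rw [hbw]; exact hper q, fun q hq => ?_⟩
  rw [hbw]
  have := hloc 0 q (by simpa using hq.1) (by simpa using hq.2)
  simpa using this

end Line

/-! ### Word norms and displacement -/

section Norms

variable {G : Type*} [Group G]

theorem wordNorm_prod_le (S : Set G) (l : List G) (hl : ∀ x ∈ l, x ∈ S) :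
    wordNorm S l.prod ≤ l.length :=
  iInf₂_le (f := fun (l' : List G) (_ : (∀ x ∈ l', x ∈ S) ∧ l'.prod = l.prod) =>
    (l'.length : ℕ∞)) l ⟨hl, rfl⟩

theorem exists_list_of_wordNorm_le {S : Set G} {g : G} {n : ℕ} (h : wordNorm S g ≤ n) :
    ∃ l : List G, (∀ x ∈ l, x ∈ S) ∧ l.prod = g ∧ l.length ≤ n := by
  by_contra! hc
  have : ((n + 1 : ℕ) : ℕ∞) ≤ wordNorm S g :=
    le_iInf₂ fun l hl => by exact_mod_cast hc l hl.1 hl.2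
  exact absurd (this.trans h) (by norm_cast; omega)

theorem wordNorm_one (S : Set G) : wordNorm S 1 = 0 :=
  le_antisymm (by simpa using wordNorm_prod_le S [] (by simp)) bot_le

theorem wordNorm_le_one {S : Set G} {g : G} (h : g ∈ S) : wordNorm S g ≤ 1 := by
  simpa using wordNorm_prod_le S [g] (by simpa using h)

theorem wordNorm_mul_le (S : Set G) (g h : G) :
    wordNorm S (g * h) ≤ wordNorm S g + wordNorm S h := by
  rcases eq_or_ne (wordNorm S g) ⊤ with hg | hg
  · simp [hg]
  rcases eq_or_ne (wordNorm S h) ⊤ with hh | hh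
  · simp [hh]
  lift wordNorm S g to ℕ using hg with m hm
  lift wordNorm S h to ℕ using hh with n hn
  obtain ⟨l, h1, rfl, h3⟩ := exists_list_of_wordNorm_le hm.ge
  obtain ⟨l', h1', rfl, h3'⟩ := exists_list_of_wordNorm_le hn.ge
  rw [← List.prod_append]
  refine (wordNorm_prod_le S (l ++ l') fun x hx => ?_).trans ?_
  · exact (List.mem_append.1 hx).elim (h1 x) (h1' x)
  · rw [List.length_append]; exact_mod_cast Nat.add_le_add h3 h3'

theorem wordNorm_anti {S T : Set G} (h : S ⊆ T) (g : G) : wordNorm T g ≤ wordNorm S g :=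
  le_iInf₂ fun l hl => iInf₂_le (f := fun (l' : List G)
    (_ : (∀ x ∈ l', x ∈ T) ∧ l'.prod = g) => (l'.length : ℕ∞)) l ⟨fun x hx => h (hl.1 x hx), hl.2⟩

theorem wordNorm_le_mul {S T : Set G} {n : ℕ} (hn : n ≠ 0) (h : ∀ s ∈ S, wordNorm T s ≤ n)
    (g : G) : wordNorm T g ≤ n * wordNorm S g := by
  have key : ∀ l : List G, (∀ x ∈ l, x ∈ S) → wordNorm T l.prod ≤ n * l.length := by
    intro l
    induction l with
    | nil => intro _; simp [wordNorm_one]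
    | cons a l ih =>
      intro hl
      rw [List.prod_cons]
      refine (wordNorm_mul_le _ _ _).trans ?_
      rw [List.length_cons, Nat.cast_add, mul_add, add_comm]
      exact add_le_add (ih fun x hx => hl x (List.mem_cons_of_mem _ hx))
        (by simpa using h a (hl a (List.mem_cons_self)))
  rcases eq_or_ne (wordNorm S g) ⊤ with hg | hg
  · rw [hg, ENat.mul_top (by exact_mod_cast hn)]; exact le_top
  · lift wordNorm S g to ℕ using hg with m hm
    obtain ⟨l, h1, rfl, h3⟩ := exists_list_of_wordNorm_le hm.ge
    refine (key l h1).trans ?_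
    exact_mod_cast Nat.mul_le_mul_left n h3

theorem IsConjInvNorm.le_of_conjNorm_le {q : G → ℝ} (hq : IsConjInvNorm q) {g f : G} {n : ℕ}
    (h : conjNorm g f ≤ n) : q f ≤ n * q g := by
  obtain ⟨l, h1, rfl, h3⟩ := exists_list_of_wordNorm_le h
  have key : ∀ l : List G, (∀ x ∈ l, x ∈ conjugatesOf g ∪ conjugatesOf g⁻¹) →
      q l.prod ≤ l.length * q g := by
    intro l
    induction l with
    | nil => intro _; simp [(hq.eq_zero_iff 1).2 rfl]
    | cons a l ih =>
      intro hl
      have ha : q a = q g := by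
        rcases hl a List.mem_cons_self with h | h
        · obtain ⟨c, rfl⟩ := isConj_iff.1 (show IsConj _ a from h)
          exact hq.conj _ _
        · obtain ⟨c, rfl⟩ := isConj_iff.1 (show IsConj _ a from h)
          rw [hq.conj, hq.inv]
      rw [List.prod_cons, List.length_cons]
      have := hq.mul_le a l.prod
      have := ih fun x hx => hl x (List.mem_cons_of_mem _ hx)
      push_cast; linarith
  exact (key l h1).trans (mul_le_mul_of_nonneg_right (by exact_mod_cast h3) (hq.nonneg g))

/-- If a conjugate `g' = h g h⁻¹` of `g` satisfies `[g' a g'⁻¹, b] = 1`, then `[a, b]` equals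
`[[a, g'], b]`, a product of four conjugates of `g` and its inverse. -/
theorem conjNorm_commutator_le {g a b : G} (h : G)
    (hc : Commute ((h * g * h⁻¹) * a * (h * g * h⁻¹)⁻¹) b) :
    conjNorm g (a * b * a⁻¹ * b⁻¹) ≤ 4 := by
  set k := h * g * h⁻¹ with hk
  have e : a * b * a⁻¹ * b⁻¹ =
      [a * k * a⁻¹, k⁻¹, b * k * b⁻¹, (b * a) * k⁻¹ * (b * a)⁻¹].prod := by
    have h1 : k * a⁻¹ * k⁻¹ * b = b * (k * a⁻¹ * k⁻¹) := by
      have := hc.inv_left.eq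
      simpa [mul_assoc] using this
    simp only [List.prod_cons, List.prod_nil, mul_one]
    have h2 : a * k * a⁻¹ * (k⁻¹ * (b * k * b⁻¹ * (b * a * k⁻¹ * (b * a)⁻¹))) =
        a * (k * a⁻¹ * k⁻¹ * b) * k * a * k⁻¹ * a⁻¹ * b⁻¹ := by group
    rw [h2, h1]; group
  rw [e]
  have cg : ∀ c, c * k * c⁻¹ ∈ conjugatesOf g ∪ conjugatesOf g⁻¹ := fun c =>
    Or.inl (isConj_iff.2 ⟨c * h, by rw [hk]; group⟩)
  have cg' : ∀ c, c * k⁻¹ * c⁻¹ ∈ conjugatesOf g ∪ conjugatesOf g⁻¹ := fun c =>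
    Or.inr (isConj_iff.2 ⟨c * h, by rw [hk]; group⟩)
  refine wordNorm_prod_le _ _ fun x hx => ?_
  simp only [List.mem_cons, List.not_mem_nil, or_false] at hx
  rcases hx with rfl | rfl | rfl | rfl
  · exact cg a
  · simpa using cg' 1
  · exact cg b
  · exact cg' (b * a)

/-- If conjugation by `h` pushes a subgroup `K` into a subgroup `L` that commutes with `K`, and
maps `L` into itself, then every product of commutators in `K` is a product of two commutators.
The successive `h`-translates of `K` commute, which leaves room to perform all the commutators at
once in distinct translates; the remaining factor is a commutator with `h`. -/
theorem exists_two_commutators {h : G} {K L : Subgroup G} (hKL : ∀ x ∈ K, ∀ y ∈ L, Commute x y)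
    (hK : ∀ x ∈ K, h * x * h⁻¹ ∈ L) (hL : ∀ x ∈ L, h * x * h⁻¹ ∈ L) {x : G} (hx : x ∈ ⁅K, K⁆) :
    ∃ a b c d : G, x = (a * b * a⁻¹ * b⁻¹) * (c * d * c⁻¹ * d⁻¹) := by
  suffices H : x ∈ K ∧ ∃ z, ∃ c ∈ L, ∃ d ∈ L,
      z * h * z⁻¹ * h⁻¹ = x * (c * d * c⁻¹ * d⁻¹)⁻¹ by
    obtain ⟨-, z, c, -, d, -, e⟩ := H
    exact ⟨z, h, c, d, by rw [e]; group⟩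
  have step : ∀ a ∈ K, ∀ b ∈ K, ∀ y, (y ∈ K ∧ ∃ z, ∃ c ∈ L, ∃ d ∈ L,
      z * h * z⁻¹ * h⁻¹ = y * (c * d * c⁻¹ * d⁻¹)⁻¹) →
      ((a * b * a⁻¹ * b⁻¹) * y ∈ K ∧ ∃ z, ∃ c ∈ L, ∃ d ∈ L,
      z * h * z⁻¹ * h⁻¹ = ((a * b * a⁻¹ * b⁻¹) * y) * (c * d * c⁻¹ * d⁻¹)⁻¹) := by
    rintro a ha b hb y ⟨hy, z, c, hc, d, hd, e⟩
    have hab : a * b * a⁻¹ * b⁻¹ ∈ K :=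
      K.mul_mem (K.mul_mem (K.mul_mem ha hb) (K.inv_mem ha)) (K.inv_mem hb)
    refine ⟨K.mul_mem hab hy, (a * b * a⁻¹ * b⁻¹) * y * (h * z * h⁻¹),
      h * (a * c) * h⁻¹, ?_, h * (b * d) * h⁻¹, ?_, ?_⟩
    · rw [show h * (a * c) * h⁻¹ = (h * a * h⁻¹) * (h * c * h⁻¹) by group]
      exact L.mul_mem (hK a ha) (hL c hc)
    · rw [show h * (b * d) * h⁻¹ = (h * b * h⁻¹) * (h * d * h⁻¹) by group]
      exact L.mul_mem (hK b hb) (hL d hd)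
    · set k := a * b * a⁻¹ * b⁻¹ with hk
      set l := c * d * c⁻¹ * d⁻¹ with hl
      have hlL : l ∈ L :=
        L.mul_mem (L.mul_mem (L.mul_mem hc hd) (L.inv_mem hc)) (L.inv_mem hd)
      -- the commutator of `a * c` and `b * d` splits, as `K` and `L` commute
      have hsplit : (a * c) * (b * d) * (a * c)⁻¹ * (b * d)⁻¹ = k * l := by
        have h1 : c * b = b * c := (hKL b hb c hc).eq.symm
        have h2 : d * a⁻¹ = a⁻¹ * d := (hKL _ (K.inv_mem ha) d hd).eq.symm
        have h3 : c⁻¹ * a⁻¹ = a⁻¹ * c⁻¹ := (hKL _ (K.inv_mem ha) _ (L.inv_mem hc)).eq.symm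
        have h4 : (c * d * c⁻¹ * d⁻¹) * b⁻¹ = b⁻¹ * (c * d * c⁻¹ * d⁻¹) :=
          (hKL _ (K.inv_mem hb) _ hlL).eq.symm
        have h5 : c * a⁻¹ = a⁻¹ * c := (hKL _ (K.inv_mem ha) c hc).eq.symm
        calc (a * c) * (b * d) * (a * c)⁻¹ * (b * d)⁻¹
            = a * (c * b) * d * (c⁻¹ * a⁻¹) * d⁻¹ * b⁻¹ := by group
          _ = a * b * c * (d * a⁻¹) * c⁻¹ * d⁻¹ * b⁻¹ := by rw [h1, h3]; group
          _ = a * b * (c * a⁻¹) * d * c⁻¹ * d⁻¹ * b⁻¹ := by rw [h2]; group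
          _ = a * b * a⁻¹ * ((c * d * c⁻¹ * d⁻¹) * b⁻¹) := by rw [h5]; group
          _ = k * l := by rw [h4, hk, hl]; group
      have hconj : h * (a * c) * h⁻¹ * (h * (b * d) * h⁻¹) * (h * (a * c) * h⁻¹)⁻¹ *
          (h * (b * d) * h⁻¹)⁻¹ = h * (k * l) * h⁻¹ := by
        rw [← hsplit]; group
      have hly : y * l⁻¹ * y⁻¹ = l⁻¹ := by
        have := (hKL y hy _ (L.inv_mem hlL)).eq
        rw [this]; group
      have hlk : l⁻¹ * k⁻¹ = (k * l)⁻¹ := by group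
      rw [hconj]
      calc k * y * (h * z * h⁻¹) * h * (k * y * (h * z * h⁻¹))⁻¹ * h⁻¹
          = k * y * (h * ((z * h * z⁻¹ * h⁻¹) * y⁻¹ * k⁻¹) * h⁻¹) := by group
        _ = k * y * (h * ((y * l⁻¹ * y⁻¹) * k⁻¹) * h⁻¹) := by rw [e]
        _ = k * y * (h * (k * l) * h⁻¹)⁻¹ := by rw [hly, hlk]; group
  rw [Subgroup.commutator_def] at hx
  induction hx using Subgroup.closure_induction_left with
  | one => exact ⟨K.one_mem, 1, 1, L.one_mem, 1, L.one_mem, by group⟩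
  | mul_left x hx y hy ih =>
    obtain ⟨a, ha, b, hb, rfl⟩ := hx
    rw [commutatorElement_def]
    exact step a ha b hb y ih
  | inv_mul_cancel x hx y hy ih =>
    obtain ⟨a, ha, b, hb, rfl⟩ := hx
    rw [commutatorElement_inv, commutatorElement_def]
    exact step b hb a ha y ih

end Norms

/-! ### The universal cover of the circle -/

section Cover

theorem contMDiff_circleCover : ContMDiff 𝓘(ℝ, ℝ) (𝓡 1) ∞ circleCover :=
  contMDiff_circleExp.comp (show ContMDiff 𝓘(ℝ, ℝ) 𝓘(ℝ, ℝ) ∞ fun s : ℝ => 2 * Real.pi * s from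
    (contDiff_const.mul contDiff_id).contMDiff)

theorem continuous_circleCover : Continuous circleCover := contMDiff_circleCover.continuous

theorem isCoveringMap_circleCover : IsCoveringMap circleCover := by
  have h2 : (2 * Real.pi) ≠ 0 := by positivity
  exact Circle.isCoveringMap_exp.comp_homeomorph (Homeomorph.mulLeft₀ _ h2)

theorem isOpenMap_circleCover : IsOpenMap circleCover :=
  isCoveringMap_circleCover.isLocalHomeomorph.isOpenMap

theorem circleCover_add_int (s : ℝ) (n : ℤ) : circleCover (s + n) = circleCover s :=
  circleCover_eq_iff.2 ⟨n, rfl⟩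

theorem circleCover_add_one (s : ℝ) : circleCover (s + 1) = circleCover s := by
  simpa using circleCover_add_int s 1

theorem exists_circleCover_Ico (c : ℝ) (b : Circle) : ∃ s ∈ Ico c (c + 1), circleCover s = b := by
  obtain ⟨t, ht⟩ : ∃ t, circleCover t = b := by
    obtain ⟨t, rfl⟩ := Circle.exp_surjective b
    exact ⟨t / (2 * Real.pi), by rw [circleCover, mul_div_cancel₀ _ (by positivity)]⟩
  refine ⟨t + (-⌊t - c⌋ : ℤ), ⟨?_, ?_⟩, by rw [circleCover_add_int, ht]⟩
  · have := Int.floor_le (t - c); push_cast; linarith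
  · have := Int.lt_floor_add_one (t - c); push_cast; linarith

theorem circleCover_surjective : Surjective circleCover := fun b => by
  obtain ⟨s, -, h⟩ := exists_circleCover_Ico 0 b
  exact ⟨s, h⟩

theorem eq_of_circleCover_eq {s t : ℝ} (h : circleCover s = circleCover t) (h1 : |s - t| < 1) :
    s = t := by
  obtain ⟨n, hn⟩ := circleCover_eq_iff.1 h
  have : |(n : ℝ)| < 1 := by rwa [hn, add_sub_cancel_left] at h1
  have : n = 0 := Int.abs_lt_one_iff.1 (by exact_mod_cast this)
  simpa [this] using hn

theorem injOn_circleCover_Ico (c : ℝ) : InjOn circleCover (Ico c (c + 1)) :=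
  fun s hs t ht h => eq_of_circleCover_eq h (by
    rw [abs_lt]; constructor <;> linarith [hs.1, hs.2, ht.1, ht.2])

/-- Two lifts of a path in the circle agree if they agree at time `0`. -/
theorem lift_unique {u v : unitInterval → ℝ} (hu : Continuous u) (hv : Continuous v)
    (h : ∀ t, circleCover (u t) = circleCover (v t)) (h0 : u 0 = v 0) : u = v :=
  isCoveringMap_circleCover.eq_of_comp_eq hu hv (funext h) 0 h0

/-- The inverse of `circleCover` with values in `(c, c + 1)`. -/
noncomputable def circleLog (c : ℝ) (b : Circle) : ℝ :=
  c + 1 / 2 + (Complex.log ((circleCover (c + 1 / 2) : ℂ)⁻¹ * (b : ℂ))).im / (2 * Real.pi)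

theorem circleCover_inv_mul (c q : ℝ) : ((circleCover c : ℂ)⁻¹ * (circleCover q : ℂ)) =
    ((Circle.exp (2 * Real.pi * (q - c)) : Circle) : ℂ) := by
  rw [mul_sub, Circle.exp_sub, circleCover, circleCover]
  push_cast
  rw [div_eq_inv_mul]

theorem circleLog_circleCover {c q : ℝ} (hq : q ∈ Ioo c (c + 1)) :
    circleLog c (circleCover q) = q := by
  rw [circleLog, circleCover_inv_mul, Complex.log_im, Circle.arg_exp]
  · field_simp; ring
  · nlinarith [Real.pi_pos, hq.1]
  · nlinarith [Real.pi_pos, hq.2]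

theorem contMDiffOn_circleLog (c : ℝ) :
    ContMDiffOn (𝓡 1) 𝓘(ℝ, ℝ) ∞ (circleLog c) (circleCover '' Ioo c (c + 1)) := by
  rintro _ ⟨q, hq, rfl⟩
  refine ContMDiffAt.contMDiffWithinAt ?_
  have hs : (circleCover (c + 1 / 2) : ℂ)⁻¹ * (circleCover q : ℂ) ∈ Complex.slitPlane := by
    rw [circleCover_inv_mul, Complex.mem_slitPlane_iff_arg, Circle.arg_exp]
    · exact ⟨by nlinarith [Real.pi_pos, hq.2], Circle.coe_ne_zero _⟩
    · nlinarith [Real.pi_pos, hq.1]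
    · nlinarith [Real.pi_pos, hq.2]
  have h1 : ContDiffAt ℝ ∞ (fun z : ℂ => c + 1 / 2 +
      (Complex.log ((circleCover (c + 1 / 2) : ℂ)⁻¹ * z)).im / (2 * Real.pi))
      (circleCover q : ℂ) := by
    refine contDiffAt_const.add (ContDiffAt.div_const ?_ _)
    have h2 : ContDiffAt ℝ ∞ (fun z : ℂ => Complex.log ((circleCover (c + 1 / 2) : ℂ)⁻¹ * z))
        (circleCover q : ℂ) :=
      ((Complex.contDiffAt_log hs).restrict_scalars ℝ).comp (circleCover q : ℂ)
        (contDiffAt_const.mul contDiffAt_id)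
    exact Complex.imCLM.contDiff.contDiffAt.comp _ h2
  have h3 : ContMDiff (𝓡 1) 𝓘(ℝ, ℂ) ∞ (fun b : Circle => (b : ℂ)) :=
    haveI := finrank_real_complex_fact'
    contMDiff_coe_sphere
  exact h1.contMDiffAt.comp (circleCover q) h3.contMDiffAt

end Cover

/-! ### Smooth families in the structure group -/

section Families

variable {EN HN : Type*} [NormedAddCommGroup EN] [NormedSpace ℝ EN] [TopologicalSpace HN]
  {N : Type*} [TopologicalSpace N] [ChartedSpace HN N]

/-- A family `τ` of elements of `Γ`, indexed by points of the line, that depends smoothly on the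
parameter in `U`, together with its inverse. -/
def SmoothFam (IN : ModelWithCorners ℝ EN HN) (Γ : Subgroup (Equiv.Perm N)) (U : Set ℝ)
    (τ : ℝ → Equiv.Perm N) : Prop :=
  (∀ q ∈ U, τ q ∈ Γ) ∧
  ContMDiffOn (𝓘(ℝ, ℝ).prod IN) IN ∞ (fun z : ℝ × N => τ z.1 z.2) (U ×ˢ univ) ∧
  ContMDiffOn (𝓘(ℝ, ℝ).prod IN) IN ∞ (fun z : ℝ × N => (τ z.1)⁻¹ z.2) (U ×ˢ univ)

variable {IN : ModelWithCorners ℝ EN HN} {Γ : Subgroup (Equiv.Perm N)} {U V : Set ℝ}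
  {σ τ : ℝ → Equiv.Perm N}

namespace SmoothFam

theorem const (hΓ : Γ ≤ diffGroup IN N ∞) {γ : Equiv.Perm N} (hγ : γ ∈ Γ) (U : Set ℝ) :
    SmoothFam IN Γ U fun _ => γ :=
  ⟨fun _ _ => hγ, ((hΓ hγ).1.comp contMDiff_snd).contMDiffOn,
    ((hΓ hγ).2.comp contMDiff_snd).contMDiffOn⟩

theorem inv (h : SmoothFam IN Γ U τ) : SmoothFam IN Γ U fun q => (τ q)⁻¹ :=
  ⟨fun q hq => Γ.inv_mem (h.1 q hq), h.2.2, by simpa using h.2.1⟩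

theorem mul (h : SmoothFam IN Γ U σ) (h' : SmoothFam IN Γ U τ) :
    SmoothFam IN Γ U fun q => σ q * τ q := by
  refine ⟨fun q hq => Γ.mul_mem (h.1 q hq) (h'.1 q hq), ?_, ?_⟩
  · exact h.2.1.comp (contMDiff_fst.contMDiffOn.prodMk h'.2.1) fun z hz => ⟨hz.1, trivial⟩
  · simp only [mul_inv_rev]
    exact h'.2.2.comp (contMDiff_fst.contMDiffOn.prodMk h.2.2) fun z hz => ⟨hz.1, trivial⟩

theorem mono (h : SmoothFam IN Γ U τ) (hVU : V ⊆ U) : SmoothFam IN Γ V τ :=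
  ⟨fun q hq => h.1 q (hVU hq), h.2.1.mono (prod_mono hVU Subset.rfl),
    h.2.2.mono (prod_mono hVU Subset.rfl)⟩

theorem congr (h : SmoothFam IN Γ U τ) (h' : ∀ q ∈ U, σ q = τ q) : SmoothFam IN Γ U σ :=
  ⟨fun q hq => h' q hq ▸ h.1 q hq, h.2.1.congr fun z hz => by rw [h' _ hz.1],
    h.2.2.congr fun z hz => by rw [h' _ hz.1]⟩

theorem comp {μ : ℝ → ℝ} (h : SmoothFam IN Γ U τ) (hμ : ContDiff ℝ ∞ μ) (hV : MapsTo μ V U) :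
    SmoothFam IN Γ V fun q => τ (μ q) := by
  have hm : ContMDiff (𝓘(ℝ, ℝ).prod IN) (𝓘(ℝ, ℝ).prod IN) ∞ fun z : ℝ × N => (μ z.1, z.2) :=
    (hμ.contMDiff.comp contMDiff_fst).prodMk contMDiff_snd
  exact ⟨fun q hq => h.1 _ (hV hq),
    h.2.1.comp hm.contMDiffOn fun z hz => ⟨hV hz.1, trivial⟩,
    h.2.2.comp hm.contMDiffOn fun z hz => ⟨hV hz.1, trivial⟩⟩

theorem of_locally (h : ∀ q ∈ U, ∃ V, IsOpen V ∧ q ∈ V ∧ SmoothFam IN Γ (U ∩ V) τ) :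
    SmoothFam IN Γ U τ := by
  refine ⟨fun q hq => ?_, contMDiffOn_of_locally_contMDiffOn fun z hz => ?_,
    contMDiffOn_of_locally_contMDiffOn fun z hz => ?_⟩
  · obtain ⟨V, -, hqV, hV⟩ := h q hq
    exact hV.1 q ⟨hq, hqV⟩
  · obtain ⟨V, hVo, hqV, hV⟩ := h z.1 hz.1
    exact ⟨V ×ˢ univ, hVo.prod isOpen_univ, ⟨hqV, trivial⟩, by
      rw [prod_inter_prod, univ_inter]; exact hV.2.1⟩
  · obtain ⟨V, hVo, hqV, hV⟩ := h z.1 hz.1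
    exact ⟨V ×ˢ univ, hVo.prod isOpen_univ, ⟨hqV, trivial⟩, by
      rw [prod_inter_prod, univ_inter]; exact hV.2.2⟩

end SmoothFam

end Families

/-! ### Trivializing the pullback of the bundle to the line -/

section Charts

variable {EM HM EN HN : Type*}
  [NormedAddCommGroup EM] [NormedSpace ℝ EM] [TopologicalSpace HM]
  [NormedAddCommGroup EN] [NormedSpace ℝ EN] [TopologicalSpace HN]
  {IM : ModelWithCorners ℝ EM HM} {IN : ModelWithCorners ℝ EN HN}
  {N : Type*} [TopologicalSpace N] [ChartedSpace HN N] {Γ : Subgroup (Equiv.Perm N)}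
  {M : Type*} [TopologicalSpace M] [ChartedSpace HM M]
  (π : GammaBundle IM (𝓡 1) IN Γ M Circle)

/-- `Φ : ℝ × N → M` trivializes, over `U`, the pullback of the bundle `π` to the universal cover of
the circle, compatibly with the smooth structure and with the structure group. -/
def GoodChart (U : Set ℝ) (Φ : ℝ × N → M) : Prop :=
  (∀ q ∈ U, ∀ x, π.proj (Φ (q, x)) = circleCover q) ∧
  ∀ ψ ∈ π.atlas, ∃ τ, SmoothFam IN Γ (U ∩ circleCover ⁻¹' ψ.baseSet) τ ∧
    ∀ q ∈ U, circleCover q ∈ ψ.baseSet → ∀ x, (ψ (Φ (q, x))).2 = τ q x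

variable {π}

theorem eq_symm_of_snd_eq {ψ : Bundle.Trivialization N π.proj} {b : Circle} (hb : b ∈ ψ.baseSet)
    {y : M} (hy : π.proj y = b) {x : N} (hx : (ψ y).2 = x) :
    y = ψ.toOpenPartialHomeomorph.symm (b, x) := by
  subst hx hy
  exact (ψ.symm_apply_mk_proj (ψ.mem_source.2 hb)).symm

theorem contMDiffOn_symm_circleCover {ψ : Bundle.Trivialization N π.proj} (hψ : ψ ∈ π.atlas) :
    ContMDiffOn (𝓘(ℝ, ℝ).prod IN) IM ∞
      (fun z : ℝ × N => ψ.toOpenPartialHomeomorph.symm (circleCover z.1, z.2))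
      ((circleCover ⁻¹' ψ.baseSet) ×ˢ univ) := by
  refine (π.smooth ψ hψ).2.comp (((contMDiff_circleCover.comp contMDiff_fst).prodMk
    contMDiff_snd).contMDiffOn) fun z hz => ?_
  rw [ψ.target_eq]
  exact ⟨hz.1, trivial⟩

theorem exists_smoothFam_transition {φ ψ : Bundle.Trivialization N π.proj} (hφ : φ ∈ π.atlas)
    (hψ : ψ ∈ π.atlas) : ∃ τ, SmoothFam IN Γ (circleCover ⁻¹' (φ.baseSet ∩ ψ.baseSet)) τ ∧
      ∀ q, circleCover q ∈ φ.baseSet → circleCover q ∈ ψ.baseSet → ∀ x,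
        (ψ (φ.toOpenPartialHomeomorph.symm (circleCover q, x))).2 = τ q x := by
  have h : ∀ q, ∃ γ : Equiv.Perm N, circleCover q ∈ φ.baseSet → circleCover q ∈ ψ.baseSet →
      γ ∈ Γ ∧ ∀ x, (ψ (φ.toOpenPartialHomeomorph.symm (circleCover q, x))).2 = γ x := by
    intro q
    by_cases hq : circleCover q ∈ φ.baseSet ∩ ψ.baseSet
    · obtain ⟨γ, h1, h2⟩ := π.compat φ hφ ψ hψ _ hq
      exact ⟨γ, fun _ _ => ⟨h1, h2⟩⟩
    · exact ⟨1, fun h1 h2 => absurd ⟨h1, h2⟩ hq⟩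
  choose τ hτ using h
  have sm : ∀ φ ∈ π.atlas, ∀ ψ ∈ π.atlas, ContMDiffOn (𝓘(ℝ, ℝ).prod IN) IN ∞
      (fun z : ℝ × N => (ψ (φ.toOpenPartialHomeomorph.symm (circleCover z.1, z.2))).2)
      ((circleCover ⁻¹' (φ.baseSet ∩ ψ.baseSet)) ×ˢ univ) := by
    intro φ hφ ψ hψ
    have h1 := ((π.smooth ψ hψ).1.comp ((contMDiffOn_symm_circleCover hφ).mono
      (prod_mono (preimage_mono inter_subset_left) Subset.rfl)) fun z hz => by
        rw [mem_preimage, ψ.mem_source, φ.proj_symm_apply' hz.1.1]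
        exact hz.1.2)
    exact contMDiff_snd.comp_contMDiffOn h1
  refine ⟨τ, ⟨fun q hq => (hτ q hq.1 hq.2).1, ?_, ?_⟩, fun q h1 h2 => (hτ q h1 h2).2⟩
  · exact (sm φ hφ ψ hψ).congr fun z hz => ((hτ z.1 hz.1.1 hz.1.2).2 z.2).symm
  · rw [inter_comm]
    refine (sm ψ hψ φ hφ).congr fun z hz => ?_
    have h1 := (hτ z.1 hz.1.2 hz.1.1).2 ((τ z.1)⁻¹ z.2)
    rw [Equiv.Perm.coe_inv, Equiv.apply_symm_apply, ← Equiv.Perm.coe_inv] at h1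
    rw [← eq_symm_of_snd_eq hz.1.1 (φ.proj_symm_apply' hz.1.2) h1, φ.apply_symm_apply' hz.1.2]

theorem goodChart_of_mem_atlas {φ : Bundle.Trivialization N π.proj} (hφ : φ ∈ π.atlas) :
    GoodChart π (circleCover ⁻¹' φ.baseSet)
      fun z => φ.toOpenPartialHomeomorph.symm (circleCover z.1, z.2) := by
  refine ⟨fun q hq x => φ.proj_symm_apply' hq, fun ψ hψ => ?_⟩
  obtain ⟨τ, h1, h2⟩ := exists_smoothFam_transition hφ hψ
  exact ⟨τ, h1, h2⟩

namespace GoodChart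

variable {U V : Set ℝ} {Φ Ψ : ℝ × N → M}

theorem mono (h : GoodChart π U Φ) (hVU : V ⊆ U) : GoodChart π V Φ :=
  ⟨fun q hq => h.1 q (hVU hq), fun ψ hψ => by
    obtain ⟨τ, h1, h2⟩ := h.2 ψ hψ
    exact ⟨τ, h1.mono (inter_subset_inter_left _ hVU), fun q hq => h2 q (hVU hq)⟩⟩

theorem congr (h : GoodChart π U Φ) (h' : ∀ q ∈ U, ∀ x, Ψ (q, x) = Φ (q, x)) :
    GoodChart π U Ψ :=
  ⟨fun q hq x => by rw [h' q hq, h.1 q hq], fun ψ hψ => by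
    obtain ⟨τ, h1, h2⟩ := h.2 ψ hψ
    exact ⟨τ, h1, fun q hq hq' x => by rw [h' q hq, h2 q hq hq']⟩⟩

theorem twist {σ : ℝ → Equiv.Perm N} (h : GoodChart π U Φ) (hσ : SmoothFam IN Γ U σ) :
    GoodChart π U fun z => Φ (z.1, σ z.1 z.2) :=
  ⟨fun q hq x => h.1 q hq _, fun ψ hψ => by
    obtain ⟨τ, h1, h2⟩ := h.2 ψ hψ
    exact ⟨fun q => τ q * σ q, h1.mul (hσ.mono inter_subset_left),
      fun q hq hq' x => h2 q hq hq' _⟩⟩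

theorem shift (h : GoodChart π U Φ) (n : ℤ) :
    GoodChart π ((fun q : ℝ => q + n) ⁻¹' U) fun z => Φ (z.1 + n, z.2) :=
  ⟨fun q hq x => by rw [h.1 _ hq, circleCover_add_int], fun ψ hψ => by
    obtain ⟨τ, h1, h2⟩ := h.2 ψ hψ
    exact ⟨fun q => τ (q + n), h1.comp (by fun_prop) fun q hq =>
      ⟨hq.1, by rw [mem_preimage, circleCover_add_int]; exact hq.2⟩,
      fun q hq hq' x => h2 _ hq (by rwa [circleCover_add_int]) x⟩⟩

/-- The families that express a chart in local trivializations are determined pointwise, so being a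
chart is a local property. -/
theorem of_locally (h : ∀ q ∈ U, ∃ V, IsOpen V ∧ q ∈ V ∧ GoodChart π (U ∩ V) Φ) :
    GoodChart π U Φ := by
  refine ⟨fun q hq x => ?_, fun ψ hψ => ?_⟩
  · obtain ⟨V, -, hqV, hV⟩ := h q hq
    exact hV.1 q ⟨hq, hqV⟩ x
  have hex : ∀ q, ∃ γ : Equiv.Perm N, q ∈ U → circleCover q ∈ ψ.baseSet →
      ∀ x, (ψ (Φ (q, x))).2 = γ x := by
    intro q
    by_cases hq : q ∈ U ∧ circleCover q ∈ ψ.baseSet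
    · obtain ⟨V, -, hqV, hV⟩ := h q hq.1
      obtain ⟨τ, -, h2⟩ := hV.2 ψ hψ
      exact ⟨τ q, fun _ hq' => h2 q ⟨hq.1, hqV⟩ hq'⟩
    · exact ⟨1, fun h1 h2 => absurd ⟨h1, h2⟩ hq⟩
  choose τ hτ using hex
  refine ⟨τ, SmoothFam.of_locally fun q hq => ?_, hτ⟩
  obtain ⟨V, hVo, hqV, hV⟩ := h q hq.1
  obtain ⟨τ', h1, h2⟩ := hV.2 ψ hψ
  refine ⟨V, hVo, hqV, (h1.mono (inter_right_comm U _ V).subset).congr fun q' hq' => ?_⟩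
  ext x
  rw [← hτ q' hq'.1.1 hq'.1.2, h2 q' ⟨hq'.1.1, hq'.2⟩ hq'.1.2]

theorem exists_eq_symm (h : GoodChart π U Φ) {ψ : Bundle.Trivialization N π.proj}
    (hψ : ψ ∈ π.atlas) : ∃ τ, SmoothFam IN Γ (U ∩ circleCover ⁻¹' ψ.baseSet) τ ∧
      ∀ q ∈ U, circleCover q ∈ ψ.baseSet → ∀ x,
        (ψ (Φ (q, x))).2 = τ q x ∧
        Φ (q, x) = ψ.toOpenPartialHomeomorph.symm (circleCover q, τ q x) := by
  obtain ⟨τ, h1, h2⟩ := h.2 ψ hψ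
  exact ⟨τ, h1, fun q hq hq' x => ⟨h2 q hq hq' x,
    eq_symm_of_snd_eq hq' (h.1 q hq x) (h2 q hq hq' x)⟩⟩

theorem injective (h : GoodChart π U Φ) {q : ℝ} (hq : q ∈ U) {x y : N}
    (hxy : Φ (q, x) = Φ (q, y)) : x = y := by
  obtain ⟨ψ, hψ, hb⟩ := π.cover (circleCover q)
  obtain ⟨τ, -, h2⟩ := h.2 ψ hψ
  apply (τ q).injective
  rw [← h2 q hq hb, ← h2 q hq hb, hxy]

theorem exists_fiber (h : GoodChart π U Φ) {q : ℝ} (hq : q ∈ U) {y : M}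
    (hy : π.proj y = circleCover q) : ∃ x, Φ (q, x) = y := by
  obtain ⟨ψ, hψ, hb⟩ := π.cover (circleCover q)
  obtain ⟨τ, -, h2⟩ := h.exists_eq_symm hψ
  refine ⟨(τ q)⁻¹ (ψ y).2, ?_⟩
  rw [(h2 q hq hb _).2]
  simpa using (eq_symm_of_snd_eq hb hy rfl).symm

/-- Two charts over the same set differ by a smooth family in the structure group. -/
theorem exists_twist (h : GoodChart π U Φ) (h' : GoodChart π U Ψ) :
    ∃ σ, SmoothFam IN Γ U σ ∧ ∀ q ∈ U, ∀ x, Ψ (q, x) = Φ (q, σ q x) := by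
  have key : ∀ ψ ∈ π.atlas, ∃ σ, SmoothFam IN Γ (U ∩ circleCover ⁻¹' ψ.baseSet) σ ∧
      ∀ q ∈ U, circleCover q ∈ ψ.baseSet → ∀ x, Ψ (q, x) = Φ (q, σ q x) := by
    intro ψ hψ
    obtain ⟨τ, h1, h2⟩ := h.exists_eq_symm hψ
    obtain ⟨τ', h1', h2'⟩ := h'.exists_eq_symm hψ
    refine ⟨_, h1.inv.mul h1', fun q hq hq' x => ?_⟩
    rw [(h2' q hq hq' x).2, (h2 q hq hq' _).2]
    simp
  have hex : ∀ q, ∃ γ : Equiv.Perm N, q ∈ U → ∀ x, Ψ (q, x) = Φ (q, γ x) := by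
    intro q
    obtain ⟨ψ, hψ, hb⟩ := π.cover (circleCover q)
    obtain ⟨σ, -, h2⟩ := key ψ hψ
    exact ⟨σ q, fun hq => h2 q hq hb⟩
  choose σ hσ using hex
  refine ⟨σ, SmoothFam.of_locally fun q hq => ?_, hσ⟩
  obtain ⟨ψ, hψ, hb⟩ := π.cover (circleCover q)
  obtain ⟨σ', h1, h2⟩ := key ψ hψ
  refine ⟨_, ψ.open_baseSet.preimage continuous_circleCover, hb, h1.congr fun q' hq' => ?_⟩
  ext x
  apply h.injective hq'.1
  rw [← hσ q' hq'.1, h2 q' hq'.1 hq'.2]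

/-- Charts over two overlapping intervals can be glued after a twist of the second one: the family
comparing the two is extended to the right by reparametrizing the interval so that it becomes
constant. -/
theorem glue {α β α' β' : ℝ} (h : GoodChart π (Ioo α β) Φ) (h' : GoodChart π (Ioo α' β') Ψ)
    (h1 : α ≤ α') (h2 : α' < β) : ∃ X, GoodChart π (Ioo α β') X := by
  rcases le_or_gt β' β with h3 | h3
  · exact ⟨Φ, h.mono (Ioo_subset_Ioo_right h3)⟩
  obtain ⟨σ, hσ, e⟩ := (h'.mono (Ioo_subset_Ioo_right h3.le)).exists_twist
    (h.mono (Ioo_subset_Ioo_left h1))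
  set q₁ := α' + (β - α') / 3 with hq₁
  set q₂ := α' + 2 * (β - α') / 3 with hq₂
  have h12 : 0 < q₂ - q₁ := by rw [hq₁, hq₂]; linarith
  set μ : ℝ → ℝ := fun q => q + Real.smoothTransition ((q - q₁) / (q₂ - q₁)) * (q₂ - q) with hμ
  have hμc : ContDiff ℝ ∞ μ :=
    contDiff_id.add ((Real.smoothTransition.contDiff.comp (by fun_prop)).mul (by fun_prop))
  have hμ1 : ∀ q ≤ q₁, μ q = q := fun q hq => by
    simp only [hμ]
    rw [Real.smoothTransition.zero_of_nonpos
      (div_nonpos_of_nonpos_of_nonneg (by linarith) h12.le)]; ring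
  have hμ2 : MapsTo μ (Ioo α' β') (Ioo α' β) := by
    intro q hq
    rcases le_total q q₂ with hq2 | hq2
    · have s0 := Real.smoothTransition.nonneg ((q - q₁) / (q₂ - q₁))
      have s1 := Real.smoothTransition.le_one ((q - q₁) / (q₂ - q₁))
      have := mul_nonneg s0 (sub_nonneg.2 hq2)
      have := mul_le_mul_of_nonneg_right s1 (sub_nonneg.2 hq2)
      exact ⟨by simp only [hμ]; linarith [hq.1], by simp only [hμ]; linarith⟩
    · simp only [hμ]
      rw [Real.smoothTransition.one_of_one_le ((one_le_div h12).2 (by linarith))]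
      exact ⟨by linarith, by linarith⟩
  have ht := h'.twist (hσ.comp hμc hμ2)
  classical
  refine ⟨fun z => if z.1 < q₁ then Φ z else Ψ (z.1, σ (μ z.1) z.2),
    GoodChart.of_locally fun q hq => ?_⟩
  rcases lt_or_ge q q₁ with hq1 | hq1
  · refine ⟨Iio q₁, isOpen_Iio, hq1, (h.mono fun x hx => ⟨hx.1.1, ?_⟩).congr fun x hx y => ?_⟩
    · have : x < q₁ := hx.2
      linarith
    · exact if_pos hx.2
  · refine ⟨Ioi α', isOpen_Ioi, by simp only [mem_Ioi]; linarith,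
      (ht.mono fun x hx => ⟨hx.2, hx.1.2⟩).congr fun x hx y => ?_⟩
    dsimp only
    split_ifs with hx1
    · rw [hμ1 x hx1.le]
      exact e x ⟨hx.2, by linarith⟩ y
    · rfl

end GoodChart

variable (π)

/-- Charts over short intervals, which come from the atlas, are glued one after the other to a chart
over an interval longer than a period. -/
theorem exists_goodChart_Ioo : ∃ Φ, GoodChart π (Ioo (-1) 2) Φ := by
  obtain ⟨δ, hδ, hb⟩ := lebesgue_number_lemma_of_metric (ι := π.atlas)
    (c := fun ψ => circleCover ⁻¹' ψ.1.baseSet) (isCompact_Icc (a := (-1 : ℝ)) (b := 2))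
    (fun ψ => ψ.1.open_baseSet.preimage continuous_circleCover) (fun q _ => by
      obtain ⟨ψ, hψ, hb⟩ := π.cover (circleCover q)
      exact mem_iUnion.2 ⟨⟨ψ, hψ⟩, hb⟩)
  have hloc : ∀ q ∈ Icc (-1 : ℝ) 2, ∃ Φ, GoodChart π (Ioo (q - δ) (q + δ)) Φ := by
    intro q hq
    obtain ⟨ψ, h⟩ := hb q hq
    rw [Real.ball_eq_Ioo] at h
    exact ⟨_, (goodChart_of_mem_atlas ψ.2).mono h⟩
  have key : ∀ n : ℕ, -1 + n * (δ / 2) ≤ 2 →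
      ∃ Φ, GoodChart π (Ioo (-1) (-1 + n * (δ / 2) + δ)) Φ := by
    intro n
    induction n with
    | zero =>
      intro _
      obtain ⟨Φ, hΦ⟩ := hloc (-1) (by norm_num)
      exact ⟨Φ, hΦ.mono (Ioo_subset_Ioo (by linarith) (by simp))⟩
    | succ n ih =>
      intro hn
      push_cast at hn
      have hn0 : 0 ≤ n * (δ / 2) := by positivity
      obtain ⟨Φ, hΦ⟩ := ih (by linarith)
      obtain ⟨Ψ, hΨ⟩ := hloc (-1 + (n + 1) * (δ / 2)) ⟨by linarith, hn⟩
      obtain ⟨X, hX⟩ := hΦ.glue (hΨ.mono (Ioo_subset_Ioo_left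
        (show -1 + (n + 1) * (δ / 2) - δ ≤ -1 + n * (δ / 2) by linarith))) (by linarith)
        (by linarith)
      exact ⟨X, by push_cast; exact hX⟩
  have hd : 0 < δ / 2 := by linarith
  have h1 := Nat.floor_le (show 0 ≤ 3 / (δ / 2) by positivity)
  have h2 := Nat.lt_floor_add_one (3 / (δ / 2))
  rw [le_div_iff₀ hd] at h1
  rw [div_lt_iff₀ hd] at h2
  obtain ⟨Φ, hΦ⟩ := key ⌊3 / (δ / 2)⌋₊ (by linarith)
  exact ⟨Φ, hΦ.mono (Ioo_subset_Ioo_right (by linarith))⟩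

/-- A trivialization `Φ : ℝ × N → M` of the pullback of a bundle over the circle to the line, with
constant monodromy: `Φ (q + 1, x) = Φ (q, m x)` for an element `m` of the structure group. It
exhibits the bundle as the mapping torus of `m`. -/
structure TorusChart where
  toFun : ℝ × N → M
  mono : Equiv.Perm N
  mono_mem : mono ∈ Γ
  good : GoodChart π univ toFun
  periodic : ∀ q x, toFun (q + 1, x) = toFun (q, mono x)

/-- A chart over an interval longer than a period and its translate by `1` differ by a smooth family
`σ` in the structure group. A twist replaces `σ` near `0` by the constant `σ 0`, and then the chart
extends periodically. -/
theorem nonempty_torusChart (hΓ : Γ ≤ diffGroup IN N ∞) : Nonempty (TorusChart π) := by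
  obtain ⟨Φ₀, h₀⟩ := exists_goodChart_Ioo π
  obtain ⟨σ, hσ, e⟩ := (h₀.mono (V := Ioo (-1) 1)
    (Ioo_subset_Ioo_right (by norm_num))).exists_twist
    ((h₀.shift 1).mono (V := Ioo (-1) 1) fun q hq => ⟨by push_cast; linarith [hq.1],
      by push_cast; linarith [hq.2]⟩)
  push_cast at e
  -- the twist by `(σ (μ (q - 1)))⁻¹ * σ 0` makes the monodromy near `0` constant
  set μ : ℝ → ℝ := fun q => (q - 1) * Real.smoothTransition (4 * (q - 1) + 2) with hμ
  have hμc : ContDiff ℝ ∞ μ :=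
    (contDiff_id.sub contDiff_const).mul (Real.smoothTransition.contDiff.comp (by fun_prop))
  have hμ0 : ∀ q ≤ 1 / 2, μ q = 0 := fun q hq => by
    simp only [hμ]
    rw [Real.smoothTransition.zero_of_nonpos (by linarith), mul_zero]
  have hμ1 : ∀ q ≥ 3 / 4, μ q = q - 1 := fun q hq => by
    simp only [hμ]
    rw [Real.smoothTransition.one_of_one_le (by linarith), mul_one]
  have hμm : MapsTo μ (Ioo (-1) 2) (Ioo (-1) 1) := by
    intro q hq
    rcases le_total q (1 / 2) with h | h
    · rw [hμ0 q h]; norm_num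
    · have s0 := Real.smoothTransition.nonneg (4 * (q - 1) + 2)
      have s1 := Real.smoothTransition.le_one (4 * (q - 1) + 2)
      simp only [hμ]
      rcases le_total q 1 with h' | h'
      · exact ⟨by nlinarith, by nlinarith⟩
      · exact ⟨by nlinarith, by nlinarith [hq.2]⟩
  have h0 : (0 : ℝ) ∈ Ioo (-1 : ℝ) 1 := by norm_num
  have hm : σ 0 ∈ Γ := hσ.1 0 h0
  set m := σ 0 with hmd
  have ht := h₀.twist ((hσ.comp hμc hμm).inv.mul (SmoothFam.const hΓ hm _))
  set Φ₁ : ℝ × N → M := fun z => Φ₀ (z.1, ((σ (μ z.1))⁻¹ * m) z.2) with hΦ₁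
  have e1 : ∀ q ∈ Ioo (-1 / 4 : ℝ) (1 / 2), ∀ x, Φ₁ (q + 1, x) = Φ₁ (q, m x) := by
    intro q hq x
    simp only [hΦ₁]
    rw [hμ0 q hq.2.le, hμ1 (q + 1) (by linarith [hq.1]), add_sub_cancel_right,
      e q ⟨by linarith [hq.1], by linarith [hq.2]⟩]
    simp [← hmd]
  set Φ : ℝ × N → M := fun z => Φ₁ (Int.fract z.1, (m ^ ⌊z.1⌋) z.2) with hΦ
  have hloc : ∀ (n : ℤ) (q : ℝ), -1 / 4 + n < q → q < n + 1 → ∀ x,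
      Φ (q, x) = Φ₁ (q - n, (m ^ n) x) := by
    intro n q h1 h2 x
    rcases lt_or_ge q n with h | h
    · have hf : ⌊q⌋ = n - 1 := Int.floor_eq_iff.2 ⟨by push_cast; linarith, by push_cast; linarith⟩
      simp only [hΦ]
      rw [Int.fract, hf]
      have := e1 (q - n) ⟨by linarith, by linarith⟩ ((m ^ (n - 1)) x)
      push_cast
      rw [show q - (n - 1) = q - n + 1 by ring, this, ← Equiv.Perm.mul_apply, ← zpow_one_add,
        add_sub_cancel]
    · have hf : ⌊q⌋ = n := Int.floor_eq_iff.2 ⟨h, by linarith⟩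
      simp only [hΦ]
      rw [Int.fract, hf]
  refine ⟨⟨Φ, m, hm, GoodChart.of_locally fun q _ => ?_, fun q x => ?_⟩⟩
  · have hg := ((ht.twist (SmoothFam.const hΓ (Γ.zpow_mem hm ⌊q⌋) _)).shift (-⌊q⌋))
    refine ⟨Ioo (-1 / 4 + ⌊q⌋) (⌊q⌋ + 1), isOpen_Ioo, ⟨by linarith [Int.floor_le q],
      Int.lt_floor_add_one q⟩, (hg.mono fun q' hq' => ?_).congr fun q' hq' x => ?_⟩
    · have h1 := hq'.2.1
      have h2 := hq'.2.2
      exact ⟨by push_cast; linarith, by push_cast; linarith⟩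
    · rw [hloc ⌊q⌋ q' hq'.2.1 hq'.2.2]
      push_cast
      rw [← sub_eq_add_neg]
  · simp only [hΦ]
    rw [Int.fract_add_one, Int.floor_add_one, zpow_add_one, Equiv.Perm.mul_apply]

end Charts

/-! ### Bundle maps and isotopies on the line and on the circle -/

section Isotopies

variable {EM HM EB HB EN HN : Type*}
  [NormedAddCommGroup EM] [NormedSpace ℝ EM] [TopologicalSpace HM]
  [NormedAddCommGroup EB] [NormedSpace ℝ EB] [TopologicalSpace HB]
  [NormedAddCommGroup EN] [NormedSpace ℝ EN] [TopologicalSpace HN]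

namespace GammaBundle

variable {IM : ModelWithCorners ℝ EM HM} {IB : ModelWithCorners ℝ EB HB}
  {IN : ModelWithCorners ℝ EN HN} {N : Type*} [TopologicalSpace N] [ChartedSpace HN N]
  {Γ : Subgroup (Equiv.Perm N)} {M B : Type*} [TopologicalSpace M] [ChartedSpace HM M]
  [TopologicalSpace B] [ChartedSpace HB B] {π : GammaBundle IM IB IN Γ M B} {r : ℕ∞}

theorem continuous_proj (π : GammaBundle IM IB IN Γ M B) : Continuous π.proj :=
  continuous_iff_continuousAt.2 fun y => by
    obtain ⟨ψ, -, hb⟩ := π.cover (π.proj y)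
    exact ψ.continuousAt_proj (ψ.mem_source.2 hb)

theorem mem_isot {F : unitInterval → Equiv.Perm M}
    (h1 : ContMDiff (IM.prod (𝓡∂ 1)) IM r (fun p : M × unitInterval => F p.2 p.1))
    (h2 : ContMDiff (IM.prod (𝓡∂ 1)) IM r (fun p : M × unitInterval => (F p.2)⁻¹ p.1))
    (h3 : ∀ t, π.IsBundleMap (F t)) : F ∈ π.isot r :=
  ⟨h1, h2, fun t => ⟨⟨h1.comp (contMDiff_id.prodMk contMDiff_const),
    h2.comp (contMDiff_id.prodMk contMDiff_const)⟩, h3 t⟩⟩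

theorem const_mem_isot {f : Equiv.Perm M} (hf : f ∈ π.diff r) : (fun _ => f) ∈ π.isot r :=
  mem_isot (hf.1.1.comp contMDiff_fst) (hf.1.2.comp contMDiff_fst) fun _ => hf.2

theorem mem_isot0_iff {F : unitInterval → Equiv.Perm M} :
    F ∈ π.isot0 r ↔ F ∈ π.isot r ∧ F 0 = 1 := Iff.rfl

end GammaBundle

end Isotopies

section Line

variable {EN HN : Type*} [NormedAddCommGroup EN] [NormedSpace ℝ EN] [TopologicalSpace HN]
  (IN : ModelWithCorners ℝ EN HN) {N : Type*} [TopologicalSpace N] [ChartedSpace HN N]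
  (Γ : Subgroup (Equiv.Perm N))

/-- The product bundle over the line. -/
noncomputable abbrev lineBundle : GammaBundle (𝓘(ℝ, ℝ).prod IN) 𝓘(ℝ, ℝ) IN Γ (ℝ × N) ℝ :=
  productBundle 𝓘(ℝ, ℝ) IN Γ ℝ

variable {IN Γ}

theorem exists_triv_lineBundle : ∃ e ∈ (lineBundle IN Γ).atlas, e.baseSet = univ ∧
    ∀ q x, e (q, x) = (q, x) ∧ e.toOpenPartialHomeomorph.symm (q, x) = (q, x) :=
  ⟨{toOpenPartialHomeomorph := OpenPartialHomeomorph.refl (ℝ × N)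
    baseSet := univ
    open_baseSet := isOpen_univ
    source_eq := by simp
    target_eq := by simp
    proj_toFun := fun _ _ => rfl },
    ⟨⟨contMDiffOn_id, contMDiffOn_id⟩, fun q _ => ⟨1, Γ.one_mem, fun x => rfl⟩⟩, rfl,
    fun _ _ => ⟨rfl, rfl⟩⟩

theorem isBundleMap_line_iff {f : ℝ × N → ℝ × N} : (lineBundle IN Γ).IsBundleMap f ↔
    ∃ g : ℝ → ℝ, ∀ q, ∃ γ ∈ Γ, ∀ x, f (q, x) = (g q, γ x) := by
  obtain ⟨e, he, hb, hid⟩ := exists_triv_lineBundle (IN := IN) (Γ := Γ)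
  have hid' : ∀ z, e z = z := fun z => (hid z.1 z.2).1
  constructor
  · rintro ⟨g, hg, h⟩
    refine ⟨g, fun q => ?_⟩
    obtain ⟨γ, hγ, h'⟩ := h e he e he q (by rw [hb]; trivial) (by rw [hb]; trivial)
    refine ⟨γ, hγ, fun x => Prod.ext (hg (q, x)) ?_⟩
    have := h' x
    rw [(hid q x).2] at this
    rw [← this, hid' (f (q, x))]
  · rintro ⟨g, h⟩
    refine ⟨g, fun z => ?_, fun φ hφ ψ hψ q hq hq' => ?_⟩
    · obtain ⟨γ, -, h'⟩ := h z.1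
      exact congrArg Prod.fst (h' z.2)
    · obtain ⟨γ, hγ, h'⟩ := h q
      obtain ⟨γ₁, hγ₁, h₁⟩ := (lineBundle IN Γ).compat φ hφ e he q ⟨hq, by rw [hb]; trivial⟩
      obtain ⟨γ₂, hγ₂, h₂⟩ := (lineBundle IN Γ).compat e he ψ hψ (g q) ⟨by rw [hb]; trivial, hq'⟩
      refine ⟨γ₂ * γ * γ₁, Γ.mul_mem (Γ.mul_mem hγ₂ hγ) hγ₁, fun x => ?_⟩
      have e1 : φ.toOpenPartialHomeomorph.symm (q, x) = (q, γ₁ x) := by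
        refine Prod.ext (φ.proj_symm_apply' hq) ?_
        rw [← h₁ x, hid' (φ.toOpenPartialHomeomorph.symm (q, x))]
      rw [e1, h', Equiv.Perm.mul_apply, Equiv.Perm.mul_apply, ← h₂, (hid _ _).2]

end Line

/-! ### The mapping torus -/

namespace TorusChart

variable {EM HM EN HN : Type*}
  [NormedAddCommGroup EM] [NormedSpace ℝ EM] [TopologicalSpace HM]
  [NormedAddCommGroup EN] [NormedSpace ℝ EN] [TopologicalSpace HN]
  {IM : ModelWithCorners ℝ EM HM} {IN : ModelWithCorners ℝ EN HN}
  {N : Type*} [TopologicalSpace N] [ChartedSpace HN N] {Γ : Subgroup (Equiv.Perm N)}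
  {M : Type*} [TopologicalSpace M] [ChartedSpace HM M]
  {π : GammaBundle IM (𝓡 1) IN Γ M Circle} {r : ℕ∞} (C : TorusChart π)

theorem proj_toFun (z : ℝ × N) : π.proj (C.toFun z) = circleCover z.1 :=
  C.good.1 z.1 trivial z.2

theorem contMDiff_toFun : ContMDiff (𝓘(ℝ, ℝ).prod IN) IM ∞ C.toFun := by
  refine contMDiffOn_univ.1 (contMDiffOn_of_locally_contMDiffOn fun z _ => ?_)
  obtain ⟨ψ, hψ, hb⟩ := π.cover (circleCover z.1)
  obtain ⟨τ, hτ, h⟩ := C.good.exists_eq_symm hψ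
  rw [univ_inter] at hτ
  refine ⟨(circleCover ⁻¹' ψ.baseSet) ×ˢ univ,
    (ψ.open_baseSet.preimage continuous_circleCover).prod isOpen_univ, ⟨hb, trivial⟩, ?_⟩
  rw [univ_inter]
  exact ((contMDiffOn_symm_circleCover hψ).comp (contMDiff_fst.contMDiffOn.prodMk hτ.2.1)
    fun w hw => ⟨hw.1, trivial⟩).congr fun w hw => (h w.1 trivial hw.1 w.2).2

theorem toFun_ext {z w : ℝ × N} (h : C.toFun z = C.toFun w) (h1 : z.1 = w.1) : z = w := by
  obtain ⟨q, x⟩ := z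
  obtain ⟨q', y⟩ := w
  obtain rfl : q = q' := h1
  rw [C.good.injective trivial h]

theorem exists_fiber {q : ℝ} {y : M} (hy : π.proj y = circleCover q) :
    ∃ x, C.toFun (q, x) = y := C.good.exists_fiber trivial hy

theorem surjective_toFun : Surjective C.toFun := fun y => by
  obtain ⟨q, hq⟩ := circleCover_surjective (π.proj y)
  obtain ⟨x, hx⟩ := C.exists_fiber hq.symm
  exact ⟨_, hx⟩

/-- The part of the total space over the arc from `c` to `c + 1`. -/
def arc (π : GammaBundle IM (𝓡 1) IN Γ M Circle) (c : ℝ) : Set M :=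
  π.proj ⁻¹' (circleCover '' Ioo c (c + 1))

theorem isOpen_arc (c : ℝ) : IsOpen (arc π c) :=
  (isOpenMap_circleCover _ isOpen_Ioo).preimage π.continuous_proj

theorem mem_arc_iff {c : ℝ} {y : M} :
    y ∈ arc π c ↔ ∃ z : ℝ × N, z.1 ∈ Ioo c (c + 1) ∧ C.toFun z = y := by
  constructor
  · rintro ⟨q, hq, h⟩
    obtain ⟨x, hx⟩ := C.exists_fiber h.symm
    exact ⟨(q, x), hq, hx⟩
  · rintro ⟨z, hz, rfl⟩
    exact ⟨z.1, hz, (C.proj_toFun z).symm⟩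

theorem injOn_arc {c : ℝ} {z w : ℝ × N} (hz : z.1 ∈ Ioo c (c + 1)) (hw : w.1 ∈ Ioo c (c + 1))
    (h : C.toFun z = C.toFun w) : z = w := by
  refine C.toFun_ext h (injOn_circleCover_Ico c (Ioo_subset_Ico_self hz)
    (Ioo_subset_Ico_self hw) ?_)
  rw [← C.proj_toFun, ← C.proj_toFun, h]

/-- The restriction of `Φ` to `(c, c + 1) × N` has a smooth inverse. -/
theorem exists_log [Nonempty N] (c : ℝ) : ∃ κ : M → ℝ × N,
    ContMDiffOn IM (𝓘(ℝ, ℝ).prod IN) ∞ κ (arc π c) ∧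
    ∀ z : ℝ × N, z.1 ∈ Ioo c (c + 1) → κ (C.toFun z) = z := by
  classical
  set κ : M → ℝ × N := fun y => Classical.epsilon fun z => z.1 ∈ Ioo c (c + 1) ∧ C.toFun z = y
    with hκd
  have hκ : ∀ z : ℝ × N, z.1 ∈ Ioo c (c + 1) → κ (C.toFun z) = z := by
    intro z hz
    have := Classical.epsilon_spec (p := fun w => w.1 ∈ Ioo c (c + 1) ∧ C.toFun w = C.toFun z)
      ⟨z, hz, rfl⟩
    exact C.injOn_arc this.1 hz this.2
  refine ⟨κ, ?_, hκ⟩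
  have hsrc : ∀ ψ : Bundle.Trivialization N π.proj, IsOpen ψ.source := fun ψ => ψ.open_source
  refine contMDiffOn_of_locally_contMDiffOn fun y _ => ?_
  obtain ⟨ψ, hψ, hb⟩ := π.cover (π.proj y)
  obtain ⟨τ, hτ, h⟩ := C.good.exists_eq_symm hψ
  rw [univ_inter] at hτ
  refine ⟨ψ.source, hsrc ψ, ψ.mem_source.2 hb, ?_⟩
  have h1 : ContMDiffOn IM (𝓡 1) ∞ π.proj (arc π c ∩ ψ.source) :=
    ((contMDiff_fst.comp_contMDiffOn (π.smooth ψ hψ).1).mono inter_subset_right).congr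
      fun w hw => (ψ.proj_toFun w hw.2).symm
  have h2 : ContMDiffOn IM 𝓘(ℝ, ℝ) ∞ (fun w => circleLog c (π.proj w)) (arc π c ∩ ψ.source) :=
    (contMDiffOn_circleLog c).comp h1 fun w hw => hw.1
  have h3 : ContMDiffOn IM IN ∞ (fun w => (ψ w).2) (arc π c ∩ ψ.source) :=
    (contMDiff_snd.comp_contMDiffOn (π.smooth ψ hψ).1).mono inter_subset_right
  have key : ∀ w ∈ arc π c ∩ ψ.source, circleCover (circleLog c (π.proj w)) = π.proj w := by
    rintro w ⟨⟨q, hq, h⟩, -⟩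
    rw [← h, circleLog_circleCover hq]
  have h4 : ContMDiffOn IM IN ∞ (fun w => (τ (circleLog c (π.proj w)))⁻¹ (ψ w).2)
      (arc π c ∩ ψ.source) :=
    hτ.2.2.comp (h2.prodMk h3) fun w hw => ⟨by
      rw [mem_preimage, key w hw]; exact ψ.mem_source.1 hw.2, trivial⟩
  refine (h2.prodMk h4).congr fun w hw => ?_
  obtain ⟨z, hz, rfl⟩ := C.mem_arc_iff.1 hw.1
  have hz' : circleCover z.1 ∈ ψ.baseSet := by
    have := ψ.mem_source.1 hw.2
    rwa [C.proj_toFun] at this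
  rw [hκ z hz, C.proj_toFun, circleLog_circleCover hz, (h z.1 trivial hz' z.2).1]
  simp

/-- The inverse of `Φ` over an arc, with values in `(c, c + 1) × N`. -/
noncomputable def log [Nonempty N] (c : ℝ) : M → ℝ × N := (C.exists_log c).choose

theorem contMDiffOn_log [Nonempty N] (c : ℝ) :
    ContMDiffOn IM (𝓘(ℝ, ℝ).prod IN) ∞ (C.log c) (arc π c) := (C.exists_log c).choose_spec.1

theorem log_toFun [Nonempty N] {c : ℝ} {z : ℝ × N} (hz : z.1 ∈ Ioo c (c + 1)) :
    C.log c (C.toFun z) = z := (C.exists_log c).choose_spec.2 z hz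

theorem log_mem [Nonempty N] {c : ℝ} {y : M} (hy : y ∈ arc π c) :
    (C.log c y).1 ∈ Ioo c (c + 1) ∧ C.toFun (C.log c y) = y := by
  obtain ⟨z, hz, rfl⟩ := C.mem_arc_iff.1 hy
  rw [C.log_toFun hz]
  exact ⟨hz, rfl⟩

/-- The generator of the deck transformations of `Φ`. -/
noncomputable def deck : Equiv.Perm (ℝ × N) where
  toFun z := (z.1 + 1, C.mono⁻¹ z.2)
  invFun z := (z.1 - 1, C.mono z.2)
  left_inv z := by simp
  right_inv z := by simp

theorem deck_apply (z : ℝ × N) : C.deck z = (z.1 + 1, C.mono⁻¹ z.2) := rfl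

theorem toFun_deck (z : ℝ × N) : C.toFun (C.deck z) = C.toFun z := by
  rw [deck_apply, C.periodic]; simp

theorem toFun_deck_zpow (n : ℤ) (z : ℝ × N) : C.toFun ((C.deck ^ n) z) = C.toFun z := by
  induction n generalizing z with
  | zero => simp
  | succ n ih => rw [zpow_add_one, Equiv.Perm.mul_apply, ih, toFun_deck]
  | pred n ih =>
    rw [zpow_sub_one, Equiv.Perm.mul_apply, ih, ← C.toFun_deck (C.deck⁻¹ z)]
    simp

theorem deck_zpow_fst (n : ℤ) (z : ℝ × N) : ((C.deck ^ n) z).1 = z.1 + n := by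
  induction n generalizing z with
  | zero => simp
  | succ n ih =>
    rw [zpow_add_one, Equiv.Perm.mul_apply, ih, deck_apply]; push_cast; ring
  | pred n ih =>
    rw [zpow_sub_one, Equiv.Perm.mul_apply, ih]
    have : (C.deck⁻¹ z).1 = z.1 - 1 := rfl
    rw [this]; push_cast; ring

theorem exists_deck_zpow {z w : ℝ × N} (h : C.toFun z = C.toFun w) :
    ∃ n : ℤ, w = (C.deck ^ n) z := by
  have h1 : circleCover w.1 = circleCover z.1 := by
    rw [← C.proj_toFun, ← C.proj_toFun, h]
  obtain ⟨n, hn⟩ := circleCover_eq_iff.1 h1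
  exact ⟨n, C.toFun_ext (by rw [C.toFun_deck_zpow, h]) (by rw [C.deck_zpow_fst, hn])⟩

/-! ### Lifting and descending isotopies -/

/-- A bundle map acts between the fibers, read in the chart `Φ`, by elements of `Γ`. -/
theorem exists_of_isBundleMap {f : M → M} (hf : π.IsBundleMap f) {q q' : ℝ} {x₀ : N}
    (h : π.proj (f (C.toFun (q, x₀))) = circleCover q') :
    ∃ γ ∈ Γ, ∀ x, f (C.toFun (q, x)) = C.toFun (q', γ x) := by
  obtain ⟨g, hg, hf⟩ := hf
  obtain ⟨φ, hφ, hb⟩ := π.cover (circleCover q)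
  obtain ⟨ψ, hψ, hb'⟩ := π.cover (circleCover q')
  have hgq : g (circleCover q) = circleCover q' := by rw [← h, hg, C.proj_toFun]
  obtain ⟨γ, hγ, e⟩ := hf φ hφ ψ hψ _ hb (by rw [hgq]; exact hb')
  obtain ⟨τ, hτ, h1⟩ := C.good.exists_eq_symm hφ
  obtain ⟨τ', hτ', h2⟩ := C.good.exists_eq_symm hψ
  refine ⟨(τ' q')⁻¹ * γ * τ q, Γ.mul_mem (Γ.mul_mem (Γ.inv_mem (hτ'.1 _ ⟨trivial, hb'⟩)) hγ)
    (hτ.1 _ ⟨trivial, hb⟩), fun x => ?_⟩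
  have h3 : π.proj (f (C.toFun (q, x))) = circleCover q' := by rw [hg, C.proj_toFun, hgq]
  rw [(h2 q' trivial hb' _).2]
  refine eq_symm_of_snd_eq hb' h3 ?_
  rw [(h1 q trivial hb x).2, e]
  simp

theorem isBundleMap_of_forall [Nonempty N] {f : M → M}
    (h : ∀ q, ∃ q', ∃ γ ∈ Γ, ∀ x, f (C.toFun (q, x)) = C.toFun (q', γ x)) :
    π.IsBundleMap f := by
  choose g γ hγ h using h
  have hper : ∀ q q' : ℝ, circleCover q = circleCover q' →
      circleCover (g q) = circleCover (g q') := by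
    intro q q' hqq
    obtain ⟨x⟩ := ‹Nonempty N›
    obtain ⟨x', hx'⟩ := C.exists_fiber (q := q') (y := C.toFun (q, x))
      (by rw [C.proj_toFun]; exact hqq)
    have h1 := congrArg π.proj (h q x)
    have h2 := congrArg π.proj (h q' x')
    rw [C.proj_toFun] at h1 h2
    rw [hx', h1] at h2
    exact h2
  set s := surjInv circleCover_surjective with hs
  have hsc : ∀ b, circleCover (s b) = b := surjInv_eq circleCover_surjective
  refine ⟨fun b => circleCover (g (s b)), fun y => ?_, fun φ hφ ψ hψ b hb hb' => ?_⟩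
  · obtain ⟨x, hx⟩ := C.exists_fiber (hsc (π.proj y)).symm
    conv_lhs => rw [← hx, h, C.proj_toFun]
  · obtain ⟨τ, hτ, h1⟩ := C.good.exists_eq_symm hφ
    obtain ⟨τ', hτ', h2⟩ := C.good.exists_eq_symm hψ
    have hbs : circleCover (s b) ∈ φ.baseSet := by rw [hsc]; exact hb
    refine ⟨τ' (g (s b)) * γ (s b) * (τ (s b))⁻¹, Γ.mul_mem (Γ.mul_mem
      (hτ'.1 _ ⟨trivial, hb'⟩) (hγ _)) (Γ.inv_mem (hτ.1 _ ⟨trivial, hbs⟩)), fun x => ?_⟩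
    have h3 := (h1 (s b) trivial hbs ((τ (s b))⁻¹ x)).2
    rw [hsc] at h3
    have h4 : τ (s b) ((τ (s b))⁻¹ x) = x := by simp
    rw [h4] at h3
    rw [← h3, h, (h2 _ trivial hb' _).1]
    simp

/-- The isotopies of the product bundle over the line that start at the identity and commute with
the deck transformations. -/
noncomputable def equivIsot (r : ℕ∞) : Subgroup (unitInterval → Equiv.Perm (ℝ × N)) :=
  (lineBundle IN Γ).isot0 r ⊓ Subgroup.centralizer {fun _ => C.deck}

theorem mem_equivIsot {F : unitInterval → Equiv.Perm (ℝ × N)} :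
    F ∈ C.equivIsot r ↔ F ∈ (lineBundle IN Γ).isot0 r ∧ ∀ t, Commute (F t) C.deck := by
  refine and_congr_right fun _ => ?_
  refine Subgroup.mem_centralizer_singleton_iff.trans ?_
  exact ⟨fun h t => (congrFun h t), fun h => funext fun t => (h t)⟩

/-- `g` covers `f` with respect to the covering map `Φ`. -/
def Lifts (g : Equiv.Perm (ℝ × N)) (f : Equiv.Perm M) : Prop :=
  ∀ z, f (C.toFun z) = C.toFun (g z)

variable {C} in
theorem Lifts.mul {g g' : Equiv.Perm (ℝ × N)} {f f' : Equiv.Perm M} (h : C.Lifts g f)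
    (h' : C.Lifts g' f') : C.Lifts (g * g') (f * f') := fun z => by
  rw [Equiv.Perm.mul_apply, h' z, h, Equiv.Perm.mul_apply]

variable {C} in
theorem Lifts.inv {g : Equiv.Perm (ℝ × N)} {f : Equiv.Perm M} (h : C.Lifts g f) :
    C.Lifts g⁻¹ f⁻¹ := fun z => by
  rw [Equiv.Perm.inv_eq_iff_eq, h]; simp

variable {C} in
theorem Lifts.eq {g : Equiv.Perm (ℝ × N)} {f f' : Equiv.Perm M} (h : C.Lifts g f)
    (h' : C.Lifts g f') : f = f' := by
  ext y
  obtain ⟨z, rfl⟩ := C.surjective_toFun y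
  rw [h, h']

theorem exists_lifts_of_commute {g : Equiv.Perm (ℝ × N)} (hg : Commute g C.deck) :
    ∃ f, C.Lifts g f := by
  set s := surjInv C.surjective_toFun with hs
  have hsc : ∀ y, C.toFun (s y) = y := surjInv_eq C.surjective_toFun
  have key : ∀ g : Equiv.Perm (ℝ × N), Commute g C.deck →
      ∀ z, C.toFun (g (s (C.toFun z))) = C.toFun (g z) := by
    intro g hg z
    obtain ⟨n, hn⟩ := C.exists_deck_zpow (hsc (C.toFun z)).symm
    rw [← hs] at *
    have := (hg.zpow_right n).eq
    rw [hn, ← Equiv.Perm.mul_apply, this, Equiv.Perm.mul_apply, C.toFun_deck_zpow]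
  refine ⟨⟨fun y => C.toFun (g (s y)), fun y => C.toFun (g⁻¹ (s y)), fun y => ?_, fun y => ?_⟩,
    fun z => key g hg z⟩
  · dsimp only
    rw [key _ hg.inv_left]; simp [hsc]
  · dsimp only
    rw [key _ hg]; simp [hsc]

theorem contMDiff_of_lifts [Nonempty N] {F : unitInterval → Equiv.Perm (ℝ × N)}
    {G : unitInterval → Equiv.Perm M} (h : ∀ t, C.Lifts (F t) (G t))
    (hF : ContMDiff ((𝓘(ℝ, ℝ).prod IN).prod (𝓡∂ 1)) (𝓘(ℝ, ℝ).prod IN) r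
      (fun p : (ℝ × N) × unitInterval => F p.2 p.1)) :
    ContMDiff (IM.prod (𝓡∂ 1)) IM r (fun p : M × unitInterval => G p.2 p.1) := by
  have hr : (r : WithTop ℕ∞) ≤ ∞ := by exact_mod_cast le_top
  refine contMDiffOn_univ.1 (contMDiffOn_of_locally_contMDiffOn fun p _ => ?_)
  obtain ⟨z, hz⟩ := C.surjective_toFun p.1
  refine ⟨arc π (z.1 - 1 / 2) ×ˢ univ, (isOpen_arc _).prod isOpen_univ,
    ⟨C.mem_arc_iff.2 ⟨z, ⟨by linarith, by linarith⟩, hz⟩, trivial⟩, ?_⟩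
  rw [univ_inter]
  have h1 : ContMDiffOn (IM.prod (𝓡∂ 1)) (𝓘(ℝ, ℝ).prod IN) r
      (fun p : M × unitInterval => C.log (z.1 - 1 / 2) p.1) (arc π (z.1 - 1 / 2) ×ˢ univ) :=
    ((C.contMDiffOn_log _).of_le hr).comp contMDiff_fst.contMDiffOn fun w hw => hw.1
  refine (((C.contMDiff_toFun.of_le hr).comp hF).comp_contMDiffOn
    (h1.prodMk contMDiff_snd.contMDiffOn)).congr fun w hw => ?_
  simp only [comp_apply]
  rw [← h, (C.log_mem hw.1).2]

/-- Equivariant isotopies of the product bundle over the line descend to isotopies of the bundle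
over the circle. -/
theorem exists_descent [Nonempty N] {F : unitInterval → Equiv.Perm (ℝ × N)}
    (hF : F ∈ C.equivIsot r) : ∃ G ∈ π.isot0 r, ∀ t, C.Lifts (F t) (G t) := by
  rw [mem_equivIsot, GammaBundle.mem_isot0_iff] at hF
  obtain ⟨⟨⟨h1, h2, h3⟩, h0⟩, hc⟩ := hF
  choose G hG using fun t => C.exists_lifts_of_commute (hc t)
  refine ⟨G, GammaBundle.mem_isot0_iff.2 ⟨GammaBundle.mem_isot (C.contMDiff_of_lifts hG h1)
    (C.contMDiff_of_lifts (F := fun t => (F t)⁻¹) (G := fun t => (G t)⁻¹)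
      (fun t => (hG t).inv) h2) fun t => ?_, ?_⟩, hG⟩
  · obtain ⟨g, hg⟩ := isBundleMap_line_iff.1 (h3 t).2
    refine C.isBundleMap_of_forall fun q => ?_
    obtain ⟨γ, hγ, e⟩ := hg q
    exact ⟨g q, γ, hγ, fun x => by rw [hG, e]⟩
  · exact (hG 0).eq (by rw [h0]; exact fun z => rfl)

/-- The homotopy of the base that underlies an isotopy lifts to the line, starting at the identity. -/
theorem exists_lift_aux [Nonempty N] {F : unitInterval → Equiv.Perm M} (hF : F ∈ π.isot0 r) :
    ∃ (f : unitInterval → ℝ → ℝ) (γ : unitInterval → ℝ → Equiv.Perm N),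
      Continuous (fun p : unitInterval × ℝ => f p.1 p.2) ∧ (∀ q, f 0 q = q) ∧
      (∀ t q, γ t q ∈ Γ) ∧ ∀ t q x, F t (C.toFun (q, x)) = C.toFun (f t q, γ t q x) := by
  obtain ⟨⟨h1, h2, h3⟩, h0⟩ := hF
  have h0 : F 0 = 1 := h0
  obtain ⟨x₀⟩ := ‹Nonempty N›
  have hΦ : Continuous C.toFun := C.contMDiff_toFun.continuous
  let H : C(unitInterval × ℝ, Circle) := ⟨fun p => π.proj (F p.1 (C.toFun (p.2, x₀))),
    π.continuous_proj.comp (h1.continuous.comp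
      ((hΦ.comp (continuous_snd.prodMk continuous_const)).prodMk continuous_fst))⟩
  have H0 : ∀ q, H (0, q) = circleCover (ContinuousMap.id ℝ q) := fun q => by
    change π.proj (F 0 (C.toFun (q, x₀))) = _
    rw [h0, Equiv.Perm.one_apply, C.proj_toFun]; rfl
  let f := isCoveringMap_circleCover.liftHomotopy H (ContinuousMap.id ℝ) H0
  have hf : ∀ p, circleCover (f p) = H p := fun p =>
    congrFun (isCoveringMap_circleCover.liftHomotopy_lifts H (ContinuousMap.id ℝ) H0) p
  have key : ∀ t q, ∃ γ ∈ Γ, ∀ x, F t (C.toFun (q, x)) = C.toFun (f (t, q), γ x) := fun t q =>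
    C.exists_of_isBundleMap (h3 t).2 (x₀ := x₀) (hf (t, q)).symm
  choose γ hγ e using key
  exact ⟨fun t q => f (t, q), γ, f.continuous,
    fun q => isCoveringMap_circleCover.liftHomotopy_zero H (ContinuousMap.id ℝ) H0 q, hγ, e⟩

/-- A lift of a `C^r` isotopy is `C^r` as soon as its base component is continuous, since `Φ` is a
local diffeomorphism. -/
theorem contMDiff_lift [Nonempty N] {G : unitInterval → Equiv.Perm M}
    {F : unitInterval → ℝ × N → ℝ × N} (h : ∀ t z, G t (C.toFun z) = C.toFun (F t z))
    (hc : Continuous fun p : (ℝ × N) × unitInterval => (F p.2 p.1).1)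
    (hG : ContMDiff (IM.prod (𝓡∂ 1)) IM r (fun p : M × unitInterval => G p.2 p.1)) :
    ContMDiff ((𝓘(ℝ, ℝ).prod IN).prod (𝓡∂ 1)) (𝓘(ℝ, ℝ).prod IN) r
      (fun p : (ℝ × N) × unitInterval => F p.2 p.1) := by
  have hr : (r : WithTop ℕ∞) ≤ ∞ := by exact_mod_cast le_top
  refine contMDiffOn_univ.1 (contMDiffOn_of_locally_contMDiffOn fun p _ => ?_)
  set c := (F p.2 p.1).1 - 1 / 2 with hcd
  refine ⟨(fun p : (ℝ × N) × unitInterval => (F p.2 p.1).1) ⁻¹' Ioo c (c + 1),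
    isOpen_Ioo.preimage hc, ⟨by simp only [hcd]; linarith, by simp only [hcd]; linarith⟩, ?_⟩
  rw [univ_inter]
  have h1 : ContMDiff ((𝓘(ℝ, ℝ).prod IN).prod (𝓡∂ 1)) IM r
      (fun p : (ℝ × N) × unitInterval => G p.2 (C.toFun p.1)) :=
    hG.comp (((C.contMDiff_toFun.of_le hr).comp contMDiff_fst).prodMk contMDiff_snd)
  refine (((C.contMDiffOn_log c).of_le hr).comp h1.contMDiffOn fun w hw => ?_).congr
    fun w hw => ?_
  · exact C.mem_arc_iff.2 ⟨F w.2 w.1, hw, (h _ _).symm⟩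
  · simp only [comp_apply]
    rw [h, C.log_toFun hw]

/-- Isotopies of the bundle lift to the product bundle over the line. -/
theorem exists_lift [Nonempty N] {G : unitInterval → Equiv.Perm M} (hG : G ∈ π.isot0 r) :
    ∃ F ∈ C.equivIsot r, ∀ t, C.Lifts (F t) (G t) := by
  obtain ⟨f, γ, hf, hf0, hγ, e⟩ := C.exists_lift_aux hG
  obtain ⟨f', γ', hf', hf0', hγ', e'⟩ := C.exists_lift_aux ((π.isot0 r).inv_mem hG)
  have e' : ∀ t q x, (G t)⁻¹ (C.toFun (q, x)) = C.toFun (f' t q, γ' t q x) := e'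
  obtain ⟨x₀⟩ := ‹Nonempty N›
  have hft : ∀ q, Continuous fun t => f t q := fun q =>
    hf.comp (continuous_id.prodMk continuous_const)
  have hft' : ∀ q, Continuous fun t => f' t q := fun q =>
    hf'.comp (continuous_id.prodMk continuous_const)
  have inv1 : ∀ t z, C.toFun (f' t (f t z.1), γ' t (f t z.1) (γ t z.1 z.2)) = C.toFun z :=
    fun t z => by rw [← e', ← e]; simp
  have inv2 : ∀ t z, C.toFun (f t (f' t z.1), γ t (f' t z.1) (γ' t z.1 z.2)) = C.toFun z :=
    fun t z => by rw [← e, ← e']; simp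
  have b1 : ∀ q t, f' t (f t q) = q := fun q => congrFun (lift_unique
    (hf'.comp (continuous_id.prodMk (hft q))) continuous_const (fun t => by
      have := congrArg π.proj (inv1 t (q, x₀))
      rwa [C.proj_toFun, C.proj_toFun] at this) (by simp [hf0, hf0']))
  have b2 : ∀ q t, f t (f' t q) = q := fun q => congrFun (lift_unique
    (hf.comp (continuous_id.prodMk (hft' q))) continuous_const (fun t => by
      have := congrArg π.proj (inv2 t (q, x₀))
      rwa [C.proj_toFun, C.proj_toFun] at this) (by simp [hf0, hf0']))
  let F : unitInterval → Equiv.Perm (ℝ × N) := fun t =>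
    { toFun := fun z => (f t z.1, γ t z.1 z.2)
      invFun := fun z => (f' t z.1, γ' t z.1 z.2)
      left_inv := fun z => C.toFun_ext (inv1 t z) (b1 z.1 t)
      right_inv := fun z => C.toFun_ext (inv2 t z) (b2 z.1 t) }
  have hF : ∀ t, C.Lifts (F t) (G t) := fun t z => e t z.1 z.2
  refine ⟨F, C.mem_equivIsot.2 ⟨GammaBundle.mem_isot0_iff.2 ⟨GammaBundle.mem_isot ?_ ?_
    fun t => ?_, ?_⟩, fun t => ?_⟩, hF⟩
  · exact C.contMDiff_lift (F := fun t => F t) hF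
      (hf.comp (continuous_snd.prodMk (continuous_fst.comp continuous_fst))) hG.1.1
  · exact C.contMDiff_lift (F := fun t => ((F t)⁻¹ : Equiv.Perm (ℝ × N))) (G := fun t => (G t)⁻¹)
      (fun t => (hF t).inv)
      (hf'.comp (continuous_snd.prodMk (continuous_fst.comp continuous_fst))) hG.1.2.1
  · exact isBundleMap_line_iff.2 ⟨f t, fun q => ⟨γ t q, hγ t q, fun x => rfl⟩⟩
  · ext1 z
    refine C.toFun_ext ?_ (hf0 z.1)
    have hG0 : G 0 = 1 := hG.2
    rw [← hF 0 z, hG0]; rfl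
  · refine Equiv.ext fun z => ?_
    rw [Equiv.Perm.mul_apply, Equiv.Perm.mul_apply]
    refine C.toFun_ext (by rw [C.toFun_deck, ← hF, ← hF, C.toFun_deck]) ?_
    change f t (z.1 + 1) = f t z.1 + 1
    refine congrFun (lift_unique (hft _) ((hft z.1).add continuous_const) (fun t => ?_)
      (by simp [hf0])) t
    change circleCover (f t (z.1 + 1)) = circleCover (f t z.1 + 1)
    rw [circleCover_add_one]
    have h1 := congrArg π.proj (e t (z.1 + 1) x₀)
    have h2 := congrArg π.proj (e t z.1 (C.mono x₀))
    rw [C.proj_toFun] at h1 h2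
    rw [C.periodic, h2] at h1
    exact h1.symm

end TorusChart

/-! ### Isotopies of the product bundle over the line -/

section LineIsotopies

variable {EN HN : Type*} [NormedAddCommGroup EN] [NormedSpace ℝ EN] [TopologicalSpace HN]
  {IN : ModelWithCorners ℝ EN HN} {N : Type*} [TopologicalSpace N] [ChartedSpace HN N]
  {Γ : Subgroup (Equiv.Perm N)} {r : ℕ∞}

/-- A diffeomorphism of the base acts on the product bundle, together with its convex isotopy to
the identity. -/
theorem exists_baseIsot {a : Equiv.Perm ℝ} (ha : a ∈ goodPerm r) :
    ∃ F ∈ (lineBundle IN Γ).isot0 r, ∀ t (z : ℝ × N), F t z = (slide a ((t : ℝ), z.1), z.2) := by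
  obtain ⟨A, hA, h1, h2⟩ := exists_slidePerm ha
  have hp : ContMDiff ((𝓘(ℝ, ℝ).prod IN).prod (𝓡∂ 1)) 𝓘(ℝ, ℝ × ℝ) r
      (fun p : (ℝ × N) × unitInterval => ((p.2 : ℝ), p.1.1)) :=
    ContMDiff.prodMk_space (contMDiff_subtypeVal_Icc.comp contMDiff_snd)
      (contMDiff_fst.comp contMDiff_fst)
  refine ⟨fun t => (A t).prodCongr (Equiv.refl N), GammaBundle.mem_isot0_iff.2
    ⟨GammaBundle.mem_isot ?_ ?_ fun t => ?_, ?_⟩, fun t z => Prod.ext (hA t z.1) rfl⟩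
  · exact (h1.contMDiff.comp hp).prodMk (contMDiff_snd.comp contMDiff_fst)
  · exact (h2.contMDiff.comp hp).prodMk (contMDiff_snd.comp contMDiff_fst)
  · exact isBundleMap_line_iff.2 ⟨A t, fun q => ⟨1, Γ.one_mem, fun x => rfl⟩⟩
  · refine Equiv.ext fun z => Prod.ext ?_ rfl
    change A ((0 : unitInterval) : ℝ) z.1 = z.1
    rw [hA, Set.Icc.coe_zero, slide_zero]

/-- The vertical part of an isotopy of the product bundle. -/
theorem exists_verticalPart {F : unitInterval → Equiv.Perm (ℝ × N)}
    (hF : F ∈ (lineBundle IN Γ).isot0 r) :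
    ∃ W ∈ (lineBundle IN Γ).isot0 r, ∀ t z, W t z = (z.1, (F t z).2) := by
  obtain ⟨⟨h1, h2, h3⟩, h0⟩ := hF
  have h0 : F 0 = 1 := h0
  choose g hg using fun t => isBundleMap_line_iff.1 (h3 t).2
  choose γ hγ e using hg
  have e' : ∀ t q x, (F t)⁻¹ (g t q, x) = (q, (γ t q)⁻¹ x) := fun t q x => by
    rw [Equiv.Perm.inv_eq_iff_eq, e]; simp
  let W : unitInterval → Equiv.Perm (ℝ × N) := fun t =>
    { toFun := fun z => (z.1, (F t z).2)
      invFun := fun z => (z.1, ((F t)⁻¹ ((F t z).1, z.2)).2)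
      left_inv := fun z => by
        obtain ⟨q, x⟩ := z
        simp only [e, e']; simp
      right_inv := fun z => by
        obtain ⟨q, x⟩ := z
        simp only [e, e']; simp }
  refine ⟨W, GammaBundle.mem_isot0_iff.2 ⟨GammaBundle.mem_isot ?_ ?_ fun t => ?_, ?_⟩,
    fun t z => rfl⟩
  · exact (contMDiff_fst.comp contMDiff_fst).prodMk (contMDiff_snd.comp h1)
  · have h5 : ContMDiff ((𝓘(ℝ, ℝ).prod IN).prod (𝓡∂ 1)) (𝓘(ℝ, ℝ).prod IN) r
        (fun p : (ℝ × N) × unitInterval => ((F p.2 p.1).1, p.1.2)) :=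
      (contMDiff_fst.comp h1).prodMk (contMDiff_snd.comp contMDiff_fst)
    have h6 : ContMDiff ((𝓘(ℝ, ℝ).prod IN).prod (𝓡∂ 1)) (𝓘(ℝ, ℝ).prod IN) r
        (fun p : (ℝ × N) × unitInterval => (F p.2)⁻¹ ((F p.2 p.1).1, p.1.2)) :=
      h2.comp (h5.prodMk contMDiff_snd)
    exact (contMDiff_fst.comp contMDiff_fst).prodMk (contMDiff_snd.comp h6)
  · exact isBundleMap_line_iff.2 ⟨id, fun q => ⟨γ t q, hγ t q, fun x =>
      Prod.ext rfl (by change (F t (q, x)).2 = _; rw [e])⟩⟩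
  · refine Equiv.ext fun z => Prod.ext rfl ?_
    change (F 0 z).2 = z.2
    rw [h0]; rfl

/-- A vertical isotopy can be cut off by a function of the base, which rescales time. -/
theorem exists_cutoff {W : unitInterval → Equiv.Perm (ℝ × N)}
    (hW : W ∈ (lineBundle IN Γ).isot0 r) (hv : ∀ t z, (W t z).1 = z.1) {l : ℝ → ℝ}
    (hl : ContDiff ℝ ∞ l) (hl0 : ∀ q, 0 ≤ l q) (hl1 : ∀ q, l q ≤ 1) :
    ∃ V ∈ (lineBundle IN Γ).isot0 r, ∀ (t : unitInterval) z, ∀ s : unitInterval,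
      (s : ℝ) = (t : ℝ) * l z.1 → V t z = W s z := by
  obtain ⟨⟨h1, h2, h3⟩, h0⟩ := hW
  have h0 : W 0 = 1 := h0
  have hr : (r : WithTop ℕ∞) ≤ ∞ := by exact_mod_cast le_top
  let s : unitInterval → ℝ → unitInterval := fun t q =>
    ⟨(t : ℝ) * l q, mul_nonneg t.2.1 (hl0 q), mul_le_one₀ t.2.2 (hl0 q) (hl1 q)⟩
  have hs : ContMDiff ((𝓘(ℝ, ℝ).prod IN).prod (𝓡∂ 1)) (𝓡∂ 1) r
      (fun p : (ℝ × N) × unitInterval => s p.2 p.1.1) := by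
    refine contMDiff_iff_comp_subtypeVal_Icc.2 ⟨?_, ?_⟩
    · refine Continuous.subtype_mk ?_ _
      exact (continuous_subtype_val.comp continuous_snd).mul
        (hl.continuous.comp (continuous_fst.comp continuous_fst))
    · have hp : ContMDiff ((𝓘(ℝ, ℝ).prod IN).prod (𝓡∂ 1)) 𝓘(ℝ, ℝ × ℝ) r
          (fun p : (ℝ × N) × unitInterval => ((p.2 : ℝ), p.1.1)) :=
        ContMDiff.prodMk_space (contMDiff_subtypeVal_Icc.comp contMDiff_snd)
          (contMDiff_fst.comp contMDiff_fst)
      have hm : ContDiff ℝ r fun z : ℝ × ℝ => z.1 * l z.2 :=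
        contDiff_fst.mul ((hl.of_le hr).comp contDiff_snd)
      exact hm.contMDiff.comp hp
  have hv' : ∀ t z, ((W t)⁻¹ z).1 = z.1 := fun t z => by
    have := hv t ((W t)⁻¹ z)
    simpa using this.symm
  let V : unitInterval → Equiv.Perm (ℝ × N) := fun t =>
    { toFun := fun z => W (s t z.1) z
      invFun := fun z => (W (s t z.1))⁻¹ z
      left_inv := fun z => by simp only [hv]; simp
      right_inv := fun z => by simp only [hv']; simp }
  refine ⟨V, GammaBundle.mem_isot0_iff.2 ⟨GammaBundle.mem_isot ?_ ?_ fun t => ?_, ?_⟩,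
    fun t z s' hs' => ?_⟩
  · exact h1.comp (contMDiff_fst.prodMk hs)
  · exact h2.comp (contMDiff_fst.prodMk hs)
  · refine isBundleMap_line_iff.2 ⟨id, fun q => ?_⟩
    obtain ⟨g, hg⟩ := isBundleMap_line_iff.1 (h3 (s t q)).2
    obtain ⟨γ, hγ, e⟩ := hg q
    exact ⟨γ, hγ, fun x => Prod.ext (hv _ _) (by change (W (s t q) (q, x)).2 = _; rw [e])⟩
  · refine Equiv.ext fun z => ?_
    change W (s 0 z.1) z = z
    have : s 0 z.1 = 0 := Subtype.ext (by simp [s])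
    rw [this, h0]; rfl
  · change W (s t z.1) z = W s' z
    congr 1
    exact congrArg W (Subtype.ext hs'.symm)

theorem conj_mem_isot0 {F : unitInterval → Equiv.Perm (ℝ × N)}
    (hF : F ∈ (lineBundle IN Γ).isot0 r) {d : Equiv.Perm (ℝ × N)}
    (hd : d ∈ (lineBundle IN Γ).diff r) :
    (fun t => d⁻¹ * F t * d) ∈ (lineBundle IN Γ).isot0 r := by
  have hc := GammaBundle.const_mem_isot hd
  refine GammaBundle.mem_isot0_iff.2 ⟨Subgroup.mul_mem _ (Subgroup.mul_mem _
    (Subgroup.inv_mem _ hc) hF.1) hc, ?_⟩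
  have h0 : F 0 = 1 := hF.2
  simp [h0]

end LineIsotopies

/-- A periodic bump function, equal to `1` near `p` and to `0` at distance at least `δ` from
`p + ℤ`. -/
theorem exists_periodic_bump (p : ℝ) {δ : ℝ} (hδ : 0 < δ) (hδ' : δ ≤ 1 / 2) :
    ∃ l : ℝ → ℝ, ContDiff ℝ ∞ l ∧ (∀ q, 0 ≤ l q) ∧ (∀ q, l q ≤ 1) ∧ (∀ q, l (q + 1) = l q) ∧
      (∃ η > 0, ∀ q, |q - p| < η → l q = 1) ∧
      ∀ q, δ ≤ |q - p| → |q - p| ≤ 1 - δ → l q = 0 := by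
  set κ := Real.cos (2 * Real.pi * δ) with hκ
  have hπ := Real.pi_pos
  have hκ1 : κ < 1 := by
    rw [hκ, ← Real.cos_zero]
    exact Real.cos_lt_cos_of_nonneg_of_le_pi le_rfl (by nlinarith) (by positivity)
  have hd : 0 < (1 - κ) / 2 := by linarith
  refine ⟨fun q => Real.smoothTransition ((Real.cos (2 * Real.pi * (q - p)) - κ) / ((1 - κ) / 2)),
    Real.smoothTransition.contDiff.comp (((Real.contDiff_cos.comp (by fun_prop)).sub
      contDiff_const).div_const _), fun q => Real.smoothTransition.nonneg _,
    fun q => Real.smoothTransition.le_one _, fun q => ?_, ?_, fun q h1 h2 => ?_⟩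
  · dsimp only
    rw [show 2 * Real.pi * (q + 1 - p) = 2 * Real.pi * (q - p) + 2 * Real.pi by ring,
      Real.cos_add_two_pi]
  · have : ∀ᶠ q in 𝓝 p, (1 + κ) / 2 < Real.cos (2 * Real.pi * (q - p)) := by
      have hc : Continuous fun q => Real.cos (2 * Real.pi * (q - p)) := by fun_prop
      refine (isOpen_lt continuous_const hc).mem_nhds ?_
      simp only [mem_ofPred_eq, sub_self, mul_zero, Real.cos_zero]
      linarith
    obtain ⟨η, hη, hb⟩ := Metric.eventually_nhds_iff.1 this
    refine ⟨η, hη, fun q hq => Real.smoothTransition.one_of_one_le ?_⟩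
    have := hb (y := q) (by rwa [Real.dist_eq])
    rw [one_le_div hd]; linarith
  · refine Real.smoothTransition.zero_of_nonpos (div_nonpos_of_nonpos_of_nonneg ?_ hd.le)
    rw [sub_nonpos, hκ, ← Real.cos_abs, abs_mul, abs_of_pos (show 0 < 2 * Real.pi by positivity)]
    set u := |q - p|
    rcases le_total u (1 / 2) with h | h
    · exact Real.cos_le_cos_of_nonneg_of_le_pi (by positivity) (by nlinarith) (by nlinarith)
    · rw [← Real.cos_two_pi_sub (2 * Real.pi * u)]
      exact Real.cos_le_cos_of_nonneg_of_le_pi (by positivity) (by nlinarith) (by nlinarith)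

/-! ### Equivariant isotopies and fragmentation -/

namespace TorusChart

variable {EM HM EN HN : Type*}
  [NormedAddCommGroup EM] [NormedSpace ℝ EM] [TopologicalSpace HM]
  [NormedAddCommGroup EN] [NormedSpace ℝ EN] [TopologicalSpace HN]
  {IM : ModelWithCorners ℝ EM HM} {IN : ModelWithCorners ℝ EN HN}
  {N : Type*} [TopologicalSpace N] [ChartedSpace HN N] {Γ : Subgroup (Equiv.Perm N)}
  {M : Type*} [TopologicalSpace M] [ChartedSpace HM M]
  {π : GammaBundle IM (𝓡 1) IN Γ M Circle} {r : ℕ∞} (C : TorusChart π)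

theorem commute_deck_iff {f : Equiv.Perm (ℝ × N)} :
    Commute f C.deck ↔ ∀ z, f (z.1 + 1, C.mono⁻¹ z.2) = ((f z).1 + 1, C.mono⁻¹ (f z).2) :=
  ⟨fun h z => DFunLike.congr_fun h.eq z, fun h => Equiv.ext h⟩

/-- The increasing diffeomorphism of the line that underlies the end of an equivariant isotopy. -/
theorem exists_base [Nonempty N] {F : unitInterval → Equiv.Perm (ℝ × N)}
    (hF : F ∈ C.equivIsot r) (t : unitInterval) :
    ∃ g ∈ goodPerm r, (∀ q, g (q + 1) = g q + 1) ∧ ∀ z, (F t z).1 = g z.1 := by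
  obtain ⟨⟨⟨-, -, h3⟩, -⟩, hc⟩ := C.mem_equivIsot.1 hF
  obtain ⟨g, hg⟩ := isBundleMap_line_iff.1 (h3 t).2
  obtain ⟨g', hg'⟩ := isBundleMap_line_iff.1 (h3 t).2.inv
  have e : ∀ z, (F t z).1 = g z.1 := fun z => by
    obtain ⟨γ, -, h⟩ := hg z.1
    exact congrArg Prod.fst (h z.2)
  have e' : ∀ z, ((F t)⁻¹ z).1 = g' z.1 := fun z => by
    obtain ⟨γ, -, h⟩ := hg' z.1
    exact congrArg Prod.fst (h z.2)
  obtain ⟨x₀⟩ := ‹Nonempty N›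
  have cd : ∀ f : ℝ × N → ℝ × N, ContMDiff (𝓘(ℝ, ℝ).prod IN) (𝓘(ℝ, ℝ).prod IN) r f →
      ContDiff ℝ r fun q => (f (q, x₀)).1 := fun f hf =>
    (contMDiff_fst.comp (hf.comp (contMDiff_id.prodMk contMDiff_const))).contDiff
  have hgc : ContDiff ℝ r g := by simpa only [e] using cd _ (h3 t).1.1
  have hgc' : ContDiff ℝ r g' := by simpa only [e'] using cd _ (h3 t).1.2
  have l1 : ∀ q, g' (g q) = q := fun q => by
    rw [← e (q, x₀), ← e' (F t (q, x₀))]; simp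
  have l2 : ∀ q, g (g' q) = q := fun q => by
    rw [← e' (q, x₀), ← e]; simp
  have hper : ∀ q, g (q + 1) = g q + 1 := fun q => by
    have := congrArg Prod.fst (C.commute_deck_iff.1 (hc t) (q, x₀))
    rw [e, e] at this
    exact this
  have hmono : StrictMono g := by
    refine (hgc.continuous.strictMono_of_inj (LeftInverse.injective l1)).resolve_right fun h => ?_
    have h1 := h (lt_add_one 0)
    have h2 := hper 0
    linarith
  exact ⟨⟨g, g', l1, l2⟩, ⟨hgc, hgc', hmono, _,
    bounded_displacement_of_periodic hmono.monotone hper⟩, hper, e⟩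

theorem exists_equivBaseIsot {a : Equiv.Perm ℝ} (ha : a ∈ goodPerm r)
    (hper : ∀ q, a (q + 1) = a q + 1) :
    ∃ F ∈ C.equivIsot r, ∀ t z, F t z = (slide a ((t : ℝ), z.1), z.2) := by
  obtain ⟨F, hF, e⟩ := exists_baseIsot (IN := IN) (Γ := Γ) (N := N) ha
  refine ⟨F, C.mem_equivIsot.2 ⟨hF, fun t => C.commute_deck_iff.2 fun z => ?_⟩, e⟩
  rw [e, e]
  refine Prod.ext ?_ rfl
  simp only [slide, hper]; ring

/-- An isotopy that is lifted by one fixing the part over an interval has support over a proper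
closed arc. -/
theorem exists_mem_isotRel0 {u v : ℝ} (huv : u < v) (hvu : v ≤ u + 1) :
    ∃ D, IsClosedArc D ∧ ∀ (F : unitInterval → Equiv.Perm (ℝ × N)),
      ∀ G ∈ π.isot0 r, (∀ t, C.Lifts (F t) (G t)) → (∀ t z, z.1 ∈ Ioo u v → F t z = z) →
        G ∈ π.isotRel0 r (interior D)ᶜ := by
  set a := u + 2 * (v - u) / 3 with ha
  set b := u + (v - u) / 3 + 1 with hb
  refine ⟨circleCover '' Icc a b, ⟨a, b, by linarith, by linarith, rfl⟩, fun F G hG h hfix => ⟨hG,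
    circleCover '' Ioo u v, isOpenMap_circleCover _ isOpen_Ioo, fun y hy => ?_, fun t x hx => ?_⟩⟩
  · obtain ⟨s, hs, rfl⟩ := exists_circleCover_Ico (b - 1) y
    refine ⟨s, ⟨by linarith [hs.1], ?_⟩, rfl⟩
    by_contra hsv
    push Not at hsv
    refine hy (interior_maximal (image_mono Ioo_subset_Icc_self)
      (isOpenMap_circleCover _ isOpen_Ioo) ⟨s, ⟨by linarith, by linarith [hs.2]⟩, rfl⟩)
  · obtain ⟨q, hq, e⟩ := hx
    obtain ⟨y, rfl⟩ := C.exists_fiber e.symm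
    rw [h, hfix t _ hq]

/-- If the lift of an isotopy moves a point of the base by less than a full turn, its end is the
product of the ends of two isotopies, each with support over a proper closed arc. The first factor
agrees near `p` with the end `f` of the given isotopy: its base part is an interpolation between
that of `f` and the identity, and its vertical part is that of the isotopy, cut off in time away
from `p`. The vertical isotopies of the two factors cancel over a neighborhood of `p` at all times,
which makes the second factor isotopic to the identity relative to that neighborhood. -/
theorem exists_fragmentation [Nonempty N] {F : unitInterval → Equiv.Perm (ℝ × N)}
    (hF : F ∈ C.equivIsot r) {p : ℝ} {x₀ : N} (hp : |(F 1 (p, x₀)).1 - p| < 1)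
    {f : Equiv.Perm M} (hf : C.Lifts (F 1) f) :
    ∃ D D' : Set Circle, IsClosedArc D ∧ IsClosedArc D' ∧ ∃ A ∈ π.diffRel0 r (interior D)ᶜ,
      ∃ B ∈ π.diffRel0 r (interior D')ᶜ, f = A * B := by
  obtain ⟨g, hg, gper, eg⟩ := C.exists_base hF 1
  obtain ⟨hF0, hFc⟩ := C.mem_equivIsot.1 hF
  rw [eg] at hp
  dsimp only at hp
  rw [abs_lt] at hp
  -- an interval of length one containing `p` and its image
  set c := (p + g p - 1) / 2 with hc
  obtain ⟨a₀, ha₀, ε, hε, α, β, h1, h2, h3, h4, h5, h6⟩ :=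
    (isIncr_of_mem_goodPerm hg).exists_extension (α := c) (β := c + 1) (p₁ := p) (p₂ := p)
      (by linarith) le_rfl (by linarith) (by linarith) (by linarith)
  obtain ⟨a, ha, aper, ea⟩ := (isIncr_of_mem_goodPerm ha₀).exists_periodic h1 h2 h6
  set δ := min (p - c) (c + 1 - p) / 2 with hδ
  have hδ1 : 0 < min (p - c) (c + 1 - p) := lt_min (by linarith) (by linarith)
  have hδ2 := min_le_left (p - c) (c + 1 - p)
  have hδ3 := min_le_right (p - c) (c + 1 - p)
  have hδ0 : 0 < δ := by linarith
  obtain ⟨l, hl, hl0, hl1, lper, ⟨η, hη, lone⟩, lzero⟩ := exists_periodic_bump p hδ0 (by linarith)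
  obtain ⟨W, hW, eW⟩ := exists_verticalPart hF0
  obtain ⟨V, hV, eV⟩ := exists_cutoff hW (fun t z => by rw [eW]) hl hl0 hl1
  have eV' : ∀ (t : unitInterval) z, ∃ s : unitInterval, V t z = W s z ∧
      (s : ℝ) = (t : ℝ) * l z.1 := fun t z =>
    ⟨⟨(t : ℝ) * l z.1, mul_nonneg t.2.1 (hl0 _), mul_le_one₀ t.2.2 (hl0 _) (hl1 _)⟩,
      eV t z _ rfl, rfl⟩
  have Vfst : ∀ t z, (V t z).1 = z.1 := fun t z => by
    obtain ⟨s, hs, -⟩ := eV' t z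
    rw [hs, eW]
  have hWc : ∀ t, Commute (W t) C.deck := fun t => C.commute_deck_iff.2 fun z => by
    have := C.commute_deck_iff.1 (hFc t) z
    rw [eW, eW, this]
  have hVc : ∀ t, Commute (V t) C.deck := fun t => C.commute_deck_iff.2 fun z => by
    obtain ⟨s, hs, hs'⟩ := eV' t z
    rw [eV t _ s (by rw [hs', lper]), hs]
    exact C.commute_deck_iff.1 (hWc s) z
  have hWe : W ∈ C.equivIsot r := C.mem_equivIsot.2 ⟨hW, hWc⟩
  have hVe : V ∈ C.equivIsot r := C.mem_equivIsot.2 ⟨hV, hVc⟩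
  obtain ⟨S, hS, eS⟩ := C.exists_equivBaseIsot ha aper
  -- the second factor is the end of `R t * ((R 1)⁻¹ * (V t)⁻¹ * R 1) * W t`, where `R` is the convex
  -- isotopy to `a⁻¹ g`: at time `1` this is `V⁻¹ * R * W`, which completes `S * V` to `F`
  have hb : a⁻¹ * g ∈ goodPerm r := Subgroup.mul_mem _ (Subgroup.inv_mem _ ha) hg
  have bper : ∀ q, (a⁻¹ * g) (q + 1) = (a⁻¹ * g) q + 1 := fun q => by
    rw [Equiv.Perm.mul_apply, Equiv.Perm.inv_eq_iff_eq, aper, gper]; simp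
  obtain ⟨R, hR, eR⟩ := C.exists_equivBaseIsot hb bper
  obtain ⟨hR0, hRc⟩ := C.mem_equivIsot.1 hR
  have hK : (fun t => (R 1)⁻¹ * V⁻¹ t * R 1) ∈ C.equivIsot r := C.mem_equivIsot.2
    ⟨conj_mem_isot0 (Subgroup.inv_mem _ hV) (hR0.1.2.2 1), fun t =>
      ((hRc 1).inv_left.mul_left (hVc t).inv_left).mul_left (hRc 1)⟩
  have hA := Subgroup.mul_mem _ hS hVe
  have hB := Subgroup.mul_mem _ (Subgroup.mul_mem _ hR hK) hWe
  obtain ⟨A, hA0, lA⟩ := C.exists_descent hA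
  obtain ⟨B, hB0, lB⟩ := C.exists_descent hB
  -- the arc of points moved by `a`, together with the support of `l`, is not the whole circle
  have afix : ∀ q ∈ Ioo (max β (p + δ) - 1) (min α (p - δ)), a q = q := by
    intro q hq
    have k1 := (le_max_left β (p + δ)).trans_lt (show max β (p + δ) < q + 1 by linarith [hq.1])
    have k2 := hq.2.trans_le (min_le_left _ _)
    rw [ea q ⟨by linarith, by linarith⟩, h6 q (Or.inl k2.le)]
  have lfix : ∀ q ∈ Ioo (max β (p + δ) - 1) (min α (p - δ)), l q = 0 := by
    intro q hq
    have k1 := (le_max_right β (p + δ)).trans_lt (show max β (p + δ) < q + 1 by linarith [hq.1])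
    have k2 := hq.2.trans_le (min_le_right _ _)
    refine lzero q ?_ ?_ <;> rw [abs_of_neg (by linarith)] <;> linarith
  have hW0 : W 0 = 1 := hW.2
  obtain ⟨D, hD, hAD⟩ := C.exists_mem_isotRel0 (r := r) (u := max β (p + δ) - 1)
    (v := min α (p - δ))
    (by rw [sub_lt_iff_lt_add, max_lt_iff]; constructor <;>
          rw [← sub_lt_iff_lt_add, lt_min_iff] <;> constructor <;> linarith)
    (by
      have := min_le_left α (p - δ)
      have := le_max_left β (p + δ)
      linarith)
  have hAD := hAD _ A hA0 lA
    (fun t z hz => by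
      obtain ⟨s, hs, hs'⟩ := eV' t z
      have hs0 : s = 0 := Subtype.ext (by rw [hs', lfix _ hz]; simp)
      rw [hs0, hW0] at hs
      rw [Pi.mul_apply, Equiv.Perm.mul_apply, hs, Equiv.Perm.one_apply, eS,
        slide_of_fixed (afix _ hz)])
  set θ := min (min ε η) δ with hθ
  have hθ0 : 0 < θ := lt_min (lt_min hε hη) hδ0
  have bfix : ∀ q, |q - p| < θ → (a⁻¹ * g) q = q := by
    intro q hq
    have k1 := hq.trans_le ((min_le_left _ _).trans (min_le_left _ _))
    have k2 := hq.trans_le (min_le_right _ _)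
    rw [abs_lt] at k1 k2
    rw [Equiv.Perm.mul_apply, Equiv.Perm.inv_eq_iff_eq,
      ea q ⟨by linarith, by linarith⟩, h5 q ⟨by linarith, by linarith⟩]
  obtain ⟨D', hD', hBD⟩ := C.exists_mem_isotRel0 (r := r) (u := p - θ) (v := p + θ) (by linarith)
    (by
      have : θ ≤ δ := min_le_right _ _
      linarith)
  have hBD := hBD _ B hB0 lB
    (fun t z hz => by
      have hz' : |z.1 - p| < θ := abs_lt.2 ⟨by linarith [hz.1], by linarith [hz.2]⟩
      have hRz : ∀ t, ∀ w : ℝ × N, w.1 = z.1 → R t w = w := fun t w hw => by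
        rw [eR, hw, slide_of_fixed (bfix _ hz'), ← hw]
      have hVW : V t z = W t z := eV t z t (by
        rw [lone _ (hz'.trans_le ((min_le_left _ _).trans (min_le_right _ _))), mul_one])
      have hVz : (V t)⁻¹ (W t z) = z := by rw [← hVW]; simp
      have hRi : (R 1)⁻¹ z = z := by rw [Equiv.Perm.inv_eq_iff_eq, hRz 1 z rfl]
      change R t ((R 1)⁻¹ ((V t)⁻¹ (R 1 (W t z)))) = z
      rw [hRz 1 (W t z) (by rw [eW]), hVz, hRi, hRz t z rfl])
  refine ⟨D, D', hD, hD', A 1, ⟨A, hAD, rfl⟩, B 1, ⟨B, hBD, rfl⟩, hf.eq ?_⟩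
  have hAB := (lA 1).mul (lB 1)
  convert hAB using 1
  refine Equiv.ext fun z => ?_
  change F 1 z = S 1 (V 1 (R 1 ((R 1)⁻¹ ((V 1)⁻¹ (R 1 (W 1 z))))))
  have hVV : V 1 (R 1 ((R 1)⁻¹ ((V 1)⁻¹ (R 1 (W 1 z))))) = R 1 (W 1 z) := by simp
  rw [hVV, eS, eR, eW, Set.Icc.coe_one, slide_one, slide_one]
  refine Prod.ext ?_ rfl
  rw [eg]
  simp

end TorusChart

/-! ### Commutators in the product bundle over the line -/

section Perfect

/-- The permutations of `ℝ × N` with support over `S`. -/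
def supportedOver (N : Type*) (S : Set ℝ) : Subgroup (Equiv.Perm (ℝ × N)) where
  carrier := {f | ∀ z, z.1 ∉ S → f z = z}
  one_mem' := fun _ _ => rfl
  mul_mem' := fun hf hg z hz => by rw [Equiv.Perm.mul_apply, hg z hz, hf z hz]
  inv_mem' := fun hf z hz => by rw [Equiv.Perm.inv_eq_iff_eq, hf z hz]

theorem supportedOver_mono {N : Type*} {S T : Set ℝ} (h : S ⊆ T) :
    supportedOver N S ≤ supportedOver N T :=
  fun _ hf z hz => hf z fun hS => hz (h hS)

variable {EN HN : Type*} [NormedAddCommGroup EN] [NormedSpace ℝ EN] [TopologicalSpace HN]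
  {IN : ModelWithCorners ℝ EN HN} {N : Type*} [TopologicalSpace N] [ChartedSpace HN N]
  {Γ : Subgroup (Equiv.Perm N)} {r : ℕ∞}

theorem mem_isotC0_of_forall {F : unitInterval → Equiv.Perm (ℝ × N)}
    (hF : F ∈ (lineBundle IN Γ).isot0 r) {a b : ℝ} (h : ∀ t, F t ∈ supportedOver N (Icc a b)) :
    F ∈ (lineBundle IN Γ).isotC0 r := by
  have hc : IsClosed ((Prod.fst : ℝ × N → ℝ) ⁻¹' Icc a b) := isClosed_Icc.preimage continuous_fst
  refine ⟨hF, Icc a b, isCompact_Icc, closure_minimal (iUnion_subset fun t =>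
    closure_minimal (fun z hz => ?_) hc) hc⟩
  by_contra hz'
  exact hz (h t z hz')

theorem exists_supportedOver {F : unitInterval → Equiv.Perm (ℝ × N)}
    (hF : F ∈ (lineBundle IN Γ).isotC0 r) :
    ∃ R > 0, ∀ t, F t ∈ supportedOver N (Icc (-R) R) := by
  obtain ⟨-, K, hK, h⟩ := hF
  obtain ⟨R, hR⟩ := hK.isBounded.subset_closedBall 0
  refine ⟨max R 1, by positivity, fun t z hz => ?_⟩
  by_contra hne
  have h1 : z.1 ∈ K := h (subset_closure (mem_iUnion.2 ⟨t, subset_closure hne⟩))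
  have h2 := hR h1
  rw [Real.closedBall_eq_Icc] at h2
  have := le_max_left R 1
  exact hz ⟨by linarith [h2.1], by linarith [h2.2]⟩

/-- If the group of ends of compactly supported isotopies is perfect, each of its elements is a
product of two commutators: a displacement of a large interval to the right provides the situation
of `exists_two_commutators`. -/
theorem exists_two_commutators_of_isPerfect
    (h : Group.IsPerfect ((lineBundle IN Γ).diffC0 r)) (x : (lineBundle IN Γ).diffC0 r) :
    ∃ a b c d : (lineBundle IN Γ).diffC0 r,
      x = (a * b * a⁻¹ * b⁻¹) * (c * d * c⁻¹ * d⁻¹) := by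
  let H := (lineBundle IN Γ).diffC0 r
  let K : Set ℝ → Subgroup H := fun S => (supportedOver N S).comap H.subtype
  have hsupp : ∀ f : H, ∃ R > 0, f ∈ K (Icc (-R) R) := by
    rintro ⟨_, F, hF, rfl⟩
    obtain ⟨R, hR, hF⟩ := exists_supportedOver hF
    exact ⟨R, hR, hF 1⟩
  have Kmono : ∀ {R R' : ℝ}, R ≤ R' → K (Icc (-R) R) ≤ K (Icc (-R') R') := fun hRR =>
    Subgroup.comap_mono (supportedOver_mono (Icc_subset_Icc (by linarith) hRR))
  have key : ∃ R > 0, x ∈ ⁅K (Icc (-R) R), K (Icc (-R) R)⁆ := by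
    have hx : x ∈ Subgroup.closure (commutatorSet H) := by
      rw [← commutator_eq_closure, h.commutator_eq_top]; trivial
    induction hx using Subgroup.closure_induction with
    | mem y hy =>
      obtain ⟨a, b, rfl⟩ := hy
      obtain ⟨R, hR, ha⟩ := hsupp a
      obtain ⟨R', hR', hb⟩ := hsupp b
      exact ⟨max R R', lt_max_of_lt_left hR, Subgroup.commutator_mem_commutator
        (Kmono (le_max_left _ _) ha) (Kmono (le_max_right _ _) hb)⟩
    | one => exact ⟨1, one_pos, one_mem _⟩
    | mul y z _ _ hy hz =>
      obtain ⟨R, hR, ha⟩ := hy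
      obtain ⟨R', hR', hb⟩ := hz
      exact ⟨max R R', lt_max_of_lt_left hR, mul_mem
        (Subgroup.commutator_mono (Kmono (le_max_left _ _)) (Kmono (le_max_left _ _)) ha)
        (Subgroup.commutator_mono (Kmono (le_max_right _ _)) (Kmono (le_max_right _ _)) hb)⟩
    | inv y _ hy =>
      obtain ⟨R, hR, ha⟩ := hy
      exact ⟨R, hR, inv_mem ha⟩
  obtain ⟨R, hR, hx⟩ := key
  -- `a` moves `[-R, ∞)` into `(R, ∞)`
  obtain ⟨a, ha, ε, hε, α, β, -, -, -, -, ha1, ha2⟩ :=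
    (isIncr_affine (r := r) one_pos (R + 1) (-R)).exists_extension
      (α := -R - 1) (β := R + 2) (p₁ := -R) (p₂ := -R) (by linarith) le_rfl (by linarith)
      (by linarith) (by linarith)
  have haR : a (-R) = R + 1 := by
    rw [ha1 _ ⟨by linarith, by linarith⟩]; ring
  obtain ⟨F, hF, eF⟩ := exists_baseIsot (IN := IN) (Γ := Γ) (N := N) ha
  have hFc : F ∈ (lineBundle IN Γ).isotC0 r := by
    refine mem_isotC0_of_forall hF (a := α) (b := β) fun t z hz => ?_
    have : z.1 ≤ α ∨ β ≤ z.1 := by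
      by_contra! hc
      exact hz ⟨hc.1.le, hc.2.le⟩
    rw [eF, slide_of_fixed (ha2 _ this)]
  have hmove : ∀ z : ℝ × N, z.1 ≤ R → ((F 1)⁻¹ z).1 < -R := by
    intro z hz
    have h1 : F 1 ((F 1)⁻¹ z) = z := by simp
    rw [eF] at h1
    have h2 := congrArg Prod.fst h1
    rw [Set.Icc.coe_one, slide_one] at h2
    by_contra! hc
    have := ha.2.2.1.monotone hc
    dsimp only at h2
    linarith
  have hpush : ∀ S : Set ℝ, S ⊆ Ici (-R) → ∀ f ∈ K S,
      (⟨F 1, F, hFc, rfl⟩ : H) * f * (⟨F 1, F, hFc, rfl⟩ : H)⁻¹ ∈ K (Ioi R) := by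
    intro S hS f hf z hz
    have hz' : ((F 1)⁻¹ z).1 ∉ S := fun hc => by
      have h1 := hmove z (not_lt.1 hz)
      have h2 : -R ≤ _ := hS hc
      linarith
    change F 1 ((f : Equiv.Perm (ℝ × N)) ((F 1)⁻¹ z)) = z
    have : (f : Equiv.Perm (ℝ × N)) ((F 1)⁻¹ z) = (F 1)⁻¹ z := hf _ hz'
    rw [this]; simp
  refine exists_two_commutators (h := ⟨F 1, F, hFc, rfl⟩) (L := K (Ioi R)) ?_
    (hpush (Icc (-R) R) fun q hq => hq.1) (hpush (Ioi R) fun q hq => by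
      have : R < q := hq
      simp only [mem_Ici]; linarith) hx
  intro f hf g hg
  refine Subtype.ext (Equiv.Perm.Disjoint.commute (f := (f : Equiv.Perm (ℝ × N)))
    (g := (g : Equiv.Perm (ℝ × N))) fun z => ?_).eq
  by_cases hz : z.1 ∈ Icc (-R) R
  · exact Or.inr (hg z fun hc => absurd (show R < z.1 from hc) (not_lt.2 hz.2))
  · exact Or.inl (hf z hz)

end Perfect

/-! ### Embedding the product bundle over the line as the part over an arc -/

section ArcParam

/-- A diffeomorphism from the line to `(c, c + 1)`. -/
noncomputable def arcParam (c s : ℝ) : ℝ := c + 1 / 2 + Real.arctan s / Real.pi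

/-- The inverse of `arcParam c`. -/
noncomputable def arcInv (c q : ℝ) : ℝ := Real.tan (Real.pi * (q - (c + 1 / 2)))

theorem arcParam_mem (c s : ℝ) : arcParam c s ∈ Ioo c (c + 1) := by
  have h1 : -(1 / 2) < Real.arctan s / Real.pi := by
    rw [lt_div_iff₀ Real.pi_pos]; linarith [Real.neg_pi_div_two_lt_arctan s]
  have h2 : Real.arctan s / Real.pi < 1 / 2 := by
    rw [div_lt_iff₀ Real.pi_pos]; linarith [Real.arctan_lt_pi_div_two s]
  constructor <;> simp only [arcParam] <;> linarith

theorem strictMono_arcParam (c : ℝ) : StrictMono (arcParam c) := fun s t h => by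
  have := div_lt_div_of_pos_right (Real.arctan_strictMono h) Real.pi_pos
  simp only [arcParam]; linarith

theorem contDiff_arcParam (c : ℝ) : ContDiff ℝ ∞ (arcParam c) :=
  contDiff_const.add (Real.contDiff_arctan.div_const _)

theorem arcInv_arcParam (c s : ℝ) : arcInv c (arcParam c s) = s := by
  rw [arcInv, arcParam, add_sub_cancel_left, mul_div_cancel₀ _ Real.pi_pos.ne', Real.tan_arctan]

theorem arcParam_arcInv {c q : ℝ} (hq : q ∈ Ioo c (c + 1)) : arcParam c (arcInv c q) = q := by
  rw [arcInv, arcParam, Real.arctan_tan, mul_div_cancel_left₀ _ Real.pi_pos.ne']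
  · ring
  · nlinarith [Real.pi_pos, hq.1]
  · nlinarith [Real.pi_pos, hq.2]

theorem contDiffOn_arcInv (c : ℝ) : ContDiffOn ℝ ∞ (arcInv c) (Ioo c (c + 1)) := fun q hq => by
  refine ContDiffAt.contDiffWithinAt ?_
  have h : Real.cos (Real.pi * (q - (c + 1 / 2))) ≠ 0 := by
    refine (Real.cos_pos_of_mem_Ioo ⟨?_, ?_⟩).ne'
    · nlinarith [Real.pi_pos, hq.1]
    · nlinarith [Real.pi_pos, hq.2]
  exact (Real.contDiffAt_tan.2 h).comp q (by fun_prop)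

/-- A closed arc, which exhausts the arc from `c` to `c + 1` as `R` tends to infinity. -/
def arcDisk (c R : ℝ) : Set Circle := circleCover '' Icc (arcParam c (-R)) (arcParam c R)

theorem isClosedArc_arcDisk (c : ℝ) {R : ℝ} (hR : 0 < R) : IsClosedArc (arcDisk c R) :=
  ⟨_, _, strictMono_arcParam c (by linarith), by
    linarith [(arcParam_mem c (-R)).1, (arcParam_mem c R).2], rfl⟩

theorem isClosed_arcDisk (c R : ℝ) : IsClosed (arcDisk c R) :=
  (isCompact_Icc.image continuous_circleCover).isClosed

theorem arcDisk_subset_interior (c : ℝ) {R R' : ℝ} (h : R < R') :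
    arcDisk c R ⊆ interior (arcDisk c R') := by
  refine Subset.trans ?_ (interior_maximal (image_mono Ioo_subset_Icc_self)
    (isOpenMap_circleCover _ isOpen_Ioo))
  exact image_mono fun q hq => ⟨(strictMono_arcParam c (by linarith)).trans_le hq.1,
    hq.2.trans_lt (strictMono_arcParam c h)⟩

end ArcParam

namespace TorusChart

variable {EM HM EN HN : Type*}
  [NormedAddCommGroup EM] [NormedSpace ℝ EM] [TopologicalSpace HM]
  [NormedAddCommGroup EN] [NormedSpace ℝ EN] [TopologicalSpace HN]
  {IM : ModelWithCorners ℝ EM HM} {IN : ModelWithCorners ℝ EN HN}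
  {N : Type*} [TopologicalSpace N] [ChartedSpace HN N] {Γ : Subgroup (Equiv.Perm N)}
  {M : Type*} [TopologicalSpace M] [ChartedSpace HM M]
  {π : GammaBundle IM (𝓡 1) IN Γ M Circle} {r : ℕ∞} (C : TorusChart π)

/-- The embedding of `ℝ × N` onto the part of the total space over the arc from `c` to `c + 1`. -/
noncomputable def arcEmb (c : ℝ) : ℝ × N ↪ M where
  toFun z := C.toFun (arcParam c z.1, z.2)
  inj' z w h := by
    have h1 := C.injOn_arc (arcParam_mem c z.1) (arcParam_mem c w.1) h
    have h2 := congrArg Prod.fst h1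
    have h3 : z.2 = w.2 := (Prod.ext_iff.1 h1).2
    exact Prod.ext ((strictMono_arcParam c).injective h2) h3

theorem arcEmb_apply (c : ℝ) (z : ℝ × N) :
    C.arcEmb c z = C.toFun (arcParam c z.1, z.2) := rfl

theorem proj_arcEmb (c : ℝ) (z : ℝ × N) :
    π.proj (C.arcEmb c z) = circleCover (arcParam c z.1) := C.proj_toFun _

theorem arcEmb_mem (c : ℝ) (z : ℝ × N) : C.arcEmb c z ∈ arc π c :=
  C.mem_arc_iff.2 ⟨_, arcParam_mem c z.1, rfl⟩

theorem contMDiff_arcEmb (c : ℝ) : ContMDiff (𝓘(ℝ, ℝ).prod IN) IM ∞ (C.arcEmb c) :=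
  C.contMDiff_toFun.comp (((contDiff_arcParam c).contMDiff.comp contMDiff_fst).prodMk
    contMDiff_snd)

/-- The inverse of `arcEmb`. -/
noncomputable def arcChart [Nonempty N] (c : ℝ) (y : M) : ℝ × N :=
  (arcInv c (C.log c y).1, (C.log c y).2)

theorem arcChart_arcEmb [Nonempty N] (c : ℝ) (z : ℝ × N) : C.arcChart c (C.arcEmb c z) = z := by
  rw [arcChart, arcEmb_apply, C.log_toFun (arcParam_mem c z.1), arcInv_arcParam]

theorem arcEmb_arcChart [Nonempty N] {c : ℝ} {y : M} (hy : y ∈ arc π c) :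
    C.arcEmb c (C.arcChart c y) = y := by
  rw [arcChart, arcEmb_apply]
  dsimp only
  rw [arcParam_arcInv (C.log_mem hy).1, Prod.mk.eta, (C.log_mem hy).2]

theorem range_arcEmb [Nonempty N] (c : ℝ) : range (C.arcEmb c) = arc π c := by
  refine Subset.antisymm ?_ fun y hy => ⟨C.arcChart c y, C.arcEmb_arcChart hy⟩
  rintro _ ⟨z, rfl⟩
  exact C.arcEmb_mem c z

theorem contMDiffOn_arcChart [Nonempty N] (c : ℝ) :
    ContMDiffOn IM (𝓘(ℝ, ℝ).prod IN) ∞ (C.arcChart c) (arc π c) :=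
  ((contDiffOn_arcInv c).contMDiffOn.comp
    (contMDiff_fst.comp_contMDiffOn (C.contMDiffOn_log c)) fun _ hy => (C.log_mem hy).1).prodMk
    (contMDiff_snd.comp_contMDiffOn (C.contMDiffOn_log c))

/-- Extension by the identity of permutations of the part over an arc. -/
noncomputable def ext (c : ℝ) : Equiv.Perm (ℝ × N) →* Equiv.Perm M :=
  Equiv.Perm.viaEmbeddingHom (C.arcEmb c)

theorem ext_arcEmb (c : ℝ) (f : Equiv.Perm (ℝ × N)) (z : ℝ × N) :
    C.ext c f (C.arcEmb c z) = C.arcEmb c (f z) :=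
  Equiv.Perm.viaEmbedding_apply f (C.arcEmb c) z

theorem ext_of_notMem [Nonempty N] (c : ℝ) (f : Equiv.Perm (ℝ × N)) {y : M} (hy : y ∉ arc π c) :
    C.ext c f y = y :=
  Equiv.Perm.viaEmbedding_apply_of_notMem f (C.arcEmb c) y (by rwa [C.range_arcEmb])

theorem ext_of_notMem_arcDisk [Nonempty N] (c : ℝ) {R : ℝ} {f : Equiv.Perm (ℝ × N)}
    (hf : f ∈ supportedOver N (Icc (-R) R)) {y : M} (hy : π.proj y ∉ arcDisk c R) :
    C.ext c f y = y := by
  by_cases h : y ∈ arc π c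
  · rw [← C.range_arcEmb] at h
    obtain ⟨z, rfl⟩ := h
    rw [C.ext_arcEmb, hf z fun hz => hy ?_]
    rw [C.proj_arcEmb]
    exact ⟨_, ⟨(strictMono_arcParam c).monotone hz.1, (strictMono_arcParam c).monotone hz.2⟩, rfl⟩
  · exact C.ext_of_notMem c f h

theorem contMDiff_ext [Nonempty N] (c : ℝ) {R : ℝ} {F : unitInterval → Equiv.Perm (ℝ × N)}
    (hF : ∀ t, F t ∈ supportedOver N (Icc (-R) R))
    (h : ContMDiff ((𝓘(ℝ, ℝ).prod IN).prod (𝓡∂ 1)) (𝓘(ℝ, ℝ).prod IN) r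
      (fun p : (ℝ × N) × unitInterval => F p.2 p.1)) :
    ContMDiff (IM.prod (𝓡∂ 1)) IM r
      (fun p : M × unitInterval => C.ext c (F p.2) p.1) := by
  have hr : (r : WithTop ℕ∞) ≤ ∞ := by exact_mod_cast le_top
  refine contMDiffOn_univ.1 (contMDiffOn_of_locally_contMDiffOn fun p _ => ?_)
  by_cases hp : p.1 ∈ arc π c
  · refine ⟨arc π c ×ˢ univ, (isOpen_arc c).prod isOpen_univ, ⟨hp, trivial⟩, ?_⟩
    rw [univ_inter]
    have h1 : ContMDiffOn (IM.prod (𝓡∂ 1)) (𝓘(ℝ, ℝ).prod IN) r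
        (fun p : M × unitInterval => C.arcChart c p.1) (arc π c ×ˢ univ) :=
      ((C.contMDiffOn_arcChart c).of_le hr).comp contMDiff_fst.contMDiffOn fun w hw => hw.1
    refine ((((C.contMDiff_arcEmb c).of_le hr).comp h).comp_contMDiffOn
      (h1.prodMk contMDiff_snd.contMDiffOn)).congr fun w hw => ?_
    simp only [comp_apply]
    rw [← C.ext_arcEmb, C.arcEmb_arcChart hw.1]
  · refine ⟨(π.proj ⁻¹' (arcDisk c R)ᶜ) ×ˢ univ, ((isClosed_arcDisk c R).isOpen_compl.preimage
      π.continuous_proj).prod isOpen_univ, ⟨fun hc => hp ?_, trivial⟩, ?_⟩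
    · obtain ⟨q, hq, e⟩ := hc
      exact ⟨q, ⟨(arcParam_mem c _).1.trans_le hq.1, hq.2.trans_lt (arcParam_mem c _).2⟩, e⟩
    · rw [univ_inter]
      exact contMDiff_fst.contMDiffOn.congr fun w hw => C.ext_of_notMem_arcDisk c (hF w.2) hw.1

/-- Compactly supported isotopies of the product bundle over the line extend by the identity. -/
theorem ext_mem_isotRel0 [Nonempty N] (c : ℝ) {F : unitInterval → Equiv.Perm (ℝ × N)}
    (hF : F ∈ (lineBundle IN Γ).isot0 r) {R : ℝ}
    (hR : ∀ t, F t ∈ supportedOver N (Icc (-R) R)) {R' : ℝ} (hRR : R < R') :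
    (fun t => C.ext c (F t)) ∈ π.isotRel0 r (interior (arcDisk c R'))ᶜ := by
  obtain ⟨⟨h1, h2, h3⟩, h0⟩ := hF
  have h0 : F 0 = 1 := h0
  refine ⟨GammaBundle.mem_isot0_iff.2 ⟨GammaBundle.mem_isot (C.contMDiff_ext c hR h1) ?_
    fun t => ?_, ?_⟩, (arcDisk c R)ᶜ, (isClosed_arcDisk c R).isOpen_compl,
    compl_subset_compl.2 (arcDisk_subset_interior c hRR),
    fun t y hy => C.ext_of_notMem_arcDisk c (hR t) hy⟩
  · have := C.contMDiff_ext c (F := fun t => (F t)⁻¹) (fun t => Subgroup.inv_mem _ (hR t)) h2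
    simpa only [map_inv] using this
  · refine C.isBundleMap_of_forall fun q => ?_
    by_cases hq : circleCover q ∈ circleCover '' Ioo c (c + 1)
    · obtain ⟨q', hq', e⟩ := hq
      obtain ⟨x₀⟩ := ‹Nonempty N›
      obtain ⟨γ, hγ, hid⟩ := C.exists_of_isBundleMap (GammaBundle.IsBundleMap.one π)
        (q := q) (q' := q') (x₀ := x₀) (by rw [id, C.proj_toFun, e])
      obtain ⟨g, hg⟩ := isBundleMap_line_iff.1 (h3 t).2
      obtain ⟨γ', hγ', e'⟩ := hg (arcInv c q')
      refine ⟨arcParam c (g (arcInv c q')), γ' * γ, Γ.mul_mem hγ' hγ, fun x => ?_⟩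
      have h4 : C.toFun (q', γ x) = C.arcEmb c (arcInv c q', γ x) := by
        rw [arcEmb_apply, arcParam_arcInv hq']
      have h5 : C.toFun (q, x) = C.toFun (q', γ x) := hid x
      rw [h5, h4, C.ext_arcEmb, e', arcEmb_apply, Equiv.Perm.mul_apply]
    · exact ⟨q, 1, Γ.one_mem, fun x => C.ext_of_notMem c _ fun hc => hq (by
        have h : π.proj (C.toFun (q, x)) ∈ circleCover '' Ioo c (c + 1) := hc
        rwa [C.proj_toFun] at h)⟩
  · simp only [h0, map_one]

theorem exists_forall_ext_mem_diffRel0 [Nonempty N] (c : ℝ) {f : Equiv.Perm (ℝ × N)}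
    (hf : f ∈ (lineBundle IN Γ).diffC0 r) :
    ∃ R > 0, ∀ R' ≥ R, C.ext c f ∈ π.diffRel0 r (interior (arcDisk c R'))ᶜ := by
  obtain ⟨F, hF, rfl⟩ := hf
  obtain ⟨R, hR, h⟩ := exists_supportedOver hF
  exact ⟨R + 1, by linarith, fun R' hR' =>
    ⟨_, C.ext_mem_isotRel0 c hF.1 h (show R < R' by linarith), rfl⟩⟩

/-- Isotopies with support over a proper closed arc come from compactly supported isotopies of the
product bundle over the line. -/
theorem exists_ext_eq [Nonempty N] {D : Set Circle} (hD : IsClosedArc D) :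
    ∃ c, ∀ f ∈ π.diffRel0 r (interior D)ᶜ, ∃ f' ∈ (lineBundle IN Γ).diffC0 r, C.ext c f' = f := by
  obtain ⟨a, b, hab, hba, rfl⟩ := hD
  set c := (a + b - 1) / 2 with hc
  refine ⟨c, ?_⟩
  rintro _ ⟨G, ⟨⟨⟨h1, h2, h3⟩, h0⟩, U, hU, hDU, hfix⟩, rfl⟩
  have h0 : G 0 = 1 := h0
  have hr : (r : WithTop ℕ∞) ≤ ∞ := by exact_mod_cast le_top
  have hac : a ∈ Ioo c (c + 1) := ⟨by linarith, by linarith⟩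
  have hbc : b ∈ Ioo c (c + 1) := ⟨by linarith, by linarith⟩
  have hfixD : ∀ t y, π.proj y ∉ circleCover '' Icc a b → G t y = y := fun t y hy =>
    hfix t y (hDU fun hi => hy (interior_subset hi))
  have hfixA : ∀ t y, y ∉ arc π c → G t y = y := fun t y hy => hfixD t y fun hi =>
    hy (image_mono (show Icc a b ⊆ Ioo c (c + 1) from fun q hq =>
      ⟨by linarith [hq.1, hac.1], by linarith [hq.2, hbc.2]⟩) hi)
  have hfixA' : ∀ t y, y ∉ arc π c → (G t)⁻¹ y = y := fun t y hy => by
    rw [Equiv.Perm.inv_eq_iff_eq, hfixA t y hy]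
  have hmaps : ∀ t, ∀ y ∈ arc π c, G t y ∈ arc π c := fun t y hy => by
    by_contra hn
    have := hfixA' t _ hn
    rw [Equiv.Perm.inv_eq_iff_eq] at this
    rw [← (G t).injective this] at hn
    exact hn hy
  have hmaps' : ∀ t, ∀ y ∈ arc π c, (G t)⁻¹ y ∈ arc π c := fun t y hy => by
    by_contra hn
    have := hfixA t _ hn
    have h4 : G t ((G t)⁻¹ y) = y := by simp
    rw [h4] at this
    rw [← this] at hn
    exact hn hy
  let F : unitInterval → Equiv.Perm (ℝ × N) := fun t =>
    { toFun := fun z => C.arcChart c (G t (C.arcEmb c z))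
      invFun := fun z => C.arcChart c ((G t)⁻¹ (C.arcEmb c z))
      left_inv := fun z => by
        dsimp only
        rw [C.arcEmb_arcChart (hmaps t _ (C.arcEmb_mem c z))]
        simp [C.arcChart_arcEmb]
      right_inv := fun z => by
        dsimp only
        rw [C.arcEmb_arcChart (hmaps' t _ (C.arcEmb_mem c z))]
        simp [C.arcChart_arcEmb] }
  have eF : ∀ t z, C.arcEmb c (F t z) = G t (C.arcEmb c z) := fun t z =>
    C.arcEmb_arcChart (hmaps t _ (C.arcEmb_mem c z))
  have hι : ContMDiff ((𝓘(ℝ, ℝ).prod IN).prod (𝓡∂ 1)) (IM.prod (𝓡∂ 1)) r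
      (fun p : (ℝ × N) × unitInterval => (C.arcEmb c p.1, p.2)) :=
    (((C.contMDiff_arcEmb c).of_le hr).comp contMDiff_fst).prodMk contMDiff_snd
  have hF : F ∈ (lineBundle IN Γ).isot0 r := by
    refine GammaBundle.mem_isot0_iff.2 ⟨GammaBundle.mem_isot ?_ ?_ fun t => ?_, ?_⟩
    · exact contMDiffOn_univ.1 (((C.contMDiffOn_arcChart c).of_le hr).comp
        (h1.comp hι).contMDiffOn fun p _ => hmaps _ _ (C.arcEmb_mem c p.1))
    · exact contMDiffOn_univ.1 (((C.contMDiffOn_arcChart c).of_le hr).comp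
        (h2.comp hι).contMDiffOn fun p _ => hmaps' _ _ (C.arcEmb_mem c p.1))
    · obtain ⟨x₀⟩ := ‹Nonempty N›
      refine isBundleMap_line_iff.2 ⟨fun q => (F t (q, x₀)).1, fun q => ?_⟩
      obtain ⟨γ, hγ, e⟩ := C.exists_of_isBundleMap (h3 t).2 (q := arcParam c q)
        (q' := arcParam c (F t (q, x₀)).1) (x₀ := x₀) (by
          have := congrArg π.proj (eF t (q, x₀))
          rw [C.proj_arcEmb] at this
          exact this.symm)
      refine ⟨γ, hγ, fun x => (C.arcEmb c).injective ?_⟩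
      rw [eF, arcEmb_apply, arcEmb_apply, e]
    · refine Equiv.ext fun z => (C.arcEmb c).injective ?_
      rw [eF, h0]; rfl
  have hsupp : ∀ t, F t ∈ supportedOver N (Icc (arcInv c a) (arcInv c b)) := fun t z hz => by
    apply (C.arcEmb c).injective
    rw [eF]
    refine hfixD t _ fun hc' => hz ?_
    rw [C.proj_arcEmb] at hc'
    obtain ⟨q, hq, e⟩ := hc'
    have hq' := injOn_circleCover_Ico c (Ioo_subset_Ico_self ⟨by linarith [hq.1, hac.1],
      by linarith [hq.2, hbc.2]⟩) (Ioo_subset_Ico_self (arcParam_mem c z.1)) e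
    have := strictMono_arcParam c
    constructor
    · rw [← this.le_iff_le, arcParam_arcInv hac, ← hq']; exact hq.1
    · rw [← this.le_iff_le, arcParam_arcInv hbc, ← hq']; exact hq.2
  refine ⟨F 1, ⟨F, mem_isotC0_of_forall hF hsupp, rfl⟩, Equiv.ext fun y => ?_⟩
  change C.ext c (F 1) y = G 1 y
  by_cases hy : y ∈ arc π c
  · rw [← C.arcEmb_arcChart hy, C.ext_arcEmb, eF]
  · rw [C.ext_of_notMem c _ hy, hfixA 1 y hy]

theorem diffRel0_le_diff0 (S : Set Circle) : π.diffRel0 r S ≤ π.diff0 r :=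
  Subgroup.map_mono fun _ hF => hF.1

/-- Under the perfectness assumption, an element with support over a proper closed arc is a product
of two commutators supported over arcs. -/
theorem clb_le_two [Nonempty N] (C : TorusChart π) (hstar : AssumptionStar IN Γ r) {D : Set Circle}
    (hD : IsClosedArc D) (f : π.diff0 r) (hf : (f : Equiv.Perm M) ∈ π.diffRel0 r (interior D)ᶜ) :
    π.clb r f ≤ 2 := by
  obtain ⟨c, hc⟩ := C.exists_ext_eq (r := r) hD
  obtain ⟨f', hf', e⟩ := hc f hf
  obtain ⟨a₁, b₁, a₂, b₂, h⟩ := exists_two_commutators_of_isPerfect hstar ⟨f', hf'⟩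
  have key : ∀ a b : (lineBundle IN Γ).diffC0 r, ∃ g ∈ π.ballCommutators r,
      (g : Equiv.Perm M) = C.ext c ((a * b * a⁻¹ * b⁻¹ : (lineBundle IN Γ).diffC0 r)) := by
    intro a b
    obtain ⟨R, hR, ha⟩ := C.exists_forall_ext_mem_diffRel0 c a.2
    obtain ⟨R', hR', hb⟩ := C.exists_forall_ext_mem_diffRel0 c b.2
    have ha := ha _ (le_max_left R R')
    have hb := hb _ (le_max_right R R')
    refine ⟨_, ⟨_, isClosedArc_arcDisk c (lt_max_of_lt_left hR), ⟨_, diffRel0_le_diff0 _ ha⟩,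
      ⟨_, diffRel0_le_diff0 _ hb⟩, ha, hb, rfl⟩, ?_⟩
    simp
  obtain ⟨g₁, h₁, e₁⟩ := key a₁ b₁
  obtain ⟨g₂, h₂, e₂⟩ := key a₂ b₂
  have hfg : f = g₁ * g₂ := by
    apply Subtype.ext
    rw [Subgroup.coe_mul, e₁, e₂, ← map_mul, ← Subgroup.coe_mul, ← h, e]
  rw [hfg]
  refine (wordNorm_mul_le _ _ _).trans ?_
  calc _ ≤ (1 : ℕ∞) + 1 := add_le_add (wordNorm_le_one h₁) (wordNorm_le_one h₂)
    _ = 2 := by norm_num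

end TorusChart

/-! ### Moving points by commutators supported over arcs -/

/-- Extension of an increasing map of an interval to a periodic diffeomorphism of the line which
is the identity near the integer translates of `c`. -/
theorem IsIncr.exists_periodic_extension {r : ℕ∞} {g : ℝ → ℝ} (hg : IsIncr r g) {c p₁ p₂ : ℝ}
    (h1 : c < p₁) (h12 : p₁ ≤ p₂) (h2 : p₂ < c + 1) (h3 : c < g p₁) (h4 : g p₂ < c + 1) :
    ∃ w ∈ goodPerm r, (∀ q, w (q + 1) = w q + 1) ∧ ∃ α β, c < α ∧ α < p₁ ∧ p₂ < β ∧ β < c + 1 ∧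
      (∀ q ∈ Icc p₁ p₂, w q = g q) ∧ ∀ q ∈ Ioo (β - 1) α, w q = q := by
  obtain ⟨a, ha, ε, hε, α, β, k1, k2, k3, k4, k5, k6⟩ := hg.exists_extension h1 h12 h2 h3 h4
  obtain ⟨w, hw, hper, hwa⟩ := (isIncr_of_mem_goodPerm ha).exists_periodic k1 k2 k6
  refine ⟨w, hw, hper, α, β, k1, k3, k4, k2, fun q hq => ?_, fun q hq => ?_⟩
  · rw [hwa q ⟨by linarith [hq.1], by linarith [hq.2]⟩, k5 q ⟨by linarith [hq.1],
      by linarith [hq.2]⟩]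
  · rw [hwa q ⟨hq.1, by linarith [hq.2]⟩, k6 q (Or.inl hq.2.le)]

namespace TorusChart

variable {EM HM EN HN : Type*}
  [NormedAddCommGroup EM] [NormedSpace ℝ EM] [TopologicalSpace HM]
  [NormedAddCommGroup EN] [NormedSpace ℝ EN] [TopologicalSpace HN]
  {IM : ModelWithCorners ℝ EM HM} {IN : ModelWithCorners ℝ EN HN}
  {N : Type*} [TopologicalSpace N] [ChartedSpace HN N] {Γ : Subgroup (Equiv.Perm N)}
  {M : Type*} [TopologicalSpace M] [ChartedSpace HM M]
  {π : GammaBundle IM (𝓡 1) IN Γ M Circle} {r : ℕ∞} (C : TorusChart π)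

/-- Every displacement by less than a full turn is realized by a commutator supported over an
arc. -/
theorem exists_ballCommutator [Nonempty N] (x₁ : ℝ) {δ : ℝ} (h0 : 0 ≤ δ) (h1 : δ < 1) :
    ∃ c ∈ π.ballCommutators r, ∃ F ∈ C.equivIsot r, C.Lifts (F 1) c ∧
      ∀ x, (F 1 (x₁, x)).1 = x₁ - δ := by
  set c := (2 * x₁ - δ - 1) / 2 with hc
  obtain ⟨u, hu, uper, α, β, a1, a2, a3, a4, ue, ufix⟩ :=
    (isIncr_affine (r := r) one_pos (x₁ - δ) x₁).exists_periodic_extension (c := c) (p₁ := x₁)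
      (p₂ := x₁) (by linarith) le_rfl (by linarith) (by linarith) (by linarith)
  obtain ⟨y, hy1, hy2⟩ := exists_between (show x₁ < c + 1 by linarith)
  -- `v` carries the left end of the support of `u` past `x₁`, so that `u` fixes `v⁻¹ x₁`
  obtain ⟨v, hv, vper, α', β', b1, b2, b3, b4, ve, vfix⟩ :=
    (isIncr_affine (r := r) one_pos y α).exists_periodic_extension (c := c) (p₁ := α)
      (p₂ := α) (by linarith) le_rfl (by linarith) (by linarith) (by linarith)
  have hux : u x₁ = x₁ - δ := by rw [ue x₁ ⟨le_rfl, le_rfl⟩]; ring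
  have hvα : v α = y := by rw [ve α ⟨le_rfl, le_rfl⟩]; ring
  have hvc : v c = c := vfix c ⟨by linarith, b1⟩
  have hv1 : v (v⁻¹ x₁) = x₁ := by simp
  have hlt : v⁻¹ x₁ < α := by rw [← hv.2.2.1.lt_iff_lt, hv1, hvα]; exact hy1
  have hgt : c < v⁻¹ x₁ := by rw [← hv.2.2.1.lt_iff_lt, hv1, hvc]; linarith
  have hfix : u⁻¹ (v⁻¹ x₁) = v⁻¹ x₁ := by
    rw [Equiv.Perm.inv_eq_iff_eq, ufix _ ⟨by linarith, hlt⟩]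
  obtain ⟨U, hU, eU⟩ := C.exists_equivBaseIsot hu uper
  obtain ⟨V, hV, eV⟩ := C.exists_equivBaseIsot hv vper
  obtain ⟨A, hA, lA⟩ := C.exists_descent hU
  obtain ⟨B, hB, lB⟩ := C.exists_descent hV
  obtain ⟨D, hD, h⟩ := C.exists_mem_isotRel0 (r := r) (u := max β β' - 1) (v := min α α')
    (by
      have := max_lt a4 b4
      have := lt_min a1 b1
      linarith)
    (by
      have := le_max_left β β'
      have := min_le_left α α'
      linarith)
  have hA' := h _ A hA lA fun t z hz => by
    rw [eU, slide_of_fixed (ufix z.1 ⟨by linarith [hz.1, le_max_left β β'],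
      hz.2.trans_le (min_le_left _ _)⟩)]
  have hB' := h _ B hB lB fun t z hz => by
    rw [eV, slide_of_fixed (vfix z.1 ⟨by linarith [hz.1, le_max_right β β'],
      hz.2.trans_le (min_le_right _ _)⟩)]
  refine ⟨_, ⟨D, hD, ⟨A 1, A, hA, rfl⟩, ⟨B 1, B, hB, rfl⟩, ⟨A, hA', rfl⟩, ⟨B, hB', rfl⟩, rfl⟩,
    U * V * U⁻¹ * V⁻¹, Subgroup.mul_mem _ (Subgroup.mul_mem _ (Subgroup.mul_mem _ hU hV)
      (Subgroup.inv_mem _ hU)) (Subgroup.inv_mem _ hV),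
    (((lA 1).mul (lB 1)).mul (lA 1).inv).mul (lB 1).inv, fun x => ?_⟩
  have eU1 : ∀ z, U 1 z = (u z.1, z.2) := fun z => by rw [eU, Set.Icc.coe_one, slide_one]
  have eV1 : ∀ z, V 1 z = (v z.1, z.2) := fun z => by rw [eV, Set.Icc.coe_one, slide_one]
  have e1 : (V 1)⁻¹ (x₁, x) = (v⁻¹ x₁, x) := by rw [Equiv.Perm.inv_eq_iff_eq, eV1, hv1]
  have e2 : (U 1)⁻¹ (v⁻¹ x₁, x) = (v⁻¹ x₁, x) := by
    rw [Equiv.Perm.inv_eq_iff_eq, eU1, ufix _ ⟨by linarith, hlt⟩]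
  change (U 1 (V 1 ((U 1)⁻¹ ((V 1)⁻¹ (x₁, x))))).1 = x₁ - δ
  rw [e1, e2, eV1, hv1, eU1, hux]

/-- A bound for the commutator length by the displacement of one fiber. -/
theorem clb_le_of_displacement [Nonempty N] (hstar : AssumptionStar IN Γ r) {p : ℝ} {x₀ : N}
    (m : ℕ) : ∀ (f : π.diff0 r), ∀ F ∈ C.equivIsot r, C.Lifts (F 1) f →
      -1 < (F 1 (p, x₀)).1 - p → (F 1 (p, x₀)).1 - p < m + 1 → π.clb r f ≤ m + 4 := by
  induction m with
  | zero =>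
    intro f F hF hf h1 h2
    obtain ⟨D, D', hD, hD', A, hA, B, hB, e⟩ := C.exists_fragmentation hF
      (abs_lt.2 ⟨h1, by simpa using h2⟩) hf
    have e' : f = (⟨A, diffRel0_le_diff0 _ hA⟩ : π.diff0 r) * ⟨B, diffRel0_le_diff0 _ hB⟩ :=
      Subtype.ext e
    rw [e']
    refine (wordNorm_mul_le _ _ _).trans ?_
    calc _ ≤ (2 : ℕ∞) + 2 := add_le_add (clb_le_two C hstar hD _ hA) (clb_le_two C hstar hD' _ hB)
      _ = _ := by norm_num
  | succ m ih =>
    intro f F hF hf h1 h2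
    push_cast at h2
    rcases lt_or_ge ((F 1 (p, x₀)).1 - p) (m + 1) with h3 | h3
    · refine (ih f F hF hf h1 h3).trans ?_
      gcongr
      exact_mod_cast m.le_succ
    set x₁ := (F 1 (p, x₀)).1 with hx₁
    obtain ⟨c, hc, K, hK, lK, eK⟩ := C.exists_ballCommutator (r := r) x₁
      (δ := (x₁ - p - m) / 2) (by linarith) (by linarith)
    have hm : (0 : ℝ) ≤ m := m.cast_nonneg
    have e1 : ((K * F) 1 (p, x₀)).1 = x₁ - (x₁ - p - m) / 2 := eK (F 1 (p, x₀)).2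
    have key := ih (c * f) (K * F) (Subgroup.mul_mem _ hK hF) (lK.mul hf)
      (by rw [e1]; linarith) (by rw [e1]; linarith)
    have hc' : c⁻¹ ∈ π.ballCommutators r := by
      obtain ⟨D, hD, a, b, ha, hb, rfl⟩ := hc
      exact ⟨D, hD, b, a, hb, ha, by group⟩
    have ef : f = c⁻¹ * (c * f) := by group
    rw [ef]
    refine (wordNorm_mul_le _ _ _).trans ?_
    calc _ ≤ (1 : ℕ∞) + (m + 4) := add_le_add (wordNorm_le_one hc') key
      _ = _ := by push_cast; ring

/-- The winding number of an isotopy is the displacement of its lift. -/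
theorem nu_eq [Nonempty N] {G : unitInterval → Equiv.Perm M} (hG : G ∈ π.isot0 r)
    {F : unitInterval → Equiv.Perm (ℝ × N)} (hF : F ∈ C.equivIsot r)
    (h : ∀ t, C.Lifts (F t) (G t)) (q : ℝ) (x : N) :
    π.nu (circleCover q) G = (F 1 (q, x)).1 - q := by
  obtain ⟨⟨⟨h1, -, -⟩, h0⟩, -⟩ := C.mem_equivIsot.1 hF
  have h0 : F 0 = 1 := h0
  have hl : Continuous fun t => (F t (q, x)).1 :=
    continuous_fst.comp (h1.continuous.comp (Continuous.prodMk_right (q, x)))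
  rw [GammaBundle.nu, windingNumber_eq hl, h0]
  · rfl
  · intro t
    have := (hG.1.2.2 t).2.baseMap_proj (C.toFun (q, x))
    rw [C.proj_toFun, h t, C.proj_toFun] at this
    exact this.symm

/-- After composition with a loop of isotopies, which does not change the end point, the
displacement of the fiber over `p` lies between `0` and `k`. -/
theorem clb_le_kInv_add_three [Nonempty N] (C : TorusChart π) (hstar : AssumptionStar IN Γ r)
    {p : Circle} (hk : 1 ≤ π.kInv r p) (f : π.diff0 r) : π.clb r f ≤ (π.kInv r p : ℕ∞) + 3 := by
  obtain ⟨q, rfl⟩ := circleCover_surjective p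
  obtain ⟨x₀⟩ := ‹Nonempty N›
  have hmem := Nat.sInf_mem (Nat.nonempty_of_pos_sInf (Nat.lt_of_lt_of_le Nat.one_pos hk))
  change π.nu _ '' _ = {a : ℝ | ∃ n : ℤ, a = (π.kInv r (circleCover q) : ℝ) * n} at hmem
  obtain ⟨m, hm⟩ := Nat.exists_eq_add_of_le' hk
  rw [hm] at hmem ⊢
  obtain ⟨_, A, hA, rfl⟩ := f
  obtain ⟨F, hF, lF⟩ := C.exists_lift hA
  obtain ⟨g, -, gper, eg⟩ := C.exists_base hF 1
  set d := (F 1 (q, x₀)).1 - q with hd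
  have hm0 : (0 : ℝ) < ((m + 1 : ℕ) : ℝ) := by positivity
  set n := ⌊d / ((m + 1 : ℕ) : ℝ)⌋ with hn
  obtain ⟨B, hB, eB⟩ := hmem.symm.subset ⟨-n, rfl⟩
  obtain ⟨K, hK, lK⟩ := C.exists_lift hB.1
  rw [C.nu_eq hB.1 hK lK q x₀] at eB
  have hB1 : B 1 = 1 := hB.2
  have e1 : ((F * K) 1 (q, x₀)).1 - q = d - ((m + 1 : ℕ) : ℝ) * n := by
    have h1 : (K 1 (q, x₀)).1 = q + ((-((m + 1 : ℕ) * n) : ℤ) : ℝ) := by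
      push_cast at eB ⊢
      linarith
    change (F 1 (K 1 (q, x₀))).1 - q = _
    rw [eg, h1, add_int_of_periodic gper, hd, eg]
    push_cast
    ring
  have h1 : (n : ℝ) * ((m + 1 : ℕ) : ℝ) ≤ d := (le_div_iff₀ hm0).1 (Int.floor_le _)
  have h2 : d < ((n : ℝ) + 1) * ((m + 1 : ℕ) : ℝ) := (div_lt_iff₀ hm0).1 (Int.lt_floor_add_one _)
  have lFK : C.Lifts ((F * K) 1) (A 1) := by
    have := (lF 1).mul (lK 1)
    rwa [hB1, mul_one] at this
  refine (C.clb_le_of_displacement hstar m ⟨A 1, A, hA, rfl⟩ _ (Subgroup.mul_mem _ hF hK) lFK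
    (p := q) (x₀ := x₀) ?_ ?_).trans_eq ?_
  · rw [e1]; linarith
  · rw [e1]
    have : ((m + 1 : ℕ) : ℝ) = m + 1 := by push_cast; ring
    linarith
  · push_cast; ring

/-! ### Conjugates of an element that moves a fiber -/

/-- An element outside `Ker P` displaces the part over a short arc. -/
theorem exists_displaced [Nonempty N] {g : π.diff0 r} (hg : g ∉ (π.P r).ker) :
    ∃ q₀, ∃ ε > 0, ∀ z w : ℝ × N, z.1 ∈ Ioo (q₀ - ε) (q₀ + ε) → w.1 ∈ Ioo (q₀ - ε) (q₀ + ε) →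
      (g : Equiv.Perm M) (C.toFun z) ≠ C.toFun w := by
  obtain ⟨_, A, hA, rfl⟩ := g
  obtain ⟨F, hF, lF⟩ := C.exists_lift hA
  obtain ⟨γ, hγ, -, eγ⟩ := C.exists_base hF 1
  have hproj : ∀ z, π.proj (A 1 (C.toFun z)) = circleCover (γ z.1) := fun z => by
    rw [lF 1 z, C.proj_toFun, eγ]
  obtain ⟨q₀, hq₀⟩ : ∃ q, circleCover (γ q) ≠ circleCover q := by
    by_contra! hc
    refine hg (MonoidHom.mem_ker.2 (Equiv.ext fun b => ?_))
    obtain ⟨q, rfl⟩ := circleCover_surjective b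
    obtain ⟨x₀⟩ := ‹Nonempty N›
    have := (hA.1.2.2 1).2.baseMap_proj (C.toFun (q, x₀))
    rw [C.proj_toFun] at this
    exact this.trans ((hproj _).trans (hc q))
  have hopen : IsOpen {s : ℝ × ℝ | circleCover (γ s.1) ≠ circleCover s.2} :=
    isOpen_ne_fun (continuous_circleCover.comp (hγ.1.continuous.comp continuous_fst))
      (continuous_circleCover.comp continuous_snd)
  obtain ⟨ε, hε, hb⟩ := Metric.isOpen_iff.1 hopen (q₀, q₀) hq₀
  rw [← ball_prod_same, Real.ball_eq_Ioo] at hb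
  refine ⟨q₀, ε, hε, fun z w hz hw h => hb (mk_mem_prod hz hw) ?_⟩
  have := congrArg π.proj h
  rw [C.proj_toFun] at this
  exact (hproj z).symm.trans this

/-- A proper closed arc can be carried by a rotation and a contraction into any open interval. -/
theorem exists_diff0_carrying [Nonempty N] {a b : ℝ} (hab : a < b) (hba : b < a + 1) (q₀ : ℝ)
    {ε : ℝ} (hε : 0 < ε) : ∃ h : π.diff0 r, ∀ q ∈ Icc a b, ∀ x, ∃ q' ∈ Ioo (q₀ - ε) (q₀ + ε),
      (h : Equiv.Perm M) (C.toFun (q, x)) = C.toFun (q', x) := by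
  obtain ⟨τ, hτ, eτ⟩ := (isIncr_affine (r := r) one_pos (q₀ - a) 0).exists_goodPerm
    (C := |q₀ - a|) (fun q => by simp)
  set η := min (ε / 2) 1 with hη
  have hη0 : 0 < η := lt_min (by linarith) one_pos
  have hη1 : η ≤ ε / 2 := min_le_left _ _
  have hη2 : η ≤ 1 := min_le_right _ _
  have hba0 : 0 < b - a := sub_pos.2 hab
  have hba1 : 0 < 1 - (b - a) := by linarith
  obtain ⟨w, hw, wper, -, -, -, -, -, -, ew, -⟩ :=
    (isIncr_affine (r := r) hη0 q₀ q₀).exists_periodic_extension (c := q₀ - (1 - (b - a)) / 2)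
      (p₁ := q₀) (p₂ := q₀ + (b - a)) (by linarith) (by linarith) (by linarith) (by linarith)
      (by nlinarith)
  obtain ⟨F, hF, eF⟩ := C.exists_equivBaseIsot (Subgroup.mul_mem _ hw hτ) fun q => by
    rw [Equiv.Perm.mul_apply, Equiv.Perm.mul_apply, ← wper, eτ]
    congr 1; ring
  obtain ⟨G, hG, lG⟩ := C.exists_descent hF
  refine ⟨⟨G 1, G, hG, rfl⟩, fun q hq x => ⟨(w * τ) q, ?_, ?_⟩⟩
  · have e1 : τ q = q₀ + (q - a) := by rw [eτ]; ring
    rw [Equiv.Perm.mul_apply, e1, ew _ ⟨by linarith [hq.1], by linarith [hq.2]⟩]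
    have h1 : 0 ≤ q - a := by linarith [hq.1]
    have h2 : q - a ≤ 1 := by linarith [hq.2]
    constructor <;> nlinarith
  · refine (lG 1 (q, x)).trans ?_
    rw [eF, Set.Icc.coe_one, slide_one]

/-- A conjugate `k` of `g` displaces the part over the given arc, so `k a k⁻¹` and `b` have disjoint
supports if `a` and `b` have support over that arc. -/
theorem conjNorm_le_four [Nonempty N] (C : TorusChart π) {g : π.diff0 r} (hg : g ∉ (π.P r).ker)
    {c : π.diff0 r} (hc : c ∈ π.ballCommutators r) : conjNorm g c ≤ 4 := by
  obtain ⟨_, ⟨a₀, b₀, hab, hba, rfl⟩, a, b, ha, hb, rfl⟩ := hc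
  obtain ⟨q₀, ε, hε, hdis⟩ := C.exists_displaced hg
  obtain ⟨h, hh⟩ := C.exists_diff0_carrying (r := r) hab hba q₀ hε
  have hsupp : ∀ f ∈ π.diffRel0 r (interior (circleCover '' Icc a₀ b₀))ᶜ, ∀ y, f y ≠ y →
      ∃ q ∈ Icc a₀ b₀, ∃ x, C.toFun (q, x) = y := by
    rintro _ ⟨G, ⟨-, U, -, hU, hfix⟩, rfl⟩ y hy
    by_contra! hn
    refine hy (hfix 1 y (hU fun hi => ?_))
    obtain ⟨q, hq, e⟩ := interior_subset hi
    obtain ⟨x, hx⟩ := C.exists_fiber e.symm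
    exact hn q hq x hx
  refine conjNorm_commutator_le h⁻¹ ?_
  rw [inv_inv]
  refine Subtype.ext (Equiv.Perm.Disjoint.commute fun y => ?_).eq
  by_contra! hy
  obtain ⟨h1, h2⟩ := hy
  obtain ⟨q, hq, x, rfl⟩ := hsupp _ hb _ h2
  set k : Equiv.Perm M := ((h⁻¹ * g * h : π.diff0 r) : Equiv.Perm M) with hk
  obtain ⟨q', hq', x', e'⟩ := hsupp _ ha (k⁻¹ (C.toFun (q, x))) fun hf => h1 (by
    change k ((a : Equiv.Perm M) (k⁻¹ (C.toFun (q, x)))) = _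
    rw [hf]; simp)
  obtain ⟨s, hs, es⟩ := hh q hq x
  obtain ⟨s', hs', es'⟩ := hh q' hq' x'
  refine hdis (s', x') (s, x) hs' hs ?_
  rw [← es', ← es, e', hk]
  simp

theorem conjNorm_le [Nonempty N] (C : TorusChart π) {g : π.diff0 r} (hg : g ∉ (π.P r).ker)
    (f : π.diff0 r) : conjNorm g f ≤ 4 * π.clb r f :=
  wordNorm_le_mul (n := 4) (by norm_num) (fun _ hc => conjNorm_le_four C hg hc) f

/-- The rotation by a half turn lifts to the bundle. -/
theorem exists_notMem_ker [Nonempty N] (C : TorusChart π) : ∃ g : π.diff0 r, g ∉ (π.P r).ker := by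
  obtain ⟨τ, hτ, eτ⟩ := (isIncr_affine (r := r) one_pos (1 / 2) 0).exists_goodPerm
    (C := 1 / 2) (fun q => by simp)
  obtain ⟨F, hF, eF⟩ := C.exists_equivBaseIsot hτ fun q => by rw [eτ]; ring
  obtain ⟨G, hG, lG⟩ := C.exists_descent hF
  refine ⟨⟨G 1, G, hG, rfl⟩, fun hker => ?_⟩
  obtain ⟨x₀⟩ := ‹Nonempty N›
  have h1 : π.baseMap (G 1) (circleCover 0) = circleCover 0 :=
    congrArg (fun e : Equiv.Perm Circle => e (circleCover 0)) (MonoidHom.mem_ker.1 hker)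
  have h2 := (hG.1.2.2 1).2.baseMap_proj (C.toFun (0, x₀))
  rw [C.proj_toFun, lG 1, C.proj_toFun, eF, Set.Icc.coe_one, slide_one, h1, eτ] at h2
  have := eq_of_circleCover_eq h2 (by norm_num)
  norm_num at this

end TorusChart

theorem mainTheorem2
    {EM HM EN HN : Type*}
    [NormedAddCommGroup EM] [NormedSpace ℝ EM] [FiniteDimensional ℝ EM] [TopologicalSpace HM]
    [NormedAddCommGroup EN] [NormedSpace ℝ EN] [FiniteDimensional ℝ EN] [TopologicalSpace HN]
    (IM : ModelWithCorners ℝ EM HM) (IN : ModelWithCorners ℝ EN HN)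
    {M N : Type*}
    [TopologicalSpace M] [ChartedSpace HM M] [IsManifold IM ∞ M] [T2Space M]
    [SecondCountableTopology M]
    [TopologicalSpace N] [ChartedSpace HN N] [IsManifold IN ∞ N] [T2Space N]
    [SecondCountableTopology N] [Nonempty N]
    (Γ : Subgroup (Equiv.Perm N)) (hΓ : Γ ≤ diffGroup IN N ∞)
    (π : GammaBundle IM (𝓡 1) IN Γ M Circle) (r : ℕ∞) (p : Circle)
    (hk : 1 ≤ π.kInv r p) (hstar : AssumptionStar IN Γ r) :
    normDiam (π.clb r) ≤ (π.kInv r p : ℕ∞) + 3 ∧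
    (∀ g : π.diff0 r, g ∉ (π.P r).ker → ∀ f : π.diff0 r, conjNorm g f ≤ 4 * π.clb r f) ∧
    IsUniformlySimpleRel (π.P r).ker ∧
    IsBoundedGroup (π.diff0 r) ∧
    IsUniformlyPerfect (π.diff0 r) := by
  obtain ⟨C⟩ := nonempty_torusChart π hΓ
  have hclb : ∀ f : π.diff0 r, π.clb r f ≤ (π.kInv r p : ℕ∞) + 3 :=
    fun f => C.clb_le_kInv_add_three hstar hk f
  have hconj : ∀ g : π.diff0 r, g ∉ (π.P r).ker → ∀ f : π.diff0 r,
      conjNorm g f ≤ ((4 * (π.kInv r p + 3) : ℕ) : ℕ∞) := fun g hg f => by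
    refine (C.conjNorm_le hg f).trans ?_
    push_cast
    gcongr
    exact hclb f
  refine ⟨iSup_le hclb, fun g hg f => C.conjNorm_le hg f, ⟨_, hconj⟩, fun q hq => ?_, ?_⟩
  · obtain ⟨g, hg⟩ := C.exists_notMem_ker (r := r)
    exact ⟨_, fun f => hq.le_of_conjNorm_le (hconj g hg f)⟩
  · have hsub : π.ballCommutators r ⊆ commutatorSet (π.diff0 r) := by
      rintro _ ⟨-, -, a, b, -, -, rfl⟩
      exact ⟨a, b, rfl⟩
    refine (iSup_le fun f => (wordNorm_anti hsub f).trans (hclb f)).trans_lt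
      (b := (π.kInv r p : ℕ∞) + 3) ?_
    exact_mod_cast ENat.natCast_lt_top (π.kInv r p + 3)
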